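/- Let $\mathbb H$ be the quaternions and $\mathbb S=\{J\in\mathbb H: J^2=-1\}$. For an open set $D\subseteq\mathbb C^2$ invariant under complex conjugation in each variable put $\Omega_D=\{(a_1+b_1J_1,\,a_2+b_2J_2): (a_1+ib_1,a_2+ib_2)\in D,\ J_1,J_2\in\mathbb S\}$; such sets are called circular. A function $g:\Omega_D\to\mathbb H$ is slice regular if $$g(a_1+b_1J_1,a_2+b_2J_2)=F_0+J_1F_1+J_2F_2+J_1J_2F_{12}\quad\text{at }(a_1+ib_1,a_2+ib_2),$$ where $F=F_0+e_1F_1+e_2F_2+e_1e_2F_{12}:D\to\mathbb H\otimes\mathbb R_2$ is $C^1$ ($\mathbb R_2$ being the Clifford algebra with $e_1^2=e_2^2=-1$, $e_1e_2=-e_2e_1$), $F_0,F_1,F_2,F_{12}$ are respectively even-even, odd-even, even-odd, odd-odd in $(b_1,b_2)$, and $\partial F/\partial a_1+e_1\,\partial F/\partial b_1=0$, $\partial F/\partial a_2+(\partial F/\partial b_2)\,e_2=0$. A map from an open subset of $\mathbb H^2$ to $\mathbb H^2$ is slice regular if near every point its two components are restrictions of slice regular functions on circular open sets containing that point. A slice-quaternionic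 atlas on a Hausdorff second countable space consists of charts onto circular open subsets of $\mathbb H^2$, covering the space, with smooth and slice regular changes of charts; maps are slice-quaternionic if they are slice regular in the charts. An affine atlas is one whose changes of charts are locally of the form $x\mapsto xA+b$ with $A\in GL(2,\mathbb H)$, $b\in\mathbb H^2$ (row vectors). A slice-quaternionic Hopf surface is a space with a slice-quaternionic atlas whose universal covering is $\mathbb H^2\setminus\{(0,0)\}$, by a slice-quaternionic covering map, and whose fundamental group is $\mathbb Z$. Theorem. Let $p\ge1$ be an integer and let $\alpha,\beta,\lambda\in\mathbb H$ satisfy $0<|\alpha|\le|\beta|<1$ and $(\alpha-\beta^p)\lambda=0$. Put $f(z,w)=(z\alpha+w^p\lambda,\;w\beta)$, a bijection of $\mathbb H^2\setminus\{(0,0)\}$, and $\Gamma=\{f^{\circ k}:k\in\mathbb Z\}$. Assume that one of the following holds. - Case A: (A.1) $\lambda=0$ and $\alpha=\beta$; or (A.2) $\lambda=0$ and $\alpha\ne\beta$; or (A.3) $\lambda\ne0$, $p=1$ and $\alpha=\beta$. - Case B: $\lambda\neq0$, $p>1$, $\beta\in\mathbb R$ and $\alpha=\beta^p$. Then every element of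 $\Gamma$ is a slice regular automorphism of $\mathbb H^2\setminus\{(0,0)\}$, and $X=(\mathbb H^2\setminus\{(0,0)\})/\Gamma$, with the atlas $\mathcal A$ of all local inverses, defined on images of circular open sets, of the projection $\pi:\mathbb H^2\setminus\{(0,0)\}\to X$, is a slice-quaternionic Hopf surface with universal covering $\pi$. The slice-quaternionic structure of $X$ admits an affine structure, i.e. there is an affine atlas $\mathcal B$ on $X$ such that $\mathcal A\cup\mathcal B$ is a slice-quaternionic atlas, if and only if case A holds. The same equivalence holds if one only asks that $X$ have an affine atlas whose coordinate maps are slice regular in the charts of $\mathcal A$. -/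

import Mathlib

open scoped Quaternion ContDiff Topology

noncomputable section

/-- The quaternionic plane `ℍ²`. -/
abbrev H2 : Type := ℍ[ℝ] × ℍ[ℝ]

/-! ### Slice regular functions of two quaternionic variables -/

/-- The sphere of imaginary units `{J : J² = -1}` of `ℍ`. -/
def imagUnits : Set ℍ[ℝ] := {J | J * J = -1}

/-- The point `a + b J` of `ℍ` attached to `a + i b ∈ ℂ` and `J`. -/
def sliceEmb (J : ℍ[ℝ]) (z : ℂ) : ℍ[ℝ] := (z.re : ℍ[ℝ]) + z.im • J

/-- Invariance under complex conjugation in each of the two variables. -/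
def ConjInvariant (D : Set (ℂ × ℂ)) : Prop :=
  ∀ z ∈ D, (star z.1, z.2) ∈ D ∧ (z.1, star z.2) ∈ D

/-- The circular subset `Ω_D` of `ℍ²` associated with `D ⊆ ℂ²`. -/
def circularization (D : Set (ℂ × ℂ)) : Set H2 :=
  {x | ∃ z ∈ D, ∃ J₁ ∈ imagUnits, ∃ J₂ ∈ imagUnits, x = (sliceEmb J₁ z.1, sliceEmb J₂ z.2)}

/-- Circular subsets of `ℍ²`. -/
def IsCircular (Ω : Set H2) : Prop :=
  ∃ D : Set (ℂ × ℂ), ConjInvariant D ∧ Ω = circularization D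

/-- The real vector space `ℍ ⊗ ℝ₂`, where `ℝ₂` is the Clifford algebra with `e₁² = e₂² = -1`,
`e₁ e₂ = - e₂ e₁`; the quadruple `(a, b, c, d)` stands for `a + e₁ b + e₂ c + e₁ e₂ d`. -/
abbrev StemSpace : Type := ℍ[ℝ] × ℍ[ℝ] × ℍ[ℝ] × ℍ[ℝ]

/-- Multiplication by `e₁` on the left:
`e₁ (a + e₁ b + e₂ c + e₁₂ d) = -b + e₁ a - e₂ d + e₁₂ c`. -/
def e1Left (v : StemSpace) : StemSpace := (-v.2.1, v.1, -v.2.2.2, v.2.2.1)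

/-- Multiplication by `e₂` on the right:
`(a + e₁ b + e₂ c + e₁₂ d) e₂ = -c - e₁ d + e₂ a + e₁₂ b`. -/
def e2Right (v : StemSpace) : StemSpace := (-v.2.2.1, -v.2.2.2, v.1, v.2.1)

/-- Stem functions of class `C¹` on the open conjugation invariant set `D` that are
holomorphic, i.e. `∂F/∂α₁ + e₁ ∂F/∂β₁ = 0` and `∂F/∂α₂ + (∂F/∂β₂) e₂ = 0`, where
`z_h = α_h + i β_h`. The conditions `parity₁`, `parity₂` say that `F₀, F₁, F₂, F₁₂` are
even-even, odd-even, even-odd, odd-odd in `(β₁, β₂)`. -/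
structure IsHolomorphicStem (D : Set (ℂ × ℂ)) (F : ℂ × ℂ → StemSpace) : Prop where
  isOpen : IsOpen D
  conjInvariant : ConjInvariant D
  parity₁ : ∀ z ∈ D, F (star z.1, z.2) =
    ((F z).1, -(F z).2.1, (F z).2.2.1, -(F z).2.2.2)
  parity₂ : ∀ z ∈ D, F (z.1, star z.2) =
    ((F z).1, (F z).2.1, -(F z).2.2.1, -(F z).2.2.2)
  contDiffOn : ContDiffOn ℝ 1 F D
  dbar₁ : ∀ z ∈ D, fderiv ℝ F z (1, 0) + e1Left (fderiv ℝ F z (Complex.I, 0)) = 0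
  dbar₂ : ∀ z ∈ D, fderiv ℝ F z (0, 1) + e2Right (fderiv ℝ F z (0, Complex.I)) = 0

/-- `g` is (left) slice regular on the circular open set `Ω`: it is there the slice function
`F₀ + J₁ F₁ + J₂ F₂ + J₁ J₂ F₁₂` induced by a holomorphic stem function. -/
def SliceRegularOnCircular (g : H2 → ℍ[ℝ]) (Ω : Set H2) : Prop :=
  ∃ (D : Set (ℂ × ℂ)) (F : ℂ × ℂ → StemSpace), IsHolomorphicStem D F ∧ Ω = circularization D ∧
    ∀ z ∈ D, ∀ J₁ ∈ imagUnits, ∀ J₂ ∈ imagUnits,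
      g (sliceEmb J₁ z.1, sliceEmb J₂ z.2) =
        (F z).1 + J₁ * (F z).2.1 + J₂ * (F z).2.2.1 + J₁ * J₂ * (F z).2.2.2

/-- A map `g` between open parts of `ℍ²` is slice regular at `x` if near `x` each of its two
components is the restriction of a slice regular function defined on a circular open set
containing `x`. -/
def SliceRegularAt (g : H2 → H2) (x : H2) : Prop :=
  ∃ (Ω : Set H2) (G : H2 → H2), x ∈ Ω ∧
    SliceRegularOnCircular (fun y => (G y).1) Ω ∧ SliceRegularOnCircular (fun y => (G y).2) Ω ∧
    g =ᶠ[𝓝 x] G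

/-- Slice regular maps on an open, not necessarily circular, subset of `ℍ²`. -/
def SliceRegularMapOn (g : H2 → H2) (V : Set H2) : Prop := ∀ x ∈ V, SliceRegularAt g x

/-! ### Slice-quaternionic and affine structures on surfaces -/

section Structures

variable {X : Type*} [TopologicalSpace X]

/-- A slice-quaternionic atlas: charts onto circular open subsets of `ℍ²`, covering `X`, with
smooth and slice regular changes of charts. -/
structure IsSliceQuaternionicAtlas (𝒜 : Set (OpenPartialHomeomorph X H2)) : Prop where
  covers : ∀ x : X, ∃ e ∈ 𝒜, x ∈ e.source
  circular : ∀ e ∈ 𝒜, IsCircular e.target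
  smooth : ∀ e ∈ 𝒜, ∀ e' ∈ 𝒜, ContDiffOn ℝ ∞ (e.symm.trans e') (e.symm.trans e').source
  sliceRegular : ∀ e ∈ 𝒜, ∀ e' ∈ 𝒜, SliceRegularMapOn (e.symm.trans e') (e.symm.trans e').source

/-- The map `x ↦ x A + b` of `ℍ²` (row vectors, coefficients on the right). -/
def affineH2 (A : Matrix (Fin 2) (Fin 2) ℍ[ℝ]) (b : H2) (x : H2) : H2 :=
  (x.1 * A 0 0 + x.2 * A 1 0 + b.1, x.1 * A 0 1 + x.2 * A 1 1 + b.2)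

/-- A (quaternionic) affine atlas: charts with values in `ℍ²`, covering `X`, whose changes of
charts are locally of the form `x ↦ x A + b` with `A ∈ GL(2, ℍ)`, `b ∈ ℍ²`. -/
structure IsAffineAtlas (𝒜 : Set (OpenPartialHomeomorph X H2)) : Prop where
  covers : ∀ x : X, ∃ e ∈ 𝒜, x ∈ e.source
  affine : ∀ e ∈ 𝒜, ∀ e' ∈ 𝒜, ∀ y ∈ (e.symm.trans e').source,
    ∃ (A : (Matrix (Fin 2) (Fin 2) ℍ[ℝ])ˣ) (b : H2), ⇑(e.symm.trans e') =ᶠ[𝓝 y] affineH2 A b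

/-- The slice-quaternionic structure given by the atlas `𝒜` admits an affine structure: some
affine atlas forms, together with `𝒜`, a slice-quaternionic atlas. -/
def AdmitsAffineStructure (𝒜 : Set (OpenPartialHomeomorph X H2)) : Prop :=
  ∃ ℬ : Set (OpenPartialHomeomorph X H2), IsAffineAtlas ℬ ∧ IsSliceQuaternionicAtlas (𝒜 ∪ ℬ)

/-- A weaker property: there is an affine atlas whose coordinate maps, read in the charts of
`𝒜`, are slice regular. -/
def AdmitsSliceRegularAffineCharts (𝒜 : Set (OpenPartialHomeomorph X H2)) : Prop :=
  ∃ ℬ : Set (OpenPartialHomeomorph X H2), IsAffineAtlas ℬ ∧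
    ∀ e ∈ 𝒜, ∀ e' ∈ ℬ, SliceRegularMapOn (e.symm.trans e') (e.symm.trans e').source

end Structures

/-! ### The punctured plane and the quotients -/

/-- `ℍ² ∖ {(0,0)}`. -/
abbrev PuncturedH2 : Type := {x : H2 // x ≠ 0}

/-- Slice regularity of a map defined on an open subset `U` of `ℍ² ∖ {(0,0)}`. -/
def SliceRegularOnPunctured (g : PuncturedH2 → H2) (U : Set PuncturedH2) : Prop :=
  ∃ G : H2 → H2, ∀ y ∈ U, G y = g y ∧ SliceRegularAt G y

/-- `X` with the atlas `𝒜` is a slice-quaternionic (primary) Hopf surface with universal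
covering `q : ℍ² ∖ {(0,0)} → X`: it is a (Hausdorff, second countable) slice-quaternionic
manifold, `q` is a covering map and a slice-quaternionic map, its total space is simply
connected, and the fundamental group of `X` is infinite cyclic. -/
structure IsHopfSurface {X : Type*} [TopologicalSpace X]
    (𝒜 : Set (OpenPartialHomeomorph X H2)) (q : PuncturedH2 → X) : Prop where
  t2 : T2Space X
  secondCountable : SecondCountableTopology X
  atlas : IsSliceQuaternionicAtlas 𝒜
  covering : IsCoveringMap q
  surjective : Function.Surjective q
  simplyConnected : SimplyConnectedSpace PuncturedH2
  sliceQuaternionic : ∀ e ∈ 𝒜, SliceRegularOnPunctured (fun y => e (q y)) (q ⁻¹' e.source)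
  fundamentalGroup : ∀ x : X, Nonempty (FundamentalGroup X x ≃* Multiplicative ℤ)

/-- `f(z,w) = (z α + w^p λ, w β)`. -/
def hopfMap (p : ℕ) (α β l : ℍ[ℝ]) (x : H2) : H2 := (x.1 * α + x.2 ^ p * l, x.2 * β)

/-- `f` as a bijection of `ℍ² ∖ {(0,0)}` onto itself. -/
def hopfPerm (p : ℕ) (α β l : ℍ[ℝ]) (hp : p ≠ 0) (hα : 0 < ‖α‖) (hβ : 0 < ‖β‖) :
    Equiv.Perm PuncturedH2 where
  toFun x := ⟨hopfMap p α β l x.1, by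
    have hα' : α ≠ 0 := norm_pos_iff.mp hα
    have hβ' : β ≠ 0 := norm_pos_iff.mp hβ
    obtain ⟨⟨z, w⟩, hx⟩ := x
    intro h
    simp only [hopfMap, Prod.mk_eq_zero, mul_eq_zero, hβ', or_false] at h
    obtain ⟨h1, rfl⟩ := h
    simp only [ne_eq, hp, not_false_eq_true, zero_pow, zero_mul, add_zero, mul_eq_zero, hα',
      or_false] at h1
    exact hx (by simp [h1])⟩
  invFun x := ⟨((x.1.1 - (x.1.2 * β⁻¹) ^ p * l) * α⁻¹, x.1.2 * β⁻¹), by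
    have hα' : α ≠ 0 := norm_pos_iff.mp hα
    have hβ' : β ≠ 0 := norm_pos_iff.mp hβ
    obtain ⟨⟨z, w⟩, hx⟩ := x
    intro h
    simp only [Prod.mk_eq_zero, mul_eq_zero, inv_eq_zero, hα', hβ', or_false] at h
    obtain ⟨h1, rfl⟩ := h
    simp only [zero_mul, ne_eq, hp, not_false_eq_true, zero_pow, sub_zero] at h1
    exact hx (by simp [h1])⟩
  left_inv x := by
    have hα' : α ≠ 0 := norm_pos_iff.mp hα
    have hβ' : β ≠ 0 := norm_pos_iff.mp hβ
    ext1
    simp [hopfMap, hα', hβ']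
  right_inv x := by
    have hα' : α ≠ 0 := norm_pos_iff.mp hα
    have hβ' : β ≠ 0 := norm_pos_iff.mp hβ
    ext1
    simp [hopfMap, hα', hβ']

/-- The group `Γ = {f^k : k ∈ ℤ}` of bijections of `ℍ² ∖ {(0,0)}`. -/
abbrev hopfGroup (p : ℕ) (α β l : ℍ[ℝ]) (hp : p ≠ 0) (hα : 0 < ‖α‖) (hβ : 0 < ‖β‖) :
    Subgroup (Equiv.Perm PuncturedH2) :=
  Subgroup.zpowers (hopfPerm p α β l hp hα hβ)

/-- The quotient space `(ℍ² ∖ {(0,0)}) / Γ`. -/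
abbrev HopfQuotient (p : ℕ) (α β l : ℍ[ℝ]) (hp : p ≠ 0) (hα : 0 < ‖α‖) (hβ : 0 < ‖β‖) : Type :=
  Quotient (MulAction.orbitRel (hopfGroup p α β l hp hα hβ) PuncturedH2)

/-- The projection `ℍ² ∖ {(0,0)} → (ℍ² ∖ {(0,0)}) / Γ`. -/
def hopfProj (p : ℕ) (α β l : ℍ[ℝ]) (hp : p ≠ 0) (hα : 0 < ‖α‖) (hβ : 0 < ‖β‖)
    (x : PuncturedH2) : HopfQuotient p α β l hp hα hβ :=
  Quotient.mk (MulAction.orbitRel (hopfGroup p α β l hp hα hβ) PuncturedH2) x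

/-- The atlas of the quotient structure: its charts are the local inverses of the projection,
defined on the images of circular open subsets of `ℍ² ∖ {(0,0)}`. -/
def hopfAtlas (p : ℕ) (α β l : ℍ[ℝ]) (hp : p ≠ 0) (hα : 0 < ‖α‖) (hβ : 0 < ‖β‖) :
    Set (OpenPartialHomeomorph (HopfQuotient p α β l hp hα hβ) H2) :=
  {e | IsCircular e.target ∧
    ∀ y ∈ e.target, ∃ hy : y ≠ 0, e.symm y = hopfProj p α β l hp hα hβ ⟨y, hy⟩}

/-! ### The cases -/

/-- Case A: (A.1) `λ = 0`, `α = β`; (A.2) `λ = 0`, `α ≠ β`; (A.3) `λ ≠ 0`, `p = 1`, `α = β`. -/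
def HopfCaseA (p : ℕ) (α β l : ℍ[ℝ]) : Prop :=
  (l = 0 ∧ α = β) ∨ (l = 0 ∧ α ≠ β) ∨ (l ≠ 0 ∧ p = 1 ∧ α = β)

/-- Case B: `λ ≠ 0`, `p > 1`, `β` real, `α = β^p`. -/
def HopfCaseB (p : ℕ) (α β l : ℍ[ℝ]) : Prop :=
  l ≠ 0 ∧ 1 < p ∧ (∃ r : ℝ, β = (r : ℍ[ℝ])) ∧ α = β ^ p

end

/-!
Under either hypothesis the iterates of `f` have the form `(z α ^ k + w ^ p c, w β ^ k)`, so `Γ` is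
an infinite cyclic group of slice regular maps; `f` contracts towards the origin, hence `Γ` acts
freely and properly discontinuously on the simply connected space `ℍ² ∖ {0}`. In case A all these
maps are affine, and the charts of `X` already form an affine atlas.

In case B, continuing an affine chart along `ℍ² ∖ {0}` gives a slice regular, locally injective
developing map `D` with `D ∘ f = D A + b`. On the slice `ℂ_J × ℂ_J` containing `λ` this becomes a
holomorphic equation on `ℂ² ∖ {0}`. Expanding `D` into its weighted homogeneous components for
`(z, w) ↦ (t ^ p z, t w)`, the equation turns into a linear recursion on the components; as a Jordan
block of size two fills all of `ℍ²`, only the weights `0` and `p` survive. Therefore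
`D = z c + w ^ p a + c₀`, and this is not locally injective because `p > 1`.
-/

open scoped Quaternion ContDiff Topology

noncomputable section

/-! ### Slices and circular sets -/

section Slices

variable {J : ℍ[ℝ]}

theorem norm_eq_one_of_mem_imagUnits (hJ : J ∈ imagUnits) : ‖J‖ = 1 := by
  have hsq : ‖J‖ ^ 2 = 1 := by rw [pow_two, ← norm_mul, show J * J = -1 from hJ]; simp
  exact (pow_eq_one_iff_of_nonneg (norm_nonneg J) two_ne_zero).mp hsq

theorem re_eq_zero_of_mem_imagUnits (hJ : J ∈ imagUnits) : J.re = 0 := by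
  rw [← Quaternion.sq_eq_neg_normSq, Quaternion.normSq_eq_norm_mul_self,
    norm_eq_one_of_mem_imagUnits hJ, pow_two, show J * J = -1 from hJ]
  simp

theorem normalize_im_mem_imagUnits {q : ℍ[ℝ]} (hq : q.im ≠ 0) :
    ‖q.im‖⁻¹ • q.im ∈ imagUnits := by
  have hn : ‖q.im‖ ≠ 0 := norm_ne_zero_iff.mpr hq
  have hre : (‖q.im‖⁻¹ • q.im).re = 0 := by simp
  change _ * _ = _
  rw [← pow_two, Quaternion.sq_eq_neg_normSq.mpr hre, Quaternion.normSq_eq_norm_mul_self,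
    norm_smul, norm_inv, norm_norm, inv_mul_cancel₀ hn]
  simp

/-- The imaginary unit `i` of `ℍ`, the base point of `imagUnits`. -/
def unitI : ℍ[ℝ] := ⟨0, 1, 0, 0⟩

theorem unitI_mem_imagUnits : unitI ∈ imagUnits := by
  change unitI * unitI = -1
  ext <;>
    simp only [Quaternion.re_mul, Quaternion.imI_mul, Quaternion.imJ_mul, Quaternion.imK_mul] <;>
    simp [unitI]

/-- `sliceEmb J` as a homomorphism of real algebras. -/
def sliceHom (hJ : J ∈ imagUnits) : ℂ →ₐ[ℝ] ℍ[ℝ] := Complex.lift ⟨J, hJ⟩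

theorem sliceHom_apply (hJ : J ∈ imagUnits) (z : ℂ) : sliceHom hJ z = sliceEmb J z := by
  simp [sliceHom, sliceEmb, Complex.lift, Complex.liftAux_apply]

theorem sliceEmb_mul (hJ : J ∈ imagUnits) (z w : ℂ) :
    sliceEmb J (z * w) = sliceEmb J z * sliceEmb J w := by
  simp only [← sliceHom_apply hJ, map_mul]

theorem sliceEmb_pow (hJ : J ∈ imagUnits) (z : ℂ) (n : ℕ) :
    sliceEmb J (z ^ n) = sliceEmb J z ^ n := by
  simp only [← sliceHom_apply hJ, map_pow]

theorem sliceEmb_add (J : ℍ[ℝ]) (z w : ℂ) :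
    sliceEmb J (z + w) = sliceEmb J z + sliceEmb J w := by
  simp only [sliceEmb, Complex.add_re, Complex.add_im, Quaternion.coe_add, add_smul]
  abel

@[simp] theorem sliceEmb_ofReal (J : ℍ[ℝ]) (x : ℝ) : sliceEmb J (x : ℂ) = (x : ℍ[ℝ]) := by
  simp [sliceEmb]

@[simp] theorem sliceEmb_zero (J : ℍ[ℝ]) : sliceEmb J 0 = 0 := by
  simp [sliceEmb]

theorem re_sliceEmb (hJ : J ∈ imagUnits) (z : ℂ) : (sliceEmb J z).re = z.re := by
  simp [sliceEmb, re_eq_zero_of_mem_imagUnits hJ]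

theorem im_sliceEmb (hJ : J ∈ imagUnits) (z : ℂ) : (sliceEmb J z).im = z.im • J := by
  ext <;> simp [sliceEmb, re_eq_zero_of_mem_imagUnits hJ]

theorem star_sliceEmb (hJ : J ∈ imagUnits) (z : ℂ) :
    star (sliceEmb J z) = sliceEmb J (star z) := by
  have hstar : star J = -J := Quaternion.star_eq_neg.mpr (re_eq_zero_of_mem_imagUnits hJ)
  simp [sliceEmb, hstar]

theorem norm_sliceEmb (hJ : J ∈ imagUnits) (z : ℂ) : ‖sliceEmb J z‖ = ‖z‖ := by
  have hsq : Quaternion.normSq (sliceEmb J z) = Complex.normSq z := by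
    apply Quaternion.coe_injective
    rw [← Quaternion.self_mul_star, star_sliceEmb hJ, ← sliceEmb_mul hJ, Complex.star_def,
      Complex.mul_conj, sliceEmb_ofReal]
  rw [← sq_eq_sq₀ (norm_nonneg _) (norm_nonneg _), ← Complex.normSq_eq_norm_sq, pow_two,
    ← Quaternion.normSq_eq_norm_mul_self, hsq]

theorem sliceEmb_injective (hJ : J ∈ imagUnits) : Function.Injective (sliceEmb J) := by
  convert (sliceHom hJ).toRingHom.injective using 1
  exact funext fun z => (sliceHom_apply hJ z).symm

theorem continuous_sliceEmb : Continuous fun x : ℍ[ℝ] × ℂ => sliceEmb x.1 x.2 :=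
  (Quaternion.continuous_coe.comp (Complex.continuous_re.comp continuous_snd)).add
    ((Complex.continuous_im.comp continuous_snd).smul continuous_fst)

/-- The point where the sphere of all `a + b J`, `J ∈ imagUnits`, through `q` meets the closed
upper half plane. It parametrizes circular sets. -/
def sliceCoord (q : ℍ[ℝ]) : ℂ := ⟨q.re, ‖q.im‖⟩

theorem continuous_sliceCoord : Continuous sliceCoord :=
  Complex.equivRealProdCLM.symm.continuous.comp
    (Quaternion.continuous_re.prodMk Quaternion.continuous_im.norm)

theorem exists_sliceEmb_sliceCoord (q : ℍ[ℝ]) :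
    ∃ J ∈ imagUnits, q = sliceEmb J (sliceCoord q) := by
  by_cases h : q.im = 0
  · refine ⟨unitI, unitI_mem_imagUnits, ?_⟩
    conv_lhs => rw [← Quaternion.re_add_im q]
    simp [sliceEmb, sliceCoord, h]
  · refine ⟨‖q.im‖⁻¹ • q.im, normalize_im_mem_imagUnits h, ?_⟩
    simp [sliceEmb, sliceCoord, smul_smul, h]

theorem norm_sliceCoord (q : ℍ[ℝ]) : ‖sliceCoord q‖ = ‖q‖ := by
  obtain ⟨J, hJ, hq⟩ := exists_sliceEmb_sliceCoord q
  rw [← norm_sliceEmb hJ, ← hq]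

theorem sliceCoord_sliceEmb (hJ : J ∈ imagUnits) (z : ℂ) :
    sliceCoord (sliceEmb J z) = ⟨z.re, |z.im|⟩ := by
  rw [sliceCoord, re_sliceEmb hJ, im_sliceEmb hJ, norm_smul, norm_eq_one_of_mem_imagUnits hJ]
  simp

theorem sliceCoord_sliceEmb_eq_or (hJ : J ∈ imagUnits) (z : ℂ) :
    sliceCoord (sliceEmb J z) = z ∨ sliceCoord (sliceEmb J z) = star z := by
  rw [sliceCoord_sliceEmb hJ]
  rcases abs_choice z.im with h | h
  · exact .inl (by rw [h])
  · exact .inr (by rw [h]; rfl)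

end Slices

section CircularSets

variable {D D' : Set (ℂ × ℂ)}

theorem ConjInvariant.star_fst_mem_iff (hD : ConjInvariant D) (z : ℂ × ℂ) :
    (star z.1, z.2) ∈ D ↔ z ∈ D :=
  ⟨fun h => by simpa using (hD _ h).1, fun h => (hD _ h).1⟩

theorem ConjInvariant.star_snd_mem_iff (hD : ConjInvariant D) (z : ℂ × ℂ) :
    (z.1, star z.2) ∈ D ↔ z ∈ D :=
  ⟨fun h => by simpa using (hD _ h).2, fun h => (hD _ h).2⟩

theorem ConjInvariant.sliceCoord_mem_iff (hD : ConjInvariant D) {J₁ J₂ : ℍ[ℝ]}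
    (h₁ : J₁ ∈ imagUnits) (h₂ : J₂ ∈ imagUnits) (z : ℂ × ℂ) :
    (sliceCoord (sliceEmb J₁ z.1), sliceCoord (sliceEmb J₂ z.2)) ∈ D ↔ z ∈ D := by
  rcases sliceCoord_sliceEmb_eq_or h₁ z.1 with e₁ | e₁ <;>
    rcases sliceCoord_sliceEmb_eq_or h₂ z.2 with e₂ | e₂ <;> rw [e₁, e₂]
  · exact hD.star_snd_mem_iff z
  · exact hD.star_fst_mem_iff z
  · exact (hD.star_snd_mem_iff (star z.1, z.2)).trans (hD.star_fst_mem_iff z)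

theorem mem_circularization_iff (hD : ConjInvariant D) (x : H2) :
    x ∈ circularization D ↔ (sliceCoord x.1, sliceCoord x.2) ∈ D := by
  constructor
  · rintro ⟨z, hz, J₁, h₁, J₂, h₂, rfl⟩
    exact (hD.sliceCoord_mem_iff h₁ h₂ z).mpr hz
  · intro hx
    obtain ⟨J₁, h₁, e₁⟩ := exists_sliceEmb_sliceCoord x.1
    obtain ⟨J₂, h₂, e₂⟩ := exists_sliceEmb_sliceCoord x.2
    exact ⟨_, hx, J₁, h₁, J₂, h₂, Prod.ext e₁ e₂⟩

theorem sliceEmb_mem_circularization (hD : ConjInvariant D) {J₁ J₂ : ℍ[ℝ]}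
    (h₁ : J₁ ∈ imagUnits) (h₂ : J₂ ∈ imagUnits) (z : ℂ × ℂ) :
    (sliceEmb J₁ z.1, sliceEmb J₂ z.2) ∈ circularization D ↔ z ∈ D :=
  (mem_circularization_iff hD _).trans (hD.sliceCoord_mem_iff h₁ h₂ z)

theorem ConjInvariant.inter (hD : ConjInvariant D) (hD' : ConjInvariant D') :
    ConjInvariant (D ∩ D') := fun z hz =>
  ⟨⟨(hD z hz.1).1, (hD' z hz.2).1⟩, ⟨(hD z hz.1).2, (hD' z hz.2).2⟩⟩

theorem circularization_inter (hD : ConjInvariant D) (hD' : ConjInvariant D') :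
    circularization (D ∩ D') = circularization D ∩ circularization D' := by
  ext x
  simp only [Set.mem_inter_iff, mem_circularization_iff hD, mem_circularization_iff hD',
    mem_circularization_iff (hD.inter hD')]

theorem conjInvariant_univ : ConjInvariant Set.univ := fun _ _ => ⟨trivial, trivial⟩

theorem circularization_univ : circularization Set.univ = Set.univ := by
  ext x
  simp [mem_circularization_iff conjInvariant_univ]

theorem isCircular_setOf_norm (P : ℝ → ℝ → Prop) : IsCircular {x : H2 | P ‖x.1‖ ‖x.2‖} := by
  have hD : ConjInvariant {z : ℂ × ℂ | P ‖z.1‖ ‖z.2‖} := fun z hz => by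
    constructor <;> simpa using hz
  refine ⟨_, hD, Set.ext fun x => ?_⟩
  simp [mem_circularization_iff hD, norm_sliceCoord]

end CircularSets

/-! ### Holomorphic stem functions -/

section Stems

variable {D D' : Set (ℂ × ℂ)} {F G : ℂ × ℂ → StemSpace}

theorem e1Left_add (v w : StemSpace) : e1Left (v + w) = e1Left v + e1Left w := by
  simp [e1Left, add_comm]

theorem e2Right_add (v w : StemSpace) : e2Right (v + w) = e2Right v + e2Right w := by
  simp [e2Right, add_comm]

theorem IsHolomorphicStem.differentiableAt (hF : IsHolomorphicStem D F) {z : ℂ × ℂ} (hz : z ∈ D) :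
    DifferentiableAt ℝ F z :=
  (hF.contDiffOn.differentiableOn one_ne_zero).differentiableAt (hF.isOpen.mem_nhds hz)

theorem IsHolomorphicStem.mono (hF : IsHolomorphicStem D F) (ho : IsOpen D')
    (hD' : ConjInvariant D') (h : D' ⊆ D) : IsHolomorphicStem D' F where
  isOpen := ho
  conjInvariant := hD'
  parity₁ z hz := hF.parity₁ z (h hz)
  parity₂ z hz := hF.parity₂ z (h hz)
  contDiffOn := hF.contDiffOn.mono h
  dbar₁ z hz := hF.dbar₁ z (h hz)
  dbar₂ z hz := hF.dbar₂ z (h hz)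

theorem IsHolomorphicStem.add (hF : IsHolomorphicStem D F) (hG : IsHolomorphicStem D G) :
    IsHolomorphicStem D (fun z => F z + G z) where
  isOpen := hF.isOpen
  conjInvariant := hF.conjInvariant
  parity₁ z hz := by
    rw [hF.parity₁ z hz, hG.parity₁ z hz]; simp [add_comm]
  parity₂ z hz := by
    rw [hF.parity₂ z hz, hG.parity₂ z hz]; simp [add_comm]
  contDiffOn := hF.contDiffOn.add hG.contDiffOn
  dbar₁ z hz := by
    rw [fderiv_fun_add (hF.differentiableAt hz) (hG.differentiableAt hz)]
    simp only [add_apply, e1Left_add]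
    rw [add_add_add_comm, hF.dbar₁ z hz, hG.dbar₁ z hz, add_zero]
  dbar₂ z hz := by
    rw [fderiv_fun_add (hF.differentiableAt hz) (hG.differentiableAt hz)]
    simp only [add_apply, e2Right_add]
    rw [add_add_add_comm, hF.dbar₂ z hz, hG.dbar₂ z hz, add_zero]

/-- Multiplication by a quaternion `c` on the right on `ℍ ⊗ ℝ₂`, acting on each coefficient. -/
def stemMulRight (c : ℍ[ℝ]) : StemSpace →L[ℝ] StemSpace :=
  let m := (ContinuousLinearMap.mul ℝ ℍ[ℝ]).flip c
  m.prodMap (m.prodMap (m.prodMap m))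

theorem stemMulRight_apply (c : ℍ[ℝ]) (v : StemSpace) :
    stemMulRight c v = (v.1 * c, v.2.1 * c, v.2.2.1 * c, v.2.2.2 * c) := rfl

theorem stemMulRight_e1Left (c : ℍ[ℝ]) (v : StemSpace) :
    stemMulRight c (e1Left v) = e1Left (stemMulRight c v) := by
  simp [stemMulRight_apply, e1Left]

theorem stemMulRight_e2Right (c : ℍ[ℝ]) (v : StemSpace) :
    stemMulRight c (e2Right v) = e2Right (stemMulRight c v) := by
  simp [stemMulRight_apply, e2Right]

theorem fderiv_stemMulRight {c : ℍ[ℝ]} {z : ℂ × ℂ} (hF : DifferentiableAt ℝ F z) :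
    fderiv ℝ (fun z => stemMulRight c (F z)) z = (stemMulRight c).comp (fderiv ℝ F z) :=
  ((stemMulRight c).hasFDerivAt.comp z hF.hasFDerivAt).fderiv

theorem IsHolomorphicStem.mulRight (hF : IsHolomorphicStem D F) (c : ℍ[ℝ]) :
    IsHolomorphicStem D (fun z => stemMulRight c (F z)) where
  isOpen := hF.isOpen
  conjInvariant := hF.conjInvariant
  parity₁ z hz := by
    rw [hF.parity₁ z hz]; simp [stemMulRight_apply]
  parity₂ z hz := by
    rw [hF.parity₂ z hz]; simp [stemMulRight_apply]
  contDiffOn := (stemMulRight c).contDiff.comp_contDiffOn hF.contDiffOn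
  dbar₁ z hz := by
    rw [fderiv_stemMulRight (hF.differentiableAt hz), ContinuousLinearMap.comp_apply,
      ContinuousLinearMap.comp_apply, ← stemMulRight_e1Left, ← map_add, hF.dbar₁ z hz, map_zero]
  dbar₂ z hz := by
    rw [fderiv_stemMulRight (hF.differentiableAt hz), ContinuousLinearMap.comp_apply,
      ContinuousLinearMap.comp_apply, ← stemMulRight_e2Right, ← map_add, hF.dbar₂ z hz, map_zero]

theorem isHolomorphicStem_const (ho : IsOpen D) (hD : ConjInvariant D) (c : ℍ[ℝ]) :
    IsHolomorphicStem D (fun _ => (c, 0, 0, 0)) where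
  isOpen := ho
  conjInvariant := hD
  parity₁ z _ := by simp
  parity₂ z _ := by simp
  contDiffOn := contDiffOn_const
  dbar₁ z _ := by simp [e1Left]
  dbar₂ z _ := by simp [e2Right]

/-- The embedding `a + i b ↦ a + e₁ b` of `ℂ` into `ℍ ⊗ ℝ₂`. -/
def stemIncl₁ : ℂ →L[ℝ] StemSpace :=
  ((algebraMapCLM ℝ ℍ[ℝ]).comp Complex.reCLM).prod
    (((algebraMapCLM ℝ ℍ[ℝ]).comp Complex.imCLM).prod 0)

/-- The embedding `a + i b ↦ a + e₂ b` of `ℂ` into `ℍ ⊗ ℝ₂`. -/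
def stemIncl₂ : ℂ →L[ℝ] StemSpace :=
  ((algebraMapCLM ℝ ℍ[ℝ]).comp Complex.reCLM).prod
    ((0 : ℂ →L[ℝ] ℍ[ℝ]).prod (((algebraMapCLM ℝ ℍ[ℝ]).comp Complex.imCLM).prod 0))

theorem stemIncl₁_apply (z : ℂ) : stemIncl₁ z = ((z.re : ℍ[ℝ]), (z.im : ℍ[ℝ]), 0, 0) := rfl

theorem stemIncl₂_apply (z : ℂ) : stemIncl₂ z = ((z.re : ℍ[ℝ]), 0, (z.im : ℍ[ℝ]), 0) := rfl

theorem e1Left_stemIncl₁ (z : ℂ) : e1Left (stemIncl₁ z) = stemIncl₁ (Complex.I * z) := by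
  simp [e1Left, stemIncl₁_apply]

theorem e2Right_stemIncl₂ (z : ℂ) : e2Right (stemIncl₂ z) = stemIncl₂ (Complex.I * z) := by
  simp [e2Right, stemIncl₂_apply]

variable {φ : ℂ → ℂ}

theorem hasFDerivAt_clm_comp_complex (L : ℂ →L[ℝ] StemSpace) (π : ℂ × ℂ →L[ℝ] ℂ)
    (hφ : Differentiable ℂ φ) (z : ℂ × ℂ) :
    HasFDerivAt (fun z => L (φ (π z)))
      (L.comp (((fderiv ℂ φ (π z)).restrictScalars ℝ).comp π)) z :=
  L.hasFDerivAt.comp z (((hφ (π z)).hasFDerivAt.restrictScalars ℝ).comp z π.hasFDerivAt)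

theorem isHolomorphicStem_stemIncl₁ (hφ : Differentiable ℂ φ)
    (hstar : ∀ z, φ (star z) = star (φ z)) :
    IsHolomorphicStem Set.univ (fun z => stemIncl₁ (φ z.1)) where
  isOpen := isOpen_univ
  conjInvariant := conjInvariant_univ
  parity₁ z _ := by simp only [hstar]; simp [stemIncl₁_apply]
  parity₂ z _ := by simp [stemIncl₁_apply]
  contDiffOn := (stemIncl₁.contDiff.comp
    ((hφ.contDiff.restrict_scalars ℝ).comp contDiff_fst)).contDiffOn
  dbar₁ z _ := by
    have h := (hasFDerivAt_clm_comp_complex stemIncl₁ (.fst ℝ ℂ ℂ) hφ z).fderiv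
    dsimp only [ContinuousLinearMap.coe_fst'] at h
    simp [h, e1Left_stemIncl₁, ← mul_assoc]
  dbar₂ z _ := by
    have h := (hasFDerivAt_clm_comp_complex stemIncl₁ (.fst ℝ ℂ ℂ) hφ z).fderiv
    dsimp only [ContinuousLinearMap.coe_fst'] at h
    simp [h, e2Right]

theorem isHolomorphicStem_stemIncl₂ (hφ : Differentiable ℂ φ)
    (hstar : ∀ z, φ (star z) = star (φ z)) :
    IsHolomorphicStem Set.univ (fun z => stemIncl₂ (φ z.2)) where
  isOpen := isOpen_univ
  conjInvariant := conjInvariant_univ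
  parity₁ z _ := by simp [stemIncl₂_apply]
  parity₂ z _ := by simp only [hstar]; simp [stemIncl₂_apply]
  contDiffOn := (stemIncl₂.contDiff.comp
    ((hφ.contDiff.restrict_scalars ℝ).comp contDiff_snd)).contDiffOn
  dbar₁ z _ := by
    have h := (hasFDerivAt_clm_comp_complex stemIncl₂ (.snd ℝ ℂ ℂ) hφ z).fderiv
    dsimp only [ContinuousLinearMap.coe_snd'] at h
    simp [h, e1Left]
  dbar₂ z _ := by
    have h := (hasFDerivAt_clm_comp_complex stemIncl₂ (.snd ℝ ℂ ℂ) hφ z).fderiv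
    dsimp only [ContinuousLinearMap.coe_snd'] at h
    simp [h, e2Right_stemIncl₂, ← mul_assoc]

end Stems

/-! ### Slice regular functions and maps -/

section SliceRegular

variable {g h : H2 → ℍ[ℝ]} {Ω Ω' : Set H2}

theorem SliceRegularOnCircular.add_inter (hg : SliceRegularOnCircular g Ω)
    (hh : SliceRegularOnCircular h Ω') :
    SliceRegularOnCircular (fun x => g x + h x) (Ω ∩ Ω') := by
  obtain ⟨D, F, hF, rfl, hgF⟩ := hg
  obtain ⟨D', G, hG, rfl, hhG⟩ := hh
  have ho : IsOpen (D ∩ D') := hF.isOpen.inter hG.isOpen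
  have hD : ConjInvariant (D ∩ D') := hF.conjInvariant.inter hG.conjInvariant
  refine ⟨D ∩ D', _, (hF.mono ho hD Set.inter_subset_left).add (hG.mono ho hD
    Set.inter_subset_right), (circularization_inter hF.conjInvariant hG.conjInvariant).symm,
    fun z hz J₁ h₁ J₂ h₂ => ?_⟩
  dsimp only
  rw [hgF z hz.1 J₁ h₁ J₂ h₂, hhG z hz.2 J₁ h₁ J₂ h₂]
  simp only [Prod.fst_add, Prod.snd_add, mul_add]
  abel

theorem SliceRegularOnCircular.add (hg : SliceRegularOnCircular g Ω)
    (hh : SliceRegularOnCircular h Ω) : SliceRegularOnCircular (fun x => g x + h x) Ω := by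
  simpa only [Set.inter_self] using hg.add_inter hh

theorem SliceRegularOnCircular.mul_right (hg : SliceRegularOnCircular g Ω) (c : ℍ[ℝ]) :
    SliceRegularOnCircular (fun x => g x * c) Ω := by
  obtain ⟨D, F, hF, rfl, hgF⟩ := hg
  refine ⟨D, _, hF.mulRight c, rfl, fun z hz J₁ h₁ J₂ h₂ => ?_⟩
  dsimp only
  rw [hgF z hz J₁ h₁ J₂ h₂]
  simp only [stemMulRight_apply, add_mul, mul_assoc]

theorem SliceRegularOnCircular.add_const (hg : SliceRegularOnCircular g Ω) (c : ℍ[ℝ]) :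
    SliceRegularOnCircular (fun x => g x + c) Ω := by
  refine hg.add ?_
  obtain ⟨D, F, hF, rfl, -⟩ := hg
  exact ⟨D, _, isHolomorphicStem_const hF.isOpen hF.conjInvariant c, rfl,
    fun z _ J₁ _ J₂ _ => by simp⟩

theorem sliceRegularOnCircular_fst : SliceRegularOnCircular (fun x => x.1) Set.univ :=
  ⟨Set.univ, _, isHolomorphicStem_stemIncl₁ differentiable_id fun _ => rfl,
    circularization_univ.symm, fun z _ J₁ _ J₂ _ => by
      simp [stemIncl₁_apply, sliceEmb, Quaternion.mul_coe_eq_smul]⟩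

theorem sliceRegularOnCircular_snd_pow (p : ℕ) :
    SliceRegularOnCircular (fun x => x.2 ^ p) Set.univ :=
  ⟨Set.univ, _, isHolomorphicStem_stemIncl₂ (differentiable_pow p) fun z => (star_pow z p).symm,
    circularization_univ.symm, fun z _ J₁ _ J₂ h₂ => by
      dsimp only
      rw [← sliceEmb_pow h₂]
      simp [stemIncl₂_apply, sliceEmb, Quaternion.mul_coe_eq_smul]⟩

theorem SliceRegularAt.congr {g g' : H2 → H2} {x : H2} (hg : SliceRegularAt g x)
    (h : g' =ᶠ[𝓝 x] g) : SliceRegularAt g' x := by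
  obtain ⟨Ω, G, hx, h₁, h₂, hgG⟩ := hg
  exact ⟨Ω, G, hx, h₁, h₂, h.trans hgG⟩

theorem SliceRegularAt.sub {g g' : H2 → H2} {x : H2} (hg : SliceRegularAt g x)
    (hg' : SliceRegularAt g' x) : SliceRegularAt (g - g') x := by
  obtain ⟨Ω, G, hx, h₁, h₂, hgG⟩ := hg
  obtain ⟨Ω', G', hx', h₁', h₂', hgG'⟩ := hg'
  refine ⟨Ω ∩ Ω', G - G', ⟨hx, hx'⟩, ?_, ?_, hgG.sub hgG'⟩
  · simpa [sub_eq_add_neg] using h₁.add_inter (h₁'.mul_right (-1))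
  · simpa [sub_eq_add_neg] using h₂.add_inter (h₂'.mul_right (-1))

theorem SliceRegularAt.affineH2_comp {g : H2 → H2} {x : H2} (hg : SliceRegularAt g x)
    (A : Matrix (Fin 2) (Fin 2) ℍ[ℝ]) (b : H2) :
    SliceRegularAt (fun y => affineH2 A b (g y)) x := by
  obtain ⟨Ω, G, hx, h₁, h₂, hgG⟩ := hg
  exact ⟨Ω, fun y => affineH2 A b (G y), hx,
    ((h₁.mul_right (A 0 0)).add (h₂.mul_right (A 1 0))).add_const b.1,
    ((h₁.mul_right (A 0 1)).add (h₂.mul_right (A 1 1))).add_const b.2,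
    hgG.mono fun y hy => congrArg (affineH2 A b) hy⟩

theorem sliceRegularAt_affine_pow (p : ℕ) (c a c₀ x : H2) :
    SliceRegularAt (fun x => x.1 • c + x.2 ^ p • a + c₀) x :=
  have hcomp (c a c₀ : ℍ[ℝ]) :
      SliceRegularOnCircular (fun x => x.1 * c + x.2 ^ p * a + c₀) Set.univ :=
    ((sliceRegularOnCircular_fst.mul_right c).add
      ((sliceRegularOnCircular_snd_pow p).mul_right a)).add_const c₀
  ⟨Set.univ, _, Set.mem_univ _, hcomp c.1 a.1 c₀.1, hcomp c.2 a.2 c₀.2, Filter.EventuallyEq.rfl⟩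

theorem sliceRegularAt_triangular (p : ℕ) (a b d : ℍ[ℝ]) (x : H2) :
    SliceRegularAt (fun x => (x.1 * a + x.2 ^ p * b, x.2 * d)) x :=
  ⟨Set.univ, _, Set.mem_univ _,
    (sliceRegularOnCircular_fst.mul_right a).add ((sliceRegularOnCircular_snd_pow p).mul_right b),
    by simpa using (sliceRegularOnCircular_snd_pow 1).mul_right d, Filter.EventuallyEq.rfl⟩

end SliceRegular

/-! ### Punctured normed spaces are simply connected -/

section PuncturedSpace

open unitInterval

variable {E : Type*} [NormedAddCommGroup E] [NormedSpace ℝ E]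

theorem homotopic_of_norm_sub_lt {x y : {v : E // v ≠ 0}} (γ γ' : Path x y)
    (h : ∀ t, ‖(γ' t : E) - γ t‖ < ‖(γ t : E)‖) : γ.Homotopic γ' := by
  have hne : ∀ s : I × I, (γ s.2 : E) + (s.1 : ℝ) • ((γ' s.2 : E) - γ s.2) ≠ 0 := by
    intro s h0
    have hnorm : ‖(γ s.2 : E)‖ = (s.1 : ℝ) * ‖(γ' s.2 : E) - γ s.2‖ := by
      conv_lhs =>
        rw [eq_neg_of_add_eq_zero_left h0, norm_neg, norm_smul, Real.norm_of_nonneg s.1.2.1]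
    refine (h s.2).not_ge (hnorm.trans_le ?_)
    exact mul_le_of_le_one_left (norm_nonneg _) s.1.2.2
  refine ⟨⟨⟨⟨fun s => ⟨_, hne s⟩, ?_⟩, ?_, ?_⟩, ?_⟩⟩
  · exact Continuous.subtype_mk (by fun_prop) _
  · intro t; ext; simp
  · intro t; ext; simp
  · intro s t ht
    ext
    rcases ht with rfl | rfl <;> simp

theorem starConvex_compl_ray {v : E} (hv : v ≠ 0) :
    StarConvex ℝ (-v) {y : E | ∀ c : ℝ, 0 ≤ c → y ≠ c • v} := by
  intro y hy a b ha hb hab c hc h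
  rcases hb.eq_or_lt with rfl | hb
  · have hcv : (c + a) • v = 0 := by
      rw [add_smul, ← h]
      module
    rcases smul_eq_zero.mp hcv with h' | h'
    · linarith
    · exact hv h'
  · refine hy ((c + a) / b) (by positivity) ?_
    rw [div_eq_inv_mul, mul_smul, eq_inv_smul_iff₀ hb.ne', add_smul, ← h]
    module

theorem homotopic_refl_of_forall_ne_smul {x : {u : E // u ≠ 0}} (γ : Path x x) {v : E}
    (hv : v ≠ 0) (hγ : ∀ t, ∀ c : ℝ, 0 ≤ c → (γ t : E) ≠ c • v) :
    γ.Homotopic (Path.refl x) := by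
  set S := {y : E | ∀ c : ℝ, 0 ≤ c → y ≠ c • v}
  have hxS : (x : E) ∈ S := fun c hc => by simpa using hγ 0 c hc
  have : ContractibleSpace S := (starConvex_compl_ray hv).contractibleSpace ⟨_, hxS⟩
  let incl : C(S, {u : E // u ≠ 0}) := ⟨fun y => ⟨y.1, by simpa using y.2 0 le_rfl⟩, by fun_prop⟩
  let γS : Path (⟨x, hxS⟩ : S) ⟨x, hxS⟩ :=
    ⟨⟨fun t => ⟨γ t, hγ t⟩, by fun_prop⟩, by simp, by simp⟩
  exact (SimplyConnectedSpace.paths_homotopic γS (Path.refl _)).map incl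

theorem exists_homotopic_contDiff {x y : {v : E // v ≠ 0}} (γ : Path x y) :
    ∃ (γ' : Path x y) (G : ℝ → E), γ.Homotopic γ' ∧ ContDiff ℝ 1 G ∧ ∀ t : I, (γ' t : E) = G t := by
  let f : C(I, E) := ⟨fun t => (γ t : E), by fun_prop⟩
  obtain ⟨t₀, -, ht₀⟩ := isCompact_univ.exists_isMinOn (Set.univ_nonempty (α := I))
    (f := fun t => ‖f t‖) (by fun_prop)
  have hmin : 0 < ‖f t₀‖ := norm_pos_iff.mpr (γ t₀).2
  obtain ⟨n, hn, hn0⟩ := ((Metric.tendsto_nhds.mp (bernsteinApproximation_uniform f) _ hmin).and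
    (Filter.eventually_ne_atTop 0)).exists
  set g := bernsteinApproximation n f with hg
  have hclose : ∀ t, ‖g t - f t‖ < ‖f t‖ := fun t => by
    rw [← dist_eq_norm]
    exact (ContinuousMap.dist_apply_le_dist t).trans_lt (hn.trans_le (ht₀ (Set.mem_univ t)))
  have hg_ne : ∀ t, g t ≠ 0 := fun t h => by simpa [h] using hclose t
  have hg_zero : g 0 = x := by rw [hg, bernsteinApproximation.apply_zero]; simp [f]
  have hg_one : g 1 = y := by rw [hg, bernsteinApproximation.apply_one hn0]; simp [f]
  let γ' : Path x y :=
    ⟨⟨fun t => ⟨g t, hg_ne t⟩, by fun_prop⟩, Subtype.ext hg_zero, Subtype.ext hg_one⟩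
  refine ⟨γ', fun t => ∑ k : Fin (n + 1),
    ((n.choose k : ℝ) * t ^ (k : ℕ) * (1 - t) ^ (n - k)) • f (bernstein.z k),
    homotopic_of_norm_sub_lt γ γ' hclose, by fun_prop, fun t => ?_⟩
  change g t = _
  simp only [hg, bernsteinApproximation.apply, bernstein_apply]

theorem exists_ne_zero_forall_smul_ne [FiniteDimensional ℝ E] (hE : 2 < Module.finrank ℝ E)
    {G : ℝ → E} (hG : ContDiff ℝ 1 G) : ∃ v ≠ 0, ∀ s t : ℝ, s • G t ≠ v := by
  have hcone : ContDiff ℝ 1 fun s : ℝ × ℝ => s.1 • G s.2 := by fun_prop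
  obtain ⟨v, hv⟩ := (hcone.dense_compl_range_of_finrank_lt_finrank (by simpa using hE)).nonempty
  have hv' : ∀ s t : ℝ, s • G t ≠ v := fun s t h => hv ⟨(s, t), h⟩
  exact ⟨v, by simpa using (hv' 0 0).symm, hv'⟩

theorem simplyConnectedSpace_ne_zero [FiniteDimensional ℝ E] (hE : 2 < Module.finrank ℝ E) :
    SimplyConnectedSpace {v : E // v ≠ 0} := by
  rw [simply_connected_iff_loops_nullhomotopic]
  refine ⟨?_, fun x γ => ?_⟩
  · have hrank : 1 < Module.rank ℝ E := by
      rw [← Module.finrank_eq_rank]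
      exact_mod_cast (by omega : 1 < Module.finrank ℝ E)
    exact isPathConnected_iff_pathConnectedSpace.mp
      (isPathConnected_compl_singleton_of_one_lt_rank hrank 0)
  · obtain ⟨γ', G, hγ', hG, hγG⟩ := exists_homotopic_contDiff γ
    obtain ⟨v, hv, hGv⟩ := exists_ne_zero_forall_smul_ne hE hG
    refine hγ'.trans (homotopic_refl_of_forall_ne_smul γ' hv fun t c hc h => ?_)
    rcases hc.eq_or_lt with rfl | hc
    · exact (γ' t).2 (by rw [h, zero_smul])
    · exact hGv c⁻¹ t (by rw [← hγG, h, inv_smul_smul₀ hc.ne'])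

instance : SimplyConnectedSpace PuncturedH2 := by
  apply simplyConnectedSpace_ne_zero
  rw [Module.finrank_prod, Quaternion.finrank_eq_four]
  norm_num

end PuncturedSpace

instance : LocallyCompactSpace PuncturedH2 :=
  (isOpen_ne (x := (0 : H2))).locallyCompactSpace

theorem isOpenEmbedding_puncturedH2_val :
    Topology.IsOpenEmbedding (Subtype.val : PuncturedH2 → H2) :=
  (isOpen_ne (x := (0 : H2))).isOpenEmbedding_subtypeVal

theorem eventually_nhds_puncturedH2_iff {P : H2 → Prop} {x : PuncturedH2} :
    (∀ᶠ y in 𝓝 (x : H2), P y) ↔ ∀ᶠ y : PuncturedH2 in 𝓝 x, P y := by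
  rw [← isOpenEmbedding_puncturedH2_val.map_nhds_eq x, Filter.eventually_map]

/-! ### Contracting bijections of a punctured normed space -/

section Contracting

variable {E : Type*} [NormedAddCommGroup E] {σ : Equiv.Perm {x : E // x ≠ 0}}

theorem exists_norm_bounds_of_isCompact {K : Set {x : E // x ≠ 0}} (hK : IsCompact K) :
    ∃ R ε : ℝ, 0 < ε ∧ ∀ x ∈ K, ε ≤ ‖(x : E)‖ ∧ ‖(x : E)‖ ≤ R := by
  have hnorm : ContinuousOn (fun x : {x : E // x ≠ 0} => ‖(x : E)‖) K := by fun_prop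
  rcases K.eq_empty_or_nonempty with rfl | hne
  · exact ⟨0, 1, one_pos, by simp⟩
  · obtain ⟨a, -, ha⟩ := hK.exists_isMinOn hne hnorm
    obtain ⟨b, -, hb⟩ := hK.exists_isMaxOn hne hnorm
    exact ⟨‖(b : E)‖, ‖(a : E)‖, norm_pos_iff.mpr a.2, fun x hx => ⟨ha hx, hb hx⟩⟩

theorem pow_natAbs_apply_eq_or {X : Type*} {σ : Equiv.Perm X} {k : ℤ} {x y : X}
    (h : (σ ^ k) x = y) : (σ ^ k.natAbs) x = y ∨ (σ ^ k.natAbs) y = x := by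
  obtain ⟨n, rfl | rfl⟩ := k.eq_nat_or_neg
  · exact .inl (by simpa using h)
  · exact .inr (by rw [zpow_neg, zpow_natCast, Equiv.Perm.inv_eq_iff_eq] at h; simpa using h.symm)

/-- The iterates `σ ^ n` tend to the removed origin, uniformly on bounded sets. -/
def IsUniformlyContracting (σ : Equiv.Perm {x : E // x ≠ 0}) : Prop :=
  ∀ R, ∀ ε > 0, ∃ N : ℕ, ∀ n ≥ N, ∀ x : {x : E // x ≠ 0}, ‖(x : E)‖ ≤ R →
    ‖((σ ^ n) x : E)‖ < ε

namespace IsUniformlyContracting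

theorem pow_apply_ne (hσ : IsUniformlyContracting σ) {n : ℕ} (hn : n ≠ 0)
    (x : {x : E // x ≠ 0}) : (σ ^ n) x ≠ x := by
  intro h
  obtain ⟨N, hN⟩ := hσ ‖(x : E)‖ ‖(x : E)‖ (norm_pos_iff.mpr x.2)
  have hfix : (σ ^ (n * N)) x = x := by
    rw [pow_mul, Equiv.Perm.coe_pow]
    exact Function.iterate_fixed h N
  have hlt := hN (n * N) (Nat.le_mul_of_pos_left N (Nat.pos_of_ne_zero hn)) x le_rfl
  exact lt_irrefl _ (hfix ▸ hlt)

theorem eq_zero_of_zpow_apply_eq (hσ : IsUniformlyContracting σ) {k : ℤ} {x : {x : E // x ≠ 0}}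
    (h : (σ ^ k) x = x) : k = 0 := by
  by_contra hk
  exact (pow_natAbs_apply_eq_or h).elim (hσ.pow_apply_ne (Int.natAbs_ne_zero.mpr hk) x)
    (hσ.pow_apply_ne (Int.natAbs_ne_zero.mpr hk) x)

theorem isCancelSMul (hσ : IsUniformlyContracting σ) :
    IsCancelSMul (Subgroup.zpowers σ) {x : E // x ≠ 0} := by
  rw [isCancelSMul_iff_eq_one_of_smul_eq]
  rintro ⟨_, k, rfl⟩ x h
  obtain rfl : k = 0 := hσ.eq_zero_of_zpow_apply_eq h
  rfl

theorem zpow_injective [Nontrivial E] (hσ : IsUniformlyContracting σ) :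
    Function.Injective fun k : ℤ => σ ^ k := by
  obtain ⟨v, hv⟩ := exists_ne (0 : E)
  intro j k (h : σ ^ j = σ ^ k)
  refine sub_eq_zero.mp (hσ.eq_zero_of_zpow_apply_eq (x := ⟨v, hv⟩) ?_)
  rw [zpow_sub, h, mul_inv_cancel, Equiv.Perm.one_apply]

theorem nonempty_zpowers_mulEquiv [Nontrivial E] (hσ : IsUniformlyContracting σ) :
    Nonempty (Subgroup.zpowers σ ≃* Multiplicative ℤ) :=
  ⟨((MonoidHom.ofInjective (f := zpowersHom _ σ) hσ.zpow_injective).trans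
    (MulEquiv.subgroupCongr rfl)).symm⟩

theorem properlyDiscontinuousSMul (hσ : IsUniformlyContracting σ) :
    ProperlyDiscontinuousSMul (Subgroup.zpowers σ) {x : E // x ≠ 0} := by
  refine ⟨fun {K L} hK hL => ?_⟩
  obtain ⟨R, ε, hε, hb⟩ := exists_norm_bounds_of_isCompact (hK.union hL)
  obtain ⟨N, hN⟩ := hσ R ε hε
  have hlt : ∀ n : ℕ, ∀ x ∈ K ∪ L, (σ ^ n) x ∈ K ∪ L → n < N := by
    intro n x hx hy
    by_contra! hn
    exact absurd (hb _ hy).1 (not_le.mpr (hN n hn x (hb x hx).2))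
  refine ((Set.finite_Icc (-(N : ℤ)) N).image
    fun k => (⟨σ ^ k, k, rfl⟩ : Subgroup.zpowers σ)).subset ?_
  rintro ⟨_, k, rfl⟩ ⟨y, ⟨x, hx, hxy⟩, hy⟩
  have hk : k.natAbs < N := by
    rcases pow_natAbs_apply_eq_or (show (σ ^ k) x = y from hxy) with h | h
    · exact hlt _ x (.inl hx) (h ▸ .inr hy)
    · exact hlt _ y (.inr hy) (h ▸ .inl hx)
  exact ⟨k, Set.mem_Icc.mpr (by omega), rfl⟩

end IsUniformlyContracting

end Contracting

/-! ### Quotients of the punctured plane -/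

theorem exists_openPartialHomeomorph_of_injOn {P X Y : Type*} [TopologicalSpace P]
    [TopologicalSpace X] [TopologicalSpace Y] [Nonempty P] {i : P → Y} {q : P → X} {U : Set P}
    (hi : Topology.IsOpenEmbedding i) (hq : Continuous q) (hqo : IsOpenMap q) (hU : IsOpen U)
    (hinj : Set.InjOn q U) :
    ∃ e : OpenPartialHomeomorph X Y, e.target = i '' U ∧ ∀ y, e.symm (i y) = q y := by
  let eX : OpenPartialHomeomorph P X :=
    .ofContinuousOpen hinj.toPartialEquiv hq.continuousOn hqo hU
  let eY := hi.toOpenPartialHomeomorph i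
  have heY : ∀ y, eY.symm (i y) = y := fun y => eY.left_inv (Set.mem_univ y)
  refine ⟨eX.symm.trans eY, ?_, fun y => congrArg q (heY y)⟩
  ext y
  rw [OpenPartialHomeomorph.trans_target]
  constructor
  · rintro ⟨hy, hyU⟩
    exact ⟨eY.symm y, hyU, eY.right_inv hy⟩
  · rintro ⟨y, hyU, rfl⟩
    refine ⟨eY.map_source (Set.mem_univ y), ?_⟩
    rw [Set.mem_preimage, heY]
    exact hyU

theorem injOn_quotientMk_zpowers {X : Type*} {σ : Equiv.Perm X} {U : Set X}
    (hU : ∀ y ∈ U, ∀ n : ℕ, n ≠ 0 → (σ ^ n) y ∉ U) :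
    Set.InjOn (Quotient.mk (MulAction.orbitRel (Subgroup.zpowers σ) X)) U := by
  intro x hx y hy hxy
  obtain ⟨⟨_, k, rfl⟩, hk⟩ := MulAction.orbitRel_apply.mp (Quotient.eq.mp hxy)
  replace hk : (σ ^ k) y = x := hk
  rcases eq_or_ne k 0 with rfl | hk0
  · exact hk.symm
  · rcases pow_natAbs_apply_eq_or hk with h | h
    · exact absurd (h ▸ hx) (hU y hy _ (Int.natAbs_ne_zero.mpr hk0))
    · exact absurd (h ▸ hy) (hU x hx _ (Int.natAbs_ne_zero.mpr hk0))

section Quotient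

/-- The projection of `ℍ² ∖ {(0,0)}` onto its quotient by a group of bijections. -/
abbrev orbitProj (Γ : Subgroup (Equiv.Perm PuncturedH2)) :
    PuncturedH2 → Quotient (MulAction.orbitRel Γ PuncturedH2) :=
  Quotient.mk (MulAction.orbitRel Γ PuncturedH2)

/-- The atlas of local inverses of `orbitProj Γ` on images of circular open sets; for the group
of a Hopf surface this is `hopfAtlas`. -/
def quotientAtlas (Γ : Subgroup (Equiv.Perm PuncturedH2)) :
    Set (OpenPartialHomeomorph (Quotient (MulAction.orbitRel Γ PuncturedH2)) H2) :=
  {e | IsCircular e.target ∧ ∀ y ∈ e.target, ∃ hy : y ≠ 0, e.symm y = orbitProj Γ ⟨y, hy⟩}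

/-- Every element of `Γ` is the restriction of a smooth slice regular map of `ℍ²`. -/
def IsSliceRegularGroup (Γ : Subgroup (Equiv.Perm PuncturedH2)) : Prop :=
  ∀ γ ∈ Γ, ∃ G : H2 → H2, ContDiff ℝ ∞ G ∧ (∀ y, SliceRegularAt G y) ∧
    ∀ y : PuncturedH2, G y = γ y

/-- Every point of `ℍ² ∖ {(0,0)}` has a circular open neighbourhood meeting each `Γ`-orbit in at
most one point. -/
def HasCircularSections (Γ : Subgroup (Equiv.Perm PuncturedH2)) : Prop :=
  ∀ x : PuncturedH2, ∃ U : Set H2, IsOpen U ∧ IsCircular U ∧ (x : H2) ∈ U ∧ (0 : H2) ∉ U ∧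
    Set.InjOn (orbitProj Γ) (Subtype.val ⁻¹' U)

variable {Γ : Subgroup (Equiv.Perm PuncturedH2)}

theorem orbitProj_eq_iff {x y : PuncturedH2} :
    orbitProj Γ x = orbitProj Γ y ↔ ∃ γ ∈ Γ, γ y = x := by
  rw [Quotient.eq, MulAction.orbitRel_apply, MulAction.mem_orbit_iff]
  exact ⟨fun ⟨γ, h⟩ => ⟨γ.1, γ.2, h⟩, fun ⟨γ, hγ, h⟩ => ⟨⟨γ, hγ⟩, h⟩⟩

theorem IsSliceRegularGroup.continuousConstSMul (hΓ : IsSliceRegularGroup Γ) :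
    ContinuousConstSMul Γ PuncturedH2 := by
  refine ⟨fun γ => ?_⟩
  obtain ⟨G, hG, -, hGγ⟩ := hΓ γ.1 γ.2
  refine continuous_induced_rng.mpr ((hG.continuous.comp continuous_subtype_val).congr hGγ)

theorem IsSliceRegularGroup.sliceRegularOnPunctured (hΓ : IsSliceRegularGroup Γ)
    {γ : Equiv.Perm PuncturedH2} (hγ : γ ∈ Γ) (U : Set PuncturedH2) :
    SliceRegularOnPunctured (fun y => (γ y : H2)) U :=
  have ⟨G, _, hreg, hGγ⟩ := hΓ γ hγ
  ⟨G, fun y _ => ⟨hGγ y, hreg y⟩⟩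

theorem HasCircularSections.exists_mem_quotientAtlas [ContinuousConstSMul Γ PuncturedH2]
    (hΓ : HasCircularSections Γ) (x : PuncturedH2) :
    ∃ e ∈ quotientAtlas Γ, (x : H2) ∈ e.target ∧ orbitProj Γ x ∈ e.source := by
  obtain ⟨U, hUo, hUc, hxU, h0, hinj⟩ := hΓ x
  have : Nonempty PuncturedH2 := ⟨x⟩
  have hquot : IsOpenQuotientMap (orbitProj Γ) := MulAction.isOpenQuotientMap_quotientMk
  obtain ⟨e, het, hes⟩ := exists_openPartialHomeomorph_of_injOn isOpenEmbedding_puncturedH2_val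
    hquot.continuous hquot.isOpenMap (hUo.preimage continuous_subtype_val) hinj
  have hval : Subtype.val '' (Subtype.val ⁻¹' U : Set PuncturedH2) = U := by
    refine Set.image_preimage_eq_of_subset fun y hy => ?_
    exact ⟨⟨y, fun h => h0 (h ▸ hy)⟩, rfl⟩
  rw [hval] at het
  refine ⟨e, ⟨het ▸ hUc, fun y hy => ?_⟩, het ▸ hxU, ?_⟩
  · exact ⟨fun h => h0 (h ▸ het ▸ hy), hes ⟨y, fun h => h0 (h ▸ het ▸ hy)⟩⟩
  · rw [← hes]
    exact e.map_target (het ▸ hxU)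

theorem eventually_apply_orbitProj_eq [ContinuousConstSMul Γ PuncturedH2]
    {e : OpenPartialHomeomorph (Quotient (MulAction.orbitRel Γ PuncturedH2)) H2}
    (he : e ∈ quotientAtlas Γ) {x : PuncturedH2} (hx : orbitProj Γ x ∈ e.source) :
    ∃ γ ∈ Γ, ∀ᶠ y in 𝓝 x, e (orbitProj Γ y) = γ y := by
  obtain ⟨hex, hsymm⟩ := he.2 _ (e.map_source hx)
  rw [e.left_inv hx] at hsymm
  obtain ⟨γ, hγ, hγx⟩ := orbitProj_eq_iff.mp hsymm.symm
  have hcont : Continuous fun y : PuncturedH2 => (γ y : H2) :=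
    continuous_subtype_val.comp (continuous_const_smul (⟨γ, hγ⟩ : Γ))
  have htarget : ∀ᶠ y in 𝓝 x, (γ y : H2) ∈ e.target :=
    hcont.continuousAt.eventually_mem
      (e.open_target.mem_nhds (by rw [hγx]; exact e.map_source hx))
  refine ⟨γ, hγ, htarget.mono fun y hy => ?_⟩
  obtain ⟨_, hy'⟩ := he.2 _ hy
  rw [← orbitProj_eq_iff.mpr ⟨γ, hγ, rfl⟩, ← hy', e.right_inv hy]

theorem quotientAtlas_trans_eventuallyEq [ContinuousConstSMul Γ PuncturedH2]
    {e e' : OpenPartialHomeomorph (Quotient (MulAction.orbitRel Γ PuncturedH2)) H2}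
    (he : e ∈ quotientAtlas Γ) (he' : e' ∈ quotientAtlas Γ) {y : H2}
    (hy : y ∈ (e.symm.trans e').source) :
    ∃ γ ∈ Γ, ∀ G : H2 → H2, (∀ x : PuncturedH2, G x = γ x) → ⇑(e.symm.trans e') =ᶠ[𝓝 y] G := by
  obtain ⟨hye : y ∈ e.target, hye' : e.symm y ∈ e'.source⟩ :=
    (OpenPartialHomeomorph.trans_source ..).subset hy
  obtain ⟨hy0, hsymm⟩ := he.2 y hye
  obtain ⟨γ, hγ, hlocal⟩ := eventually_apply_orbitProj_eq he' (hsymm ▸ hye')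
  refine ⟨γ, hγ, fun G hG => ?_⟩
  have htarget : ∀ᶠ x in 𝓝 y, x ∈ e.target := e.open_target.mem_nhds hye
  refine (eventually_nhds_puncturedH2_iff (x := ⟨y, hy0⟩)).mpr ?_
  filter_upwards [eventually_nhds_puncturedH2_iff.mp htarget, hlocal] with x hxe hx
  obtain ⟨_, hsymm_x⟩ := he.2 x hxe
  calc e' (e.symm x) = e' (orbitProj Γ x) := by rw [hsymm_x]
    _ = G x := by rw [hx, hG]

theorem isSliceQuaternionicAtlas_quotientAtlas (hreg : IsSliceRegularGroup Γ)
    (hsec : HasCircularSections Γ) : IsSliceQuaternionicAtlas (quotientAtlas Γ) := by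
  have := hreg.continuousConstSMul
  refine ⟨fun x => ?_, fun e he => he.1, fun e he e' he' y hy => ?_, fun e he e' he' y hy => ?_⟩
  · obtain ⟨y, rfl⟩ := Quotient.exists_rep x
    exact (hsec.exists_mem_quotientAtlas y).imp fun e he => ⟨he.1, he.2.2⟩
  · obtain ⟨γ, hγ, h⟩ := quotientAtlas_trans_eventuallyEq he he' hy
    obtain ⟨G, hsmooth, -, hGγ⟩ := hreg γ hγ
    exact (hsmooth.contDiffAt.congr_of_eventuallyEq (h G hGγ)).contDiffWithinAt
  · obtain ⟨γ, hγ, h⟩ := quotientAtlas_trans_eventuallyEq he he' hy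
    obtain ⟨G, -, hGreg, hGγ⟩ := hreg γ hγ
    exact (hGreg y).congr (h G hGγ)

theorem sliceRegularOnPunctured_quotientAtlas (hreg : IsSliceRegularGroup Γ)
    {e : OpenPartialHomeomorph (Quotient (MulAction.orbitRel Γ PuncturedH2)) H2}
    (he : e ∈ quotientAtlas Γ) :
    SliceRegularOnPunctured (fun y => e (orbitProj Γ y)) (orbitProj Γ ⁻¹' e.source) := by
  have := hreg.continuousConstSMul
  refine ⟨Function.extend Subtype.val (fun y => e (orbitProj Γ y)) 0,
    fun y hy => ⟨Subtype.val_injective.extend_apply .., ?_⟩⟩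
  obtain ⟨γ, hγ, h⟩ := eventually_apply_orbitProj_eq he hy
  obtain ⟨G, -, hGreg, hGγ⟩ := hreg γ hγ
  refine (hGreg y).congr (eventually_nhds_puncturedH2_iff.mpr (h.mono fun x hx => ?_))
  rw [Subtype.val_injective.extend_apply, hx, hGγ]

theorem isHopfSurface_quotientAtlas [ProperlyDiscontinuousSMul Γ PuncturedH2]
    [IsCancelSMul Γ PuncturedH2] (hreg : IsSliceRegularGroup Γ) (hsec : HasCircularSections Γ)
    (hcyc : Nonempty (Γ ≃* Multiplicative ℤ)) :
    IsHopfSurface (quotientAtlas Γ) (orbitProj Γ) := by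
  have := hreg.continuousConstSMul
  have hcov : IsQuotientCoveringMap (orbitProj Γ) Γ :=
    isQuotientCoveringMap_quotientMk_of_properlyDiscontinuousSMul
  exact
  { t2 := t2Space_of_properlyDiscontinuousSMul_of_t2Space
    secondCountable := ContinuousConstSMul.secondCountableTopology
    atlas := isSliceQuaternionicAtlas_quotientAtlas hreg hsec
    covering := hcov.isCoveringMap
    surjective := hcov.surjective
    simplyConnected := inferInstance
    sliceQuaternionic := fun e he => sliceRegularOnPunctured_quotientAtlas hreg he
    fundamentalGroup := fun x => by
      obtain ⟨y, rfl⟩ := hcov.surjective x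
      exact hcyc.map fun φ =>
        (hcov.fundamentalGroupEquiv ⟨y, rfl⟩).trans ((MulEquiv.inv' _).symm.trans φ) }

theorem admitsAffineStructure_quotientAtlas (hreg : IsSliceRegularGroup Γ)
    (hsec : HasCircularSections Γ)
    (haff : ∀ γ ∈ Γ, ∃ (A : (Matrix (Fin 2) (Fin 2) ℍ[ℝ])ˣ) (b : H2), ∀ x : PuncturedH2,
      affineH2 A b x = γ x) :
    AdmitsAffineStructure (quotientAtlas Γ) := by
  have hatlas := isSliceQuaternionicAtlas_quotientAtlas hreg hsec
  have := hreg.continuousConstSMul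
  refine ⟨quotientAtlas Γ, ⟨hatlas.covers, fun e he e' he' y hy => ?_⟩, by rwa [Set.union_self]⟩
  obtain ⟨γ, hγ, h⟩ := quotientAtlas_trans_eventuallyEq he he' hy
  obtain ⟨A, b, hA⟩ := haff γ hγ
  exact ⟨A, b, h _ hA⟩

end Quotient

theorem AdmitsAffineStructure.admitsSliceRegularAffineCharts {X : Type*} [TopologicalSpace X]
    {𝒜 : Set (OpenPartialHomeomorph X H2)} (h : AdmitsAffineStructure 𝒜) :
    AdmitsSliceRegularAffineCharts 𝒜 :=
  have ⟨ℬ, haff, hunion⟩ := h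
  ⟨ℬ, haff, fun e he e' he' => hunion.sliceRegular e (.inl he) e' (.inr he')⟩

/-! ### The Hopf group -/

section HopfGroup

/-- The condition under which all iterates of `f` keep the form `(z, w) ↦ (z a + w^p c, w b)`:
either there is no monomial `w^p λ`, or it is linear, or `β` is real, so that it commutes with
`w`. -/
def HasTriangularIterates (p : ℕ) (β l : ℍ[ℝ]) : Prop :=
  l = 0 ∨ p = 1 ∨ ∃ r : ℝ, β = (r : ℍ[ℝ])

/-- The coefficient of `w ^ p` in the first component of the `n`-th iterate of `f`. -/
def hopfCoeff (p : ℕ) (α β l : ℍ[ℝ]) : ℕ → ℍ[ℝ]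
  | 0 => 0
  | n + 1 => hopfCoeff p α β l n * α + (β ^ n) ^ p * l

variable {p : ℕ} {α β l : ℍ[ℝ]} {hp : p ≠ 0} {hα : 0 < ‖α‖} {hβ : 0 < ‖β‖}

theorem HopfCaseA.hasTriangularIterates (h : HopfCaseA p α β l) : HasTriangularIterates p β l := by
  rcases h with ⟨hl, -⟩ | ⟨hl, -⟩ | ⟨-, hp, -⟩
  exacts [.inl hl, .inl hl, .inr (.inl hp)]

theorem HopfCaseB.hasTriangularIterates (h : HopfCaseB p α β l) : HasTriangularIterates p β l :=
  .inr (.inr h.2.2.1)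

theorem HasTriangularIterates.mul_zpow_pow_mul (h : HasTriangularIterates p β l) (k : ℤ)
    (w : ℍ[ℝ]) : (w * β ^ k) ^ p * l = w ^ p * ((β ^ k) ^ p * l) := by
  rcases h with rfl | rfl | ⟨r, rfl⟩
  · simp
  · simp [mul_assoc]
  · have hcomm : Commute w (r : ℍ[ℝ]) := (Quaternion.coe_commutes r w).symm
    rw [(hcomm.zpow_right₀ k).mul_pow, mul_assoc]

theorem hopfPerm_zpow_apply (h : HasTriangularIterates p β l) (k : ℤ) :
    ∃ c : ℍ[ℝ], (l = 0 → c = 0) ∧ ∀ x : PuncturedH2,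
      ((hopfPerm p α β l hp hα hβ ^ k) x : H2) =
        (x.1.1 * α ^ k + x.1.2 ^ p * c, x.1.2 * β ^ k) := by
  have hα' : α ≠ 0 := norm_pos_iff.mp hα
  have hβ' : β ≠ 0 := norm_pos_iff.mp hβ
  induction k using Int.induction_on with
  | zero => exact ⟨0, by simp⟩
  | succ n ih =>
    obtain ⟨c, hc, hx⟩ := ih
    refine ⟨c * α + (β ^ (n : ℤ)) ^ p * l, fun hl => by simp [hc hl, hl], fun x => ?_⟩
    rw [add_comm, zpow_add, zpow_one, Equiv.Perm.mul_apply]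
    change hopfMap p α β l _ = _
    rw [hx x, hopfMap]
    dsimp only
    rw [h.mul_zpow_pow_mul, add_comm 1, zpow_add_one₀ hα', zpow_add_one₀ hβ']
    simp only [add_mul, mul_add, mul_assoc, add_assoc]
  | pred n ih =>
    obtain ⟨c, hc, hx⟩ := ih
    refine ⟨c * α⁻¹ - (β ^ (-(n : ℤ) - 1)) ^ p * l * α⁻¹, fun hl => by simp [hc hl, hl],
      fun x => ?_⟩
    rw [sub_eq_add_neg, add_comm, zpow_add, zpow_neg_one, Equiv.Perm.mul_apply]
    change ((_ - (_ * β⁻¹) ^ p * l) * α⁻¹, _ * β⁻¹) = _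
    rw [hx x]
    dsimp only
    have hsnd : x.1.2 * β ^ (-(n : ℤ)) * β⁻¹ = x.1.2 * β ^ (-(n : ℤ) - 1) := by
      rw [zpow_sub_one₀ hβ', mul_assoc]
    rw [hsnd, h.mul_zpow_pow_mul, add_comm (-1), ← sub_eq_add_neg, zpow_sub_one₀ hα']
    simp only [add_mul, sub_mul, mul_sub, mul_assoc, add_sub_assoc]

theorem hopfPerm_pow_apply (h : HasTriangularIterates p β l) (n : ℕ) (x : PuncturedH2) :
    ((hopfPerm p α β l hp hα hβ ^ n) x : H2) =
      (x.1.1 * α ^ n + x.1.2 ^ p * hopfCoeff p α β l n, x.1.2 * β ^ n) := by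
  induction n with
  | zero => simp [hopfCoeff]
  | succ n ih =>
    rw [pow_succ', Equiv.Perm.mul_apply]
    change hopfMap p α β l _ = _
    rw [ih, hopfMap]
    dsimp only
    have hpow := h.mul_zpow_pow_mul n x.1.2
    rw [zpow_natCast] at hpow
    rw [hpow, pow_succ, pow_succ, hopfCoeff]
    simp only [add_mul, mul_add, mul_assoc, add_assoc]

theorem isSliceRegularGroup_hopfGroup (h : HasTriangularIterates p β l) :
    IsSliceRegularGroup (hopfGroup p α β l hp hα hβ) := by
  rintro _ ⟨k, rfl⟩
  obtain ⟨c, -, hc⟩ := hopfPerm_zpow_apply (hp := hp) (hα := hα) (hβ := hβ) h k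
  refine ⟨_, ?_, fun y => sliceRegularAt_triangular p (α ^ k) c (β ^ k) y, fun y => (hc y).symm⟩
  fun_prop

theorem isUnit_matrix_lowerTriangular {R : Type*} [DivisionRing R] {a d : R} (ha : a ≠ 0)
    (hd : d ≠ 0) (c : R) : IsUnit !![a, 0; c, d] := by
  refine ⟨⟨!![a, 0; c, d], !![a⁻¹, 0; -(d⁻¹ * c * a⁻¹), d⁻¹], ?_, ?_⟩, rfl⟩
  all_goals
    refine Matrix.ext fun i j => ?_
    fin_cases i <;> fin_cases j <;> simp [Matrix.mul_apply, ha, hd, mul_assoc]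

theorem HopfCaseA.exists_affineH2_eq (hA : HopfCaseA p α β l) {γ : Equiv.Perm PuncturedH2}
    (hγ : γ ∈ hopfGroup p α β l hp hα hβ) :
    ∃ (A : (Matrix (Fin 2) (Fin 2) ℍ[ℝ])ˣ) (b : H2), ∀ x : PuncturedH2, affineH2 A b x = γ x := by
  obtain ⟨k, rfl⟩ := hγ
  obtain ⟨c, hc, hx⟩ :=
    hopfPerm_zpow_apply (hp := hp) (hα := hα) (hβ := hβ) hA.hasTriangularIterates k
  obtain ⟨A, hAc⟩ := isUnit_matrix_lowerTriangular
    (zpow_ne_zero k (norm_pos_iff.mp hα)) (zpow_ne_zero k (norm_pos_iff.mp hβ)) c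
  refine ⟨A, 0, fun x => ?_⟩
  rw [hAc, affineH2, hx x]
  rcases hA with ⟨hl, -⟩ | ⟨hl, -⟩ | ⟨-, rfl, -⟩
  · simp [hc hl]
  · simp [hc hl]
  · simp

theorem norm_hopfCoeff_mul_le (hp : p ≠ 0) (hαβ : ‖α‖ ≤ ‖β‖) (hβ1 : ‖β‖ ≤ 1) (n : ℕ) :
    ‖hopfCoeff p α β l n‖ * ‖β‖ ≤ n * ‖β‖ ^ n * ‖l‖ := by
  induction n with
  | zero => simp [hopfCoeff]
  | succ n ih =>
    have hsucc : ‖hopfCoeff p α β l (n + 1)‖ ≤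
        ‖hopfCoeff p α β l n‖ * ‖β‖ + ‖β‖ ^ n * ‖l‖ := by
      refine (norm_add_le _ _).trans (add_le_add ?_ ?_)
      · rw [norm_mul]
        gcongr
      · rw [norm_mul, norm_pow, norm_pow]
        gcongr
        exact pow_le_of_le_one (by positivity) (pow_le_one₀ (norm_nonneg _) hβ1) hp
    calc ‖hopfCoeff p α β l (n + 1)‖ * ‖β‖
        ≤ (n * ‖β‖ ^ n * ‖l‖ + ‖β‖ ^ n * ‖l‖) * ‖β‖ := by gcongr; linarith
      _ = (n + 1 : ℕ) * ‖β‖ ^ (n + 1) * ‖l‖ := by push_cast; ring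

theorem tendsto_norm_hopfCoeff (hp : p ≠ 0) (hβ : 0 < ‖β‖) (hαβ : ‖α‖ ≤ ‖β‖) (hβ1 : ‖β‖ < 1) :
    Filter.Tendsto (fun n => ‖hopfCoeff p α β l n‖) Filter.atTop (𝓝 0) := by
  have hbound : Filter.Tendsto (fun n : ℕ => n * ‖β‖ ^ n * ‖l‖ / ‖β‖) Filter.atTop (𝓝 0) := by
    simpa using ((tendsto_self_mul_const_pow_of_lt_one (norm_nonneg β) hβ1).mul_const
      ‖l‖).div_const ‖β‖
  refine squeeze_zero (fun _ => norm_nonneg _) (fun n => ?_) hbound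
  rw [le_div_iff₀ hβ]
  exact norm_hopfCoeff_mul_le hp hαβ hβ1.le n

theorem isUniformlyContracting_hopfPerm (h : HasTriangularIterates p β l) (hαβ : ‖α‖ ≤ ‖β‖)
    (hβ1 : ‖β‖ < 1) : IsUniformlyContracting (hopfPerm p α β l hp hα hβ) := by
  intro R ε hε
  have hlim : Filter.Tendsto (fun n => R * ‖β‖ ^ n + R ^ p * ‖hopfCoeff p α β l n‖)
      Filter.atTop (𝓝 0) := by
    simpa using ((tendsto_pow_atTop_nhds_zero_of_lt_one (norm_nonneg β) hβ1).const_mul R).add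
      ((tendsto_norm_hopfCoeff (l := l) hp hβ hαβ hβ1).const_mul (R ^ p))
  obtain ⟨N, hN⟩ := Filter.eventually_atTop.mp (hlim.eventually (gt_mem_nhds hε))
  refine ⟨N, fun n hn x hx => lt_of_le_of_lt ?_ (hN n hn)⟩
  have hfst : ‖x.1.1‖ ≤ R := (norm_fst_le _).trans hx
  have hsnd : ‖x.1.2‖ ≤ R := (norm_snd_le _).trans hx
  have hR : 0 ≤ R := (norm_nonneg _).trans hx
  rw [hopfPerm_pow_apply h, Prod.norm_mk]
  refine max_le ((norm_add_le _ _).trans ?_) ?_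
  · rw [norm_mul, norm_mul, norm_pow, norm_pow]
    gcongr
  · rw [norm_mul, norm_pow]
    exact (by gcongr : _ ≤ R * ‖β‖ ^ n).trans (le_add_of_nonneg_right (by positivity))

theorem exists_lt_lt_mul_lt {q r : ℝ} (hq : 0 ≤ q) (hq1 : q < 1) (hr : 0 < r) :
    ∃ m M : ℝ, 0 < m ∧ m < r ∧ r < M ∧ M * q < m := by
  obtain ⟨m, hm, hmr⟩ := exists_between (show r * q < r by nlinarith)
  have hm0 : 0 < m := (mul_nonneg hr.le hq).trans_lt hm
  have hnhds : ∀ᶠ M in 𝓝[>] r, M * q < m :=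
    nhdsWithin_le_nhds <| (continuous_mul_const q).continuousAt.eventually_lt_const hm
  obtain ⟨M, hM, hrM⟩ := (hnhds.and self_mem_nhdsWithin).exists
  exact ⟨m, M, hm0, hmr, hrM, hM⟩

theorem exists_circular_wandering_of_snd_ne_zero (h : HasTriangularIterates p β l)
    (hβ1 : ‖β‖ < 1) {x : H2} (hx : x.2 ≠ 0) :
    ∃ U : Set H2, IsOpen U ∧ IsCircular U ∧ x ∈ U ∧ (0 : H2) ∉ U ∧
      ∀ y : PuncturedH2, (y : H2) ∈ U → ∀ n : ℕ, n ≠ 0 →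
        ((hopfPerm p α β l hp hα hβ ^ n) y : H2) ∉ U := by
  obtain ⟨m, M, hm, hmx, hxM, hMm⟩ := exists_lt_lt_mul_lt hβ.le hβ1 (norm_pos_iff.mpr hx)
  refine ⟨{y | m < ‖y.2‖ ∧ ‖y.2‖ < M}, ?_, isCircular_setOf_norm fun _ b => m < b ∧ b < M,
    ⟨hmx, hxM⟩, fun h0 => ?_, fun y hy n hn hyn => ?_⟩
  · exact isOpen_Ioo.preimage (by fun_prop : Continuous fun y : H2 => ‖y.2‖)
  · exact hm.not_gt (by simpa using h0.1)
  · refine hMm.not_gt (hyn.1.trans_le ?_)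
    rw [hopfPerm_pow_apply h, norm_mul, norm_pow]
    have hM : 0 ≤ M := (norm_nonneg _).trans hy.2.le
    exact mul_le_mul hy.2.le (pow_le_of_le_one hβ.le hβ1.le hn) (by positivity) hM

theorem exists_circular_wandering_of_snd_eq_zero (h : HasTriangularIterates p β l)
    (hαβ : ‖α‖ ≤ ‖β‖) (hβ1 : ‖β‖ < 1) {x : H2} (hx : x ≠ 0) (hx2 : x.2 = 0) :
    ∃ U : Set H2, IsOpen U ∧ IsCircular U ∧ x ∈ U ∧ (0 : H2) ∉ U ∧
      ∀ y : PuncturedH2, (y : H2) ∈ U → ∀ n : ℕ, n ≠ 0 →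
        ((hopfPerm p α β l hp hα hβ ^ n) y : H2) ∉ U := by
  have hx1 : 0 < ‖x.1‖ := norm_pos_iff.mpr fun h1 => hx (Prod.ext h1 hx2)
  obtain ⟨m, M, hm, hmx, hxM, hMm⟩ := exists_lt_lt_mul_lt hβ.le hβ1 hx1
  obtain ⟨C, hC⟩ := (tendsto_norm_hopfCoeff (l := l) hp hβ hαβ hβ1).bddAbove_range
  obtain ⟨ε, hε, hε1, hεC⟩ : ∃ ε : ℝ, 0 < ε ∧ ε < 1 ∧ M * ‖β‖ + ε * C < m := by
    have hnhds : ∀ᶠ ε : ℝ in 𝓝[>] 0, ε < 1 ∧ M * ‖β‖ + ε * C < m :=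
      nhdsWithin_le_nhds <| (eventually_lt_nhds one_pos).and <|
        (by fun_prop : Continuous fun ε : ℝ => M * ‖β‖ + ε * C).continuousAt.eventually_lt_const
          (by simpa using hMm)
    obtain ⟨ε, ⟨hε1, hεC⟩, hε⟩ := (hnhds.and self_mem_nhdsWithin).exists
    exact ⟨ε, hε, hε1, hεC⟩
  refine ⟨{y | (m < ‖y.1‖ ∧ ‖y.1‖ < M) ∧ ‖y.2‖ < ε}, ?_,
    isCircular_setOf_norm fun a b => (m < a ∧ a < M) ∧ b < ε,
    ⟨⟨hmx, hxM⟩, by simpa [hx2] using hε⟩, fun h0 => ?_, fun y hy n hn hyn => ?_⟩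
  · exact (isOpen_Ioo.preimage (by fun_prop : Continuous fun y : H2 => ‖y.1‖)).inter
      (isOpen_Iio.preimage (by fun_prop : Continuous fun y : H2 => ‖y.2‖))
  · exact hm.not_gt (by simpa using h0.1.1)
  · refine hεC.not_gt (hyn.1.1.trans_le ?_)
    rw [hopfPerm_pow_apply h]
    refine (norm_add_le _ _).trans ?_
    rw [norm_mul, norm_mul, norm_pow, norm_pow]
    have hαn : ‖α‖ ^ n ≤ ‖β‖ :=
      (pow_le_pow_left₀ (norm_nonneg _) hαβ n).trans (pow_le_of_le_one hβ.le hβ1.le hn)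
    have hyp : ‖y.1.2‖ ^ p ≤ ε :=
      (pow_le_of_le_one (norm_nonneg _) (hy.2.trans hε1).le hp).trans hy.2.le
    have hCn : ‖hopfCoeff p α β l n‖ ≤ C := hC ⟨n, rfl⟩
    have hM : ‖y.1.1‖ ≤ M := hy.1.2.le
    gcongr
    exact hx1.le.trans hxM.le

theorem hasCircularSections_hopfGroup (h : HasTriangularIterates p β l) (hαβ : ‖α‖ ≤ ‖β‖)
    (hβ1 : ‖β‖ < 1) : HasCircularSections (hopfGroup p α β l hp hα hβ) := by
  intro x
  obtain ⟨U, hUo, hUc, hxU, h0, hU⟩ : ∃ U : Set H2, IsOpen U ∧ IsCircular U ∧ (x : H2) ∈ U ∧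
      (0 : H2) ∉ U ∧ ∀ y : PuncturedH2, (y : H2) ∈ U → ∀ n : ℕ, n ≠ 0 →
        ((hopfPerm p α β l hp hα hβ ^ n) y : H2) ∉ U := by
    by_cases hx : x.1.2 = 0
    · exact exists_circular_wandering_of_snd_eq_zero h hαβ hβ1 x.2 hx
    · exact exists_circular_wandering_of_snd_ne_zero h hβ1 hx
  exact ⟨U, hUo, hUc, hxU, h0, injOn_quotientMk_zpowers hU⟩

theorem isHopfSurface_hopfAtlas (h : HasTriangularIterates p β l) (hαβ : ‖α‖ ≤ ‖β‖)
    (hβ1 : ‖β‖ < 1) : IsHopfSurface (hopfAtlas p α β l hp hα hβ) (hopfProj p α β l hp hα hβ) := by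
  have hσ := isUniformlyContracting_hopfPerm (hp := hp) (hα := hα) (hβ := hβ) h hαβ hβ1
  have := hσ.isCancelSMul
  have := hσ.properlyDiscontinuousSMul
  exact isHopfSurface_quotientAtlas (isSliceRegularGroup_hopfGroup h)
    (hasCircularSections_hopfGroup h hαβ hβ1) hσ.nonempty_zpowers_mulEquiv

theorem admitsAffineStructure_hopfAtlas (hA : HopfCaseA p α β l) (hαβ : ‖α‖ ≤ ‖β‖)
    (hβ1 : ‖β‖ < 1) : AdmitsAffineStructure (hopfAtlas p α β l hp hα hβ) :=
  admitsAffineStructure_quotientAtlas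
    (isSliceRegularGroup_hopfGroup hA.hasTriangularIterates)
    (hasCircularSections_hopfGroup hA.hasTriangularIterates hαβ hβ1)
    fun _ hγ => hA.exists_affineH2_eq hγ

end HopfGroup

/-! ### Locally constant cocycles and developing maps -/

section Cocycle

open Filter

/-- `τ` is a locally constant Čech 1-cocycle of the cover `U` with values in `G`. -/
structure IsLocallyConstantCocycle {ι M G : Type*} [TopologicalSpace M] [Group G] (U : ι → Set M)
    (τ : ι → ι → M → G) : Prop where
  mul_eq : ∀ i j k, ∀ z ∈ U i ∩ U j ∩ U k, τ i j z * τ j k z = τ i k z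
  eventually_eq : ∀ i j, ∀ z ∈ U i ∩ U j, ∀ᶠ t in 𝓝 z, τ i j t = τ i j z

namespace IsLocallyConstantCocycle

variable {M G : Type*} [TopologicalSpace M] [Group G] {U : M → Set M} {τ : M → M → M → G}

theorem self_eq_one (h : IsLocallyConstantCocycle U τ) {x z : M} (hz : z ∈ U x) : τ x x z = 1 :=
  mul_eq_left.mp (h.mul_eq x x x z ⟨⟨hz, hz⟩, hz⟩)

/-- The principal bundle of a cocycle with values in a discrete group; the fibre coordinates
change by right multiplication with `τ`. -/
def fiberBundleCore [TopologicalSpace G] [DiscreteTopology G] (h : IsLocallyConstantCocycle U τ)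
    (hU : ∀ x, IsOpen (U x)) (hxU : ∀ x, x ∈ U x) : FiberBundleCore M M G where
  baseSet := U
  isOpen_baseSet := hU
  indexAt := id
  mem_baseSet_at := hxU
  coordChange x y z g := g * τ x y z
  coordChange_self x z hz g := by rw [h.self_eq_one hz, mul_one]
  continuousOn_coordChange x y := by
    rintro ⟨z, g⟩ ⟨hz, -⟩
    have hlocal : (fun q : M × G => q.2 * τ x y z) =ᶠ[𝓝 (z, g)] fun q => q.2 * τ x y q.1 := by
      filter_upwards [(continuous_fst.tendsto (z, g)).eventually (h.eventually_eq x y z hz)]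
        with q hq
      rw [hq]
    have hright : Continuous fun g : G => g * τ x y z := continuous_of_discreteTopology
    exact ((hright.comp continuous_snd).continuousAt.congr hlocal).continuousWithinAt
  coordChange_comp x y w z hz g := by rw [mul_assoc, h.mul_eq x y w z hz]

-- The bundle of the cocycle is a covering, which has a section because the base is simply
-- connected.
theorem exists_eventually_mul_eq [SimplyConnectedSpace M] [LocallyPathConnectedSpace M]
    (h : IsLocallyConstantCocycle U τ) (hU : ∀ x, IsOpen (U x)) (hxU : ∀ x, x ∈ U x) :
    ∃ γ : M → G, ∀ x, ∀ᶠ t in 𝓝 x, γ t * τ t x t = γ x := by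
  let _ : TopologicalSpace G := ⊥
  have : DiscreteTopology G := ⟨rfl⟩
  let Z := h.fiberBundleCore hU hxU
  have hcov : IsCoveringMap (Bundle.TotalSpace.proj : Bundle.TotalSpace G Z.Fiber → M) :=
    FiberBundle.isCoveringMap
  obtain ⟨x₀⟩ : Nonempty M := inferInstance
  obtain ⟨s, ⟨-, hs⟩, -⟩ := hcov.existsUnique_continuousMap_lifts (ContinuousMap.id M) x₀
    ⟨x₀, (1 : G)⟩ rfl
  have hproj : ∀ x, (s x).proj = x := congrFun hs
  let γ : M → G := fun x => (s x).2
  refine ⟨γ, fun x => ?_⟩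
  have hcoord : ∀ t, (Z.localTriv x (s t)).2 = γ t * τ t x t := by
    intro t
    change γ t * τ (s t).proj x (s t).proj = _
    rw [hproj]
  have hcont : ContinuousAt (fun t => (Z.localTriv x (s t)).2) x := by
    refine continuous_snd.continuousAt.comp (ContinuousAt.comp ?_ s.continuous.continuousAt)
    refine (Z.localTriv x).continuousAt ?_
    rw [Z.mem_localTriv_source]
    exact (hproj x).symm ▸ hxU x
  simp only [hcoord] at hcont
  have hγ : γ x * τ x x x = γ x := by rw [h.self_eq_one (hxU x), mul_one]
  exact hcont.eventually_mem ((isOpen_discrete {γ x}).mem_nhds hγ)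

end IsLocallyConstantCocycle

end Cocycle

section Developing

open Filter

variable {ι M V : Type*} [TopologicalSpace M] [TopologicalSpace V] {G : Subgroup (Equiv.Perm V)}

/-- A group of bijections, two of which coincide as soon as they agree near some point. -/
def IsRigidGroup (G : Subgroup (Equiv.Perm V)) : Prop :=
  ∀ g ∈ G, ∀ g' ∈ G, ∀ v, ⇑g =ᶠ[𝓝 v] ⇑g' → g = g'

theorem IsRigidGroup.eq_of_eventuallyEq_comp (hG : IsRigidGroup G) {φ : M → V} {z : M}
    (hφ : 𝓝 (φ z) ≤ map φ (𝓝 z)) {g g' : Equiv.Perm V} (hg : g ∈ G) (hg' : g' ∈ G)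
    (h : ∀ᶠ y in 𝓝 z, g (φ y) = g' (φ y)) : g = g' :=
  hG g hg g' hg' (φ z) (hφ (show _ ∈ _ from h))

theorem IsRigidGroup.exists_isLocallyConstantCocycle (hG : IsRigidGroup G) {U : ι → Set M}
    (hU : ∀ i, IsOpen (U i)) {φ : ι → M → V} (hφ : ∀ i, ∀ z ∈ U i, 𝓝 (φ i z) ≤ map (φ i) (𝓝 z))
    (htrans : ∀ i j, ∀ z ∈ U i ∩ U j, ∃ g ∈ G, ∀ᶠ t in 𝓝 z, φ i t = g (φ j t)) :
    ∃ τ : ι → ι → M → G, IsLocallyConstantCocycle U τ ∧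
      ∀ i j, ∀ z ∈ U i ∩ U j, ∀ᶠ t in 𝓝 z, φ i t = (τ i j z : Equiv.Perm V) (φ j t) := by
  have htotal : ∀ i j z, ∃ g : G, z ∈ U i ∩ U j →
      ∀ᶠ t in 𝓝 z, φ i t = (g : Equiv.Perm V) (φ j t) := by
    intro i j z
    by_cases hz : z ∈ U i ∩ U j
    · obtain ⟨g, hg, h⟩ := htrans i j z hz
      exact ⟨⟨g, hg⟩, fun _ => h⟩
    · exact ⟨1, fun h => absurd h hz⟩
  choose τ hτ using htotal
  have hunique : ∀ i, ∀ z ∈ U i, ∀ g g' : G,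
      (∀ᶠ t in 𝓝 z, (g : Equiv.Perm V) (φ i t) = (g' : Equiv.Perm V) (φ i t)) → g = g' :=
    fun i z hz g g' h => Subtype.ext (hG.eq_of_eventuallyEq_comp (hφ i z hz) g.2 g'.2 h)
  refine ⟨τ, ⟨fun i j k z ⟨⟨hi, hj⟩, hk⟩ => ?_, fun i j z hz => ?_⟩, hτ⟩
  · refine hunique k z hk _ _ ?_
    filter_upwards [hτ i j z ⟨hi, hj⟩, hτ j k z ⟨hj, hk⟩, hτ i k z ⟨hi, hk⟩] with t hij hjk hik
    rw [← hik, hij, hjk]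
    rfl
  · filter_upwards [(hτ i j z hz).eventually_nhds, ((hU i).inter (hU j)).mem_nhds hz] with t ht hti
    refine hunique j t hti.2 _ _ ?_
    filter_upwards [hτ i j t hti, ht] with s hst hsz
    rw [← hst, hsz]

theorem IsRigidGroup.exists_eventually_eq_apply [SimplyConnectedSpace M]
    [LocallyPathConnectedSpace M] (hG : IsRigidGroup G) {U : M → Set M} (hU : ∀ x, IsOpen (U x))
    (hxU : ∀ x, x ∈ U x) {φ : M → M → V} (hφ : ∀ x, ∀ z ∈ U x, 𝓝 (φ x z) ≤ map (φ x) (𝓝 z))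
    (htrans : ∀ x y, ∀ z ∈ U x ∩ U y, ∃ g ∈ G, ∀ᶠ t in 𝓝 z, φ x t = g (φ y t)) :
    ∃ dev : M → V, ∀ x, ∃ g ∈ G, ∀ᶠ t in 𝓝 x, dev t = g (φ x t) := by
  obtain ⟨τ, hcocycle, hτ⟩ := hG.exists_isLocallyConstantCocycle hU hφ htrans
  obtain ⟨γ, hγ⟩ := hcocycle.exists_eventually_mul_eq hU hxU
  refine ⟨fun x => (γ x : Equiv.Perm V) (φ x x), fun x => ⟨γ x, (γ x).2, ?_⟩⟩
  filter_upwards [hγ x, (hU x).mem_nhds (hxU x)] with t ht htU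
  rw [← ht, (hτ t x t ⟨hxU t, htU⟩).self_of_nhds]
  rfl

theorem IsRigidGroup.exists_forall_eq_apply [PreconnectedSpace M] [Nonempty M]
    (hG : IsRigidGroup G) {d d' : M → V} (hd : ∀ z, 𝓝 (d z) ≤ map d (𝓝 z))
    (h : ∀ z, ∃ g ∈ G, ∀ᶠ t in 𝓝 z, d' t = g (d t)) : ∃ g ∈ G, ∀ z, d' z = g (d z) := by
  choose g hg h using h
  have hlocal : IsLocallyConstant g := by
    rw [IsLocallyConstant.iff_eventually_eq]
    intro z
    filter_upwards [(h z).eventually_nhds] with t ht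
    refine hG.eq_of_eventuallyEq_comp (hd t) (hg t) (hg z) ?_
    filter_upwards [h t, ht] with s hst hsz
    rw [← hst, hsz]
  obtain ⟨z₀⟩ : Nonempty M := inferInstance
  refine ⟨g z₀, hg z₀, fun z => ?_⟩
  rw [(h z).self_of_nhds, hlocal.apply_eq_of_preconnectedSpace z z₀]

end Developing

/-! ### The group of quaternionic affine transformations -/

section AffineGroup

/-- The linear map `x ↦ x A` of row vectors, real linear so that it is available to real
differential calculus. -/
def rowMulCLM (A : Matrix (Fin 2) (Fin 2) ℍ[ℝ]) : H2 →L[ℝ] H2 :=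
  let m := fun c : ℍ[ℝ] => (ContinuousLinearMap.mul ℝ ℍ[ℝ]).flip c
  let f := ContinuousLinearMap.fst ℝ ℍ[ℝ] ℍ[ℝ]
  let s := ContinuousLinearMap.snd ℝ ℍ[ℝ] ℍ[ℝ]
  ((m (A 0 0)).comp f + (m (A 1 0)).comp s).prod ((m (A 0 1)).comp f + (m (A 1 1)).comp s)

theorem rowMulCLM_apply (A : Matrix (Fin 2) (Fin 2) ℍ[ℝ]) (x : H2) :
    rowMulCLM A x = (x.1 * A 0 0 + x.2 * A 1 0, x.1 * A 0 1 + x.2 * A 1 1) := rfl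

theorem affineH2_eq (A : Matrix (Fin 2) (Fin 2) ℍ[ℝ]) (b x : H2) :
    affineH2 A b x = rowMulCLM A x + b := rfl

theorem rowMulCLM_mul (A B : Matrix (Fin 2) (Fin 2) ℍ[ℝ]) (x : H2) :
    rowMulCLM (A * B) x = rowMulCLM B (rowMulCLM A x) := by
  simp only [rowMulCLM_apply, Matrix.mul_apply, Fin.sum_univ_two, mul_add, add_mul, mul_assoc]
  ext1 <;> dsimp only <;> abel

theorem rowMulCLM_one (x : H2) : rowMulCLM 1 x = x := by
  simp [rowMulCLM_apply]

theorem rowMulCLM_smul (A : Matrix (Fin 2) (Fin 2) ℍ[ℝ]) (c : ℍ[ℝ]) (x : H2) :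
    rowMulCLM A (c • x) = c • rowMulCLM A x := by
  simp [rowMulCLM_apply, mul_add, mul_assoc]

theorem continuous_affineH2 (A : Matrix (Fin 2) (Fin 2) ℍ[ℝ]) (b : H2) :
    Continuous (affineH2 A b) :=
  (rowMulCLM A).continuous.add continuous_const

/-- The group of invertible affine transformations `x ↦ x A + b` of `ℍ²`. -/
def affineGroup : Subgroup (Equiv.Perm H2) where
  carrier := {σ | ∃ (A : (Matrix (Fin 2) (Fin 2) ℍ[ℝ])ˣ) (b : H2), ∀ x, σ x = affineH2 A b x}
  one_mem' := ⟨1, 0, fun x => by simp [affineH2_eq, rowMulCLM_one]⟩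
  mul_mem' := by
    rintro σ σ' ⟨A, b, h⟩ ⟨A', b', h'⟩
    refine ⟨A' * A, rowMulCLM A b' + b, fun x => ?_⟩
    rw [Equiv.Perm.mul_apply, h, h', affineH2_eq, affineH2_eq, affineH2_eq, Units.val_mul,
      rowMulCLM_mul, map_add, add_assoc]
  inv_mem' := by
    rintro σ ⟨A, b, h⟩
    refine ⟨A⁻¹, -rowMulCLM (A⁻¹ : (Matrix (Fin 2) (Fin 2) ℍ[ℝ])ˣ) b, fun x => ?_⟩
    rw [Equiv.Perm.inv_eq_iff_eq, h, affineH2_eq, affineH2_eq, map_add, map_neg, ← rowMulCLM_mul,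
      ← rowMulCLM_mul, Units.inv_mul, rowMulCLM_one, rowMulCLM_one, neg_add_cancel_right]

/-- The affine transformation `x ↦ x A + b` as a bijection. -/
def affinePerm (A : (Matrix (Fin 2) (Fin 2) ℍ[ℝ])ˣ) (b : H2) : Equiv.Perm H2 where
  toFun := affineH2 A b
  invFun x := rowMulCLM (A⁻¹ : (Matrix (Fin 2) (Fin 2) ℍ[ℝ])ˣ) (x - b)
  left_inv x := by
    dsimp only
    rw [affineH2_eq, add_sub_cancel_right, ← rowMulCLM_mul, Units.mul_inv, rowMulCLM_one]
  right_inv x := by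
    rw [affineH2_eq, ← rowMulCLM_mul, Units.inv_mul, rowMulCLM_one, sub_add_cancel]

theorem affinePerm_mem_affineGroup (A : (Matrix (Fin 2) (Fin 2) ℍ[ℝ])ˣ) (b : H2) :
    affinePerm A b ∈ affineGroup := ⟨A, b, fun _ => rfl⟩

theorem isRigidGroup_affineGroup : IsRigidGroup affineGroup := by
  rintro g ⟨A, b, hg⟩ g' ⟨A', b', hg'⟩ v h
  ext1 x
  have hlim : Filter.Tendsto (fun t : ℝ => v + t • (x - v)) (𝓝[≠] 0) (𝓝 v) := by
    refine (Continuous.tendsto' ?_ 0 v ?_).mono_left nhdsWithin_le_nhds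
    · fun_prop
    · rw [zero_smul, add_zero]
  obtain ⟨t, ht, ht0⟩ := ((hlim.eventually h).and self_mem_nhdsWithin).exists
  have hv := h.self_of_nhds
  simp only [hg, hg', affineH2_eq, map_add, map_smul, map_sub] at ht hv ⊢
  refine smul_right_injective H2 ht0 ?_
  linear_combination (norm := module) ht - (1 - t) • hv

theorem map_nhds_eq_of_mem_affineGroup {g : Equiv.Perm H2} (hg : g ∈ affineGroup) (v : H2) :
    Filter.map g (𝓝 v) = 𝓝 (g v) := by
  have hcont : ∀ g ∈ affineGroup, Continuous g := by
    rintro g ⟨A, b, h⟩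
    exact (continuous_affineH2 A b).congr fun x => (h x).symm
  exact (Homeomorph.mk g (hcont g hg) (hcont g⁻¹ (affineGroup.inv_mem hg))).map_nhds_eq v

end AffineGroup

/-! ### Developing maps of affine atlases -/

section AffineAtlas

variable {X M : Type*} [TopologicalSpace X] [TopologicalSpace M]
  {ℬ : Set (OpenPartialHomeomorph X H2)} {q : M → X} {dev : M → H2}

/-- `dev` is a developing map, along `q`, of the affine structure with atlas `ℬ`: near each point
it is an affine transformation of a chart. -/
def IsDevelopingMap (ℬ : Set (OpenPartialHomeomorph X H2)) (q : M → X) (dev : M → H2) : Prop :=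
  ∀ x, ∃ e ∈ ℬ, q x ∈ e.source ∧ ∃ g ∈ affineGroup, ∀ᶠ t in 𝓝 x, dev t = g (e (q t))

theorem IsAffineAtlas.exists_eventually_eq (hℬ : IsAffineAtlas ℬ)
    {e e' : OpenPartialHomeomorph X H2} (he : e ∈ ℬ) (he' : e' ∈ ℬ) {x : X} (hx : x ∈ e.source)
    (hx' : x ∈ e'.source) : ∃ g ∈ affineGroup, ∀ᶠ y in 𝓝 x, e' y = g (e y) := by
  have hsource : e x ∈ (e.symm.trans e').source := by
    rw [OpenPartialHomeomorph.trans_source]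
    refine ⟨e.map_source hx, ?_⟩
    rwa [Set.mem_preimage, e.left_inv hx]
  obtain ⟨A, b, hAb⟩ := hℬ.affine e he e' he' _ hsource
  refine ⟨affinePerm A b, affinePerm_mem_affineGroup A b, ?_⟩
  filter_upwards [(e.continuousAt hx).eventually hAb, e.open_source.mem_nhds hx] with y hy hye
  rwa [OpenPartialHomeomorph.coe_trans, Function.comp_apply, e.left_inv hye] at hy

theorem map_nhds_chart_comp_eq (hq : IsLocalHomeomorph q)
    (e : OpenPartialHomeomorph X H2) {z : M} (hz : q z ∈ e.source) :
    Filter.map (fun t => e (q t)) (𝓝 z) = 𝓝 (e (q z)) := by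
  rw [← e.map_nhds_eq hz, ← hq.map_nhds_eq, Filter.map_map]
  rfl

theorem IsAffineAtlas.exists_isDevelopingMap [SimplyConnectedSpace M] [LocallyPathConnectedSpace M]
    (hℬ : IsAffineAtlas ℬ) (hq : IsLocalHomeomorph q) : ∃ dev, IsDevelopingMap ℬ q dev := by
  choose e he hsource using fun x => hℬ.covers (q x)
  obtain ⟨dev, hdev⟩ := isRigidGroup_affineGroup.exists_eventually_eq_apply
    (fun x => (e x).open_source.preimage hq.continuous) hsource
    (fun x z hz => (map_nhds_chart_comp_eq hq (e x) hz).ge) fun x y z hz =>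
      have ⟨g, hg, h⟩ := hℬ.exists_eventually_eq (he y) (he x) hz.2 hz.1
      ⟨g, hg, hq.continuous.continuousAt.eventually h⟩
  exact ⟨dev, fun x => ⟨e x, he x, hsource x, hdev x⟩⟩

namespace IsDevelopingMap

theorem map_nhds_eq (h : IsDevelopingMap ℬ q dev) (hq : IsLocalHomeomorph q) (x : M) :
    Filter.map dev (𝓝 x) = 𝓝 (dev x) := by
  obtain ⟨e, -, hx, g, hg, hdev⟩ := h x
  rw [Filter.map_congr hdev, hdev.self_of_nhds, ← map_nhds_eq_of_mem_affineGroup hg,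
    ← map_nhds_chart_comp_eq hq e hx, Filter.map_map]
  rfl

theorem exists_injOn (h : IsDevelopingMap ℬ q dev) (hq : IsLocalHomeomorph q) (x : M) :
    ∃ U ∈ 𝓝 x, Set.InjOn dev U := by
  obtain ⟨e, -, hx, g, -, hdev⟩ := h x
  obtain ⟨c, hc, rfl⟩ := hq x
  refine ⟨_, (hdev.and (c.open_source.mem_nhds hc)).and
    (hq.continuous.continuousAt.eventually_mem (e.open_source.mem_nhds hx)), ?_⟩
  rintro y ⟨⟨hy, hyc⟩, hye⟩ z ⟨⟨hz, hzc⟩, hze⟩ hyz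
  rw [hy, hz] at hyz
  exact c.injOn hyc hzc (e.injOn hye hze (g.injective hyz))

theorem exists_forall_apply_eq [PreconnectedSpace M] [Nonempty M] (h : IsDevelopingMap ℬ q dev)
    (hℬ : IsAffineAtlas ℬ) (hq : IsLocalHomeomorph q) {f : M → M} (hf : Continuous f)
    (hqf : ∀ x, q (f x) = q x) : ∃ g ∈ affineGroup, ∀ x, dev (f x) = g (dev x) := by
  refine isRigidGroup_affineGroup.exists_forall_eq_apply (fun x => (h.map_nhds_eq hq x).ge)
    fun x => ?_
  obtain ⟨e, he, hx, g, hg, hdev⟩ := h x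
  obtain ⟨e', he', hfx, g', hg', hdev'⟩ := h (f x)
  obtain ⟨k, hk, htrans⟩ := hℬ.exists_eventually_eq he he' hx (hqf x ▸ hfx)
  refine ⟨g' * k * g⁻¹, mul_mem (mul_mem hg' hk) (inv_mem hg), ?_⟩
  filter_upwards [hdev, hf.continuousAt.eventually hdev',
    hq.continuous.continuousAt.eventually htrans] with t ht hft ht'
  rw [hft, hqf, ht', ht]
  simp

end IsDevelopingMap

end AffineAtlas

section QuotientDeveloping

variable {Γ : Subgroup (Equiv.Perm PuncturedH2)}

instance : LocallyPathConnectedSpace PuncturedH2 :=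
  (isOpen_ne (x := (0 : H2))).locallyPathConnectedSpace

theorem IsDevelopingMap.sliceRegularAt_extend [ContinuousConstSMul Γ PuncturedH2]
    (hsec : HasCircularSections Γ)
    {ℬ : Set (OpenPartialHomeomorph (Quotient (MulAction.orbitRel Γ PuncturedH2)) H2)}
    (hreg : ∀ e ∈ quotientAtlas Γ, ∀ e' ∈ ℬ,
      SliceRegularMapOn (e.symm.trans e') (e.symm.trans e').source)
    {dev : PuncturedH2 → H2} (h : IsDevelopingMap ℬ (orbitProj Γ) dev) (x : PuncturedH2) :
    SliceRegularAt (Function.extend Subtype.val dev 0) x := by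
  obtain ⟨e, he, hx, g, ⟨A, b, hg⟩, hdev⟩ := h x
  obtain ⟨c, hc, hxc, -⟩ := hsec.exists_mem_quotientAtlas x
  have hsource : (x : H2) ∈ (c.symm.trans e).source := by
    rw [OpenPartialHomeomorph.trans_source]
    obtain ⟨_, hsymm⟩ := hc.2 x hxc
    exact ⟨hxc, show c.symm x ∈ e.source from hsymm ▸ hx⟩
  refine ((hreg c hc e he x hsource).affineH2_comp A b).congr ?_
  have htarget : ∀ᶠ y in 𝓝 (x : H2), y ∈ c.target := c.open_target.mem_nhds hxc
  refine eventually_nhds_puncturedH2_iff.mpr ?_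
  filter_upwards [eventually_nhds_puncturedH2_iff.mp htarget, hdev] with y hyc hy
  obtain ⟨_, hsymm⟩ := hc.2 y hyc
  rw [Subtype.val_injective.extend_apply, hy, hg, OpenPartialHomeomorph.coe_trans,
    Function.comp_apply, hsymm]

theorem AdmitsSliceRegularAffineCharts.exists_equivariant_developing
    [ContinuousConstSMul Γ PuncturedH2] (hsec : HasCircularSections Γ)
    (hq : IsLocalHomeomorph (orbitProj Γ))
    (h : AdmitsSliceRegularAffineCharts (quotientAtlas Γ)) :
    ∃ dev : H2 → H2, (∀ x ≠ 0, SliceRegularAt dev x) ∧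
      (∀ x ≠ 0, ∃ U ∈ 𝓝 x, Set.InjOn dev U) ∧
      ∀ γ ∈ Γ, ∃ (A : (Matrix (Fin 2) (Fin 2) ℍ[ℝ])ˣ) (b : H2), ∀ x : PuncturedH2,
        dev (γ x) = affineH2 A b (dev x) := by
  obtain ⟨ℬ, hℬ, hreg⟩ := h
  obtain ⟨d, hd⟩ := hℬ.exists_isDevelopingMap hq
  have hext : ∀ x : PuncturedH2, Function.extend Subtype.val d 0 (x : H2) = d x :=
    Subtype.val_injective.extend_apply d 0
  refine ⟨Function.extend Subtype.val d 0, fun x hx => hd.sliceRegularAt_extend hsec hreg ⟨x, hx⟩,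
    fun x hx => ?_, fun γ hγ => ?_⟩
  · obtain ⟨U, hU, hinj⟩ := hd.exists_injOn hq ⟨x, hx⟩
    refine ⟨Subtype.val '' U, isOpenEmbedding_puncturedH2_val.image_mem_nhds.mpr hU, ?_⟩
    rintro _ ⟨y, hy, rfl⟩ _ ⟨z, hz, rfl⟩ hyz
    rw [hext, hext] at hyz
    rw [hinj hy hz hyz]
  · obtain ⟨σ, ⟨A, b, hσ⟩, hσd⟩ := hd.exists_forall_apply_eq hℬ hq
      (continuous_const_smul (⟨γ, hγ⟩ : Γ)) fun x => orbitProj_eq_iff.mpr ⟨γ, hγ, rfl⟩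
    refine ⟨A, b, fun x => ?_⟩
    rw [hext, hext, ← hσ]
    exact hσd x

end QuotientDeveloping

/-! ### Restriction to complex slices -/

section ComplexSlices

variable {J : ℍ[ℝ]}

theorem exists_sliceEquiv (hJ : J ∈ imagUnits) :
    ∃ T : ℍ[ℝ] ≃L[ℝ] ℂ × ℂ, ∀ (z : ℂ) (q : ℍ[ℝ]), T (sliceEmb J z * q) = z • T q := by
  let : Module ℂ ℍ[ℝ] := Module.compHom _ (sliceHom hJ).toRingHom
  have smul_def (z : ℂ) (q : ℍ[ℝ]) : z • q = sliceEmb J z * q := by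
    rw [← sliceHom_apply hJ]; rfl
  have : IsScalarTower ℝ ℂ ℍ[ℝ] := ⟨fun t z q => by
    simp only [smul_def, ← sliceHom_apply hJ, map_smul, smul_mul_assoc]⟩
  have : Module.Finite ℂ ℍ[ℝ] := .of_restrictScalars_finite ℝ ℂ ℍ[ℝ]
  have hrank : Module.finrank ℂ ℍ[ℝ] = Module.finrank ℂ (ℂ × ℂ) := by
    have := Module.finrank_mul_finrank ℝ ℂ ℍ[ℝ]
    rw [Complex.finrank_real_complex, Quaternion.finrank_eq_four] at this
    rw [Module.finrank_prod, Module.finrank_self]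
    lia
  refine ⟨((LinearEquiv.ofFinrankEq ℍ[ℝ] (ℂ × ℂ) hrank).restrictScalars ℝ)
    |>.toContinuousLinearEquiv, fun z q => ?_⟩
  rw [← smul_def]
  exact map_smul (LinearEquiv.ofFinrankEq ℍ[ℝ] (ℂ × ℂ) hrank) z q

/-- Coordinates on `ℍ`, as a complex plane for the complex structure given by left
multiplication by `J`. -/
def sliceEquiv (hJ : J ∈ imagUnits) : ℍ[ℝ] ≃L[ℝ] ℂ × ℂ := (exists_sliceEquiv hJ).choose

theorem sliceEquiv_sliceEmb_mul (hJ : J ∈ imagUnits) (z : ℂ) (q : ℍ[ℝ]) :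
    sliceEquiv hJ (sliceEmb J z * q) = z • sliceEquiv hJ q :=
  (exists_sliceEquiv hJ).choose_spec z q

theorem sliceEquiv_mul (hJ : J ∈ imagUnits) (q : ℍ[ℝ]) :
    sliceEquiv hJ (J * q) = Complex.I • sliceEquiv hJ q := by
  simpa [sliceEmb] using sliceEquiv_sliceEmb_mul hJ Complex.I q

/-- The value `F₀ + J₁ F₁ + J₂ F₂ + J₁ J₂ F₁₂` of an element of `ℍ ⊗ ℝ₂` at `e₁ = J₁`,
`e₂ = J₂`. -/
def stemEval (J₁ J₂ : ℍ[ℝ]) : StemSpace →L[ℝ] ℍ[ℝ] :=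
  let m := ContinuousLinearMap.mul ℝ ℍ[ℝ]
  (ContinuousLinearMap.id ℝ ℍ[ℝ]).coprod ((m J₁).coprod ((m J₂).coprod (m (J₁ * J₂))))

theorem stemEval_apply (J₁ J₂ : ℍ[ℝ]) (v : StemSpace) :
    stemEval J₁ J₂ v = v.1 + J₁ * v.2.1 + J₂ * v.2.2.1 + J₁ * J₂ * v.2.2.2 := by
  simp [stemEval, add_assoc]

theorem stemEval_e1Left (hJ : J ∈ imagUnits) (J₂ : ℍ[ℝ]) (v : StemSpace) :
    stemEval J J₂ (e1Left v) = J * stemEval J J₂ v := by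
  simp only [stemEval_apply, e1Left, mul_add, ← mul_assoc, show J * J = -1 from hJ]
  simp only [neg_mul, one_mul, mul_neg]
  abel

theorem stemEval_e2Right (hJ : J ∈ imagUnits) (v : StemSpace) :
    stemEval J J (e2Right v) = J * stemEval J J v := by
  simp only [stemEval_apply, e2Right, mul_add, ← mul_assoc, show J * J = -1 from hJ]
  simp only [neg_mul, one_mul, mul_one, mul_neg]
  abel

theorem differentiableAt_of_hasFDerivAt_map_I {E : Type*} [NormedAddCommGroup E] [NormedSpace ℂ E]
    {f : ℂ × ℂ → E} {M : ℂ × ℂ →L[ℝ] E} {z : ℂ × ℂ} (hf : HasFDerivAt f M z)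
    (h₁ : M (Complex.I, 0) = Complex.I • M (1, 0)) (h₂ : M (0, Complex.I) = Complex.I • M (0, 1)) :
    DifferentiableAt ℂ f z := by
  have hM (c : ℂ) (v : ℂ × ℂ) : M (c • v) = c • M v := by
    have e₁ := real_linearMap_map_smul_complex (ℓ := M.toLinearMap.comp (.inl ℝ ℂ ℂ)) h₁ c v.1
    have e₂ := real_linearMap_map_smul_complex (ℓ := M.toLinearMap.comp (.inr ℝ ℂ ℂ)) h₂ c v.2
    have hv : v = (v.1, 0) + (0, v.2) := by simp
    have hcv : c • v = (c • v.1, 0) + (0, c • v.2) := by simp [Prod.smul_def]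
    calc M (c • v) = M (c • v.1, 0) + M (0, c • v.2) := by rw [← map_add, ← hcv]
      _ = c • M (v.1, 0) + c • M (0, v.2) := congrArg₂ (· + ·) e₁ e₂
      _ = c • M v := by rw [← smul_add, ← map_add, ← hv]
  let N : ℂ × ℂ →L[ℂ] E := ⟨⟨⟨M, map_add M⟩, hM⟩, M.continuous⟩
  exact (hasFDerivAt_of_restrictScalars ℝ hf (f' := N) rfl).differentiableAt

theorem IsHolomorphicStem.differentiableAt_stemEval {D : Set (ℂ × ℂ)} {F : ℂ × ℂ → StemSpace}
    (hF : IsHolomorphicStem D F) (hJ : J ∈ imagUnits) {z : ℂ × ℂ} (hz : z ∈ D) :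
    DifferentiableAt ℂ (fun z => sliceEquiv hJ (stemEval J J (F z))) z := by
  let ev : StemSpace →L[ℝ] ℂ × ℂ := (sliceEquiv hJ : ℍ[ℝ] →L[ℝ] ℂ × ℂ).comp (stemEval J J)
  have map_I_of_dbar {v w : StemSpace} {e : StemSpace → StemSpace} (h : v + e w = 0)
      (he : ∀ u, stemEval J J (e u) = J * stemEval J J u) : ev w = Complex.I • ev v := by
    have hev : ev v + Complex.I • ev w = 0 := by
      have := congrArg ev h
      rwa [map_add, map_zero, show ev (e w) = Complex.I • ev w from
        (congrArg (sliceEquiv hJ) (he w)).trans (sliceEquiv_mul hJ _)] at this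
    rw [eq_neg_of_add_eq_zero_left hev, smul_neg, smul_smul, Complex.I_mul_I, neg_one_smul,
      neg_neg]
  exact differentiableAt_of_hasFDerivAt_map_I
    (ev.hasFDerivAt.comp z (hF.differentiableAt hz).hasFDerivAt)
    (map_I_of_dbar (hF.dbar₁ z hz) (stemEval_e1Left hJ J))
    (map_I_of_dbar (hF.dbar₂ z hz) (stemEval_e2Right hJ))

/-- The point of `ℍ²` with coordinates `z` in the slice of `J`. -/
def slicePt (J : ℍ[ℝ]) (z : ℂ × ℂ) : H2 := (sliceEmb J z.1, sliceEmb J z.2)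

theorem continuous_slicePt (J : ℍ[ℝ]) : Continuous (slicePt J) := by
  have := continuous_sliceEmb
  unfold slicePt
  fun_prop

theorem slicePt_injective (hJ : J ∈ imagUnits) : Function.Injective (slicePt J) :=
  (sliceEmb_injective hJ).prodMap (sliceEmb_injective hJ)

theorem slicePt_ne_zero (hJ : J ∈ imagUnits) {z : ℂ × ℂ} (hz : z ≠ 0) : slicePt J z ≠ 0 := by
  have h0 : slicePt J 0 = 0 := by simp [slicePt]
  exact h0 ▸ (slicePt_injective hJ).ne hz

theorem SliceRegularOnCircular.differentiableAt_slice {g : H2 → ℍ[ℝ]} {Ω : Set H2}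
    (hg : SliceRegularOnCircular g Ω) (hJ : J ∈ imagUnits) {z : ℂ × ℂ} (hz : slicePt J z ∈ Ω) :
    DifferentiableAt ℂ (fun z => sliceEquiv hJ (g (slicePt J z))) z := by
  obtain ⟨D, F, hF, rfl, hgF⟩ := hg
  have hzD : z ∈ D := (sliceEmb_mem_circularization hF.conjInvariant hJ hJ z).mp hz
  refine (hF.differentiableAt_stemEval hJ hzD).congr_of_eventuallyEq ?_
  filter_upwards [hF.isOpen.mem_nhds hzD] with w hw
  rw [slicePt, hgF w hw J hJ J hJ, stemEval_apply]

theorem SliceRegularAt.differentiableAt_slice {g : H2 → H2} (hJ : J ∈ imagUnits) {z : ℂ × ℂ}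
    (hg : SliceRegularAt g (slicePt J z)) :
    DifferentiableAt ℂ
      (fun z => (sliceEquiv hJ (g (slicePt J z)).1, sliceEquiv hJ (g (slicePt J z)).2)) z := by
  obtain ⟨Ω, G, hx, h₁, h₂, hgG⟩ := hg
  refine ((h₁.differentiableAt_slice hJ hx).prodMk
    (h₂.differentiableAt_slice hJ hx)).congr_of_eventuallyEq ?_
  filter_upwards [(continuous_slicePt J).continuousAt.eventually hgG] with w hw
  rw [hw]

end ComplexSlices

/-! ### The identity theorem for slice regular maps -/

section IdentityTheorem

variable {J : ℍ[ℝ]} {D : Set (ℂ × ℂ)} {F : ℂ × ℂ → StemSpace} {g : H2 → ℍ[ℝ]} {Ω : Set H2}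

theorem eq_zero_of_forall_stemEval_eq_zero {v : StemSpace} {I₁ J₁ I₂ J₂ : ℍ[ℝ]} (h₁ : I₁ ≠ J₁)
    (h₂ : I₂ ≠ J₂)
    (h : ∀ K₁ ∈ ({I₁, J₁} : Set ℍ[ℝ]), ∀ K₂ ∈ ({I₂, J₂} : Set ℍ[ℝ]), stemEval K₁ K₂ v = 0) :
    v = 0 := by
  simp only [stemEval_apply, Set.mem_insert_iff, Set.mem_singleton_iff, forall_eq_or_imp,
    forall_eq] at h
  obtain ⟨⟨hII, hIJ⟩, hJI, hJJ⟩ := h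
  have cancel {I J q : ℍ[ℝ]} (hIJ : I ≠ J) (hq : (I - J) * q = 0) : q = 0 :=
    (mul_eq_zero.mp hq).resolve_left (sub_ne_zero.mpr hIJ)
  have hI₂ : v.2.1 + I₂ * v.2.2.2 = 0 :=
    cancel h₁ (by linear_combination (norm := noncomm_ring) hII - hJI)
  have hJ₂ : v.2.1 + J₂ * v.2.2.2 = 0 :=
    cancel h₁ (by linear_combination (norm := noncomm_ring) hIJ - hJJ)
  have v₁₂ : v.2.2.2 = 0 := cancel h₂ (by linear_combination (norm := noncomm_ring) hI₂ - hJ₂)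
  have v₁ : v.2.1 = 0 := by simpa [v₁₂] using hI₂
  rw [v₁, v₁₂] at hII hIJ
  have v₂ : v.2.2.1 = 0 := cancel h₂ (by linear_combination (norm := noncomm_ring) hII - hIJ)
  have v₀ : v.1 = 0 := by simpa [v₂] using hII
  exact Prod.ext v₀ (Prod.ext v₁ (Prod.ext v₂ v₁₂))

theorem exists_mul_ne_mul_of_mem_imagUnits (hJ : J ∈ imagUnits) : ∃ u : ℍ[ℝ], u * J ≠ J * u := by
  by_contra! hcomm
  let unitJ : ℍ[ℝ] := ⟨0, 0, 1, 0⟩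
  have himK := congrArg QuaternionAlgebra.imK (hcomm unitI)
  have himJ := congrArg QuaternionAlgebra.imJ (hcomm unitI)
  have himI := congrArg QuaternionAlgebra.imK (hcomm unitJ)
  simp only [Quaternion.imJ_mul, Quaternion.imK_mul] at himI himJ himK
  simp only [unitI, unitJ] at himI himJ himK
  have hJ0 : J = 0 := by
    apply Quaternion.ext
    · exact re_eq_zero_of_mem_imagUnits hJ
    all_goals simp; linarith
  simpa [hJ0] using norm_eq_one_of_mem_imagUnits hJ

theorem conj_mem_imagUnits (hJ : J ∈ imagUnits) {q : ℍ[ℝ]} (hq : q ≠ 0) :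
    q * J * q⁻¹ ∈ imagUnits := by
  change q * J * q⁻¹ * (q * J * q⁻¹) = -1
  calc q * J * q⁻¹ * (q * J * q⁻¹) = q * J * (q⁻¹ * q) * J * q⁻¹ := by simp only [mul_assoc]
    _ = q * (J * J) * q⁻¹ := by rw [inv_mul_cancel₀ hq, mul_one, mul_assoc q]
    _ = -1 := by rw [show J * J = -1 from hJ]; simp [hq]

theorem exists_mem_imagUnits_ne_of_mem_nhds (hJ : J ∈ imagUnits) {s : Set ℍ[ℝ]} (hs : s ∈ 𝓝 J) :
    ∃ K ∈ imagUnits, K ∈ s ∧ K ≠ J := by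
  obtain ⟨u, hu⟩ := exists_mul_ne_mul_of_mem_imagUnits hJ
  let q : ℝ → ℍ[ℝ] := fun t => 1 + t • u
  have hq : Continuous q := by fun_prop
  have hq0 : q 0 = 1 := by simp [q]
  have hconj : ContinuousAt (fun t => q t * J * (q t)⁻¹) 0 :=
    (hq.continuousAt.mul continuousAt_const).mul (hq.continuousAt.inv₀ (by simp [hq0]))
  have hne : ∀ᶠ t in 𝓝 (0 : ℝ), q t ≠ 0 := hq.continuousAt.eventually_ne (by simp [hq0])
  have hmem : ∀ᶠ t in 𝓝 (0 : ℝ), q t * J * (q t)⁻¹ ∈ s :=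
    hconj.eventually_mem (by simpa [hq0] using hs)
  obtain ⟨t, ⟨hqt, hts⟩, ht0⟩ :=
    (((hne.and hmem).filter_mono nhdsWithin_le_nhds).and
      (self_mem_nhdsWithin (a := (0 : ℝ)) (s := {0}ᶜ))).exists
  refine ⟨_, conj_mem_imagUnits hJ hqt, hts, fun h => hu ?_⟩
  rw [mul_inv_eq_iff_eq_mul₀ hqt] at h
  simp only [q, add_mul, mul_add, one_mul, mul_one, add_right_inj, smul_mul_assoc,
    mul_smul_comm] at h
  exact smul_right_injective _ ht0 h

theorem IsHolomorphicStem.stemEval_star_fst (hF : IsHolomorphicStem D F) (J₁ J₂ : ℍ[ℝ])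
    {z : ℂ × ℂ} (hz : z ∈ D) :
    stemEval J₁ J₂ (F (star z.1, z.2)) = stemEval (-J₁) J₂ (F z) := by
  rw [hF.parity₁ z hz]
  simp [stemEval_apply]

theorem IsHolomorphicStem.stemEval_star_snd (hF : IsHolomorphicStem D F) (J₁ J₂ : ℍ[ℝ])
    {z : ℂ × ℂ} (hz : z ∈ D) :
    stemEval J₁ J₂ (F (z.1, star z.2)) = stemEval J₁ (-J₂) (F z) := by
  rw [hF.parity₂ z hz]
  simp [stemEval_apply]

theorem IsHolomorphicStem.eq_zero_of_stemEval (hF : IsHolomorphicStem D F) (hJ : J ∈ imagUnits)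
    {z : ℂ × ℂ} (hz : z ∈ D) (h : stemEval J J (F z) = 0)
    (h₁ : stemEval J J (F (star z.1, z.2)) = 0) (h₂ : stemEval J J (F (z.1, star z.2)) = 0)
    (h₁₂ : stemEval J J (F (star z.1, star z.2)) = 0) : F z = 0 := by
  have : IsAddTorsionFree ℍ[ℝ] := .of_module_rat ℍ[ℝ]
  have hne : J ≠ -J := self_ne_neg.mpr fun h0 => by
    simpa [h0] using norm_eq_one_of_mem_imagUnits hJ
  refine eq_zero_of_forall_stemEval_eq_zero hne hne fun K₁ hK₁ K₂ hK₂ => ?_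
  rcases hK₁ with rfl | rfl <;> rcases hK₂ with rfl | rfl
  · exact h
  · rwa [← hF.stemEval_star_snd _ _ hz]
  · rwa [← hF.stemEval_star_fst _ _ hz]
  · rwa [← hF.stemEval_star_fst _ _ hz, ← hF.stemEval_star_snd _ _ (hF.conjInvariant z hz).1]

theorem IsHolomorphicStem.stemEval_eq_zero (hF : IsHolomorphicStem D F) (hJ : J ∈ imagUnits)
    {C : Set (ℂ × ℂ)} (hC : Convex ℝ C) (ho : IsOpen C) (hCD : C ⊆ D) {u z : ℂ × ℂ} (hu : u ∈ C)
    (hz : z ∈ C) (h : ∀ᶠ w in 𝓝 u, F w = 0) : stemEval J J (F z) = 0 := by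
  let line : ℂ → ℂ × ℂ := fun t => u + t • (z - u)
  have hcont : Continuous line := by fun_prop
  have hconv : Convex ℝ (line ⁻¹' C) := (hC.translate_preimage_right u).linear_preimage
    ((LinearMap.toSpanSingleton ℂ (ℂ × ℂ) (z - u)).restrictScalars ℝ)
  have hline0 : line 0 = u := by simp [line]
  have hline1 : line 1 = z := by simp [line]
  have hdiff : DifferentiableOn ℂ (fun t => sliceEquiv hJ (stemEval J J (F (line t))))
      (line ⁻¹' C) := fun t ht =>
    ((hF.differentiableAt_stemEval hJ (hCD ht)).comp t
      (by fun_prop)).differentiableWithinAt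
  have hzero : (fun t => sliceEquiv hJ (stemEval J J (F (line t)))) =ᶠ[𝓝 0] 0 := by
    rw [← hline0] at h
    filter_upwards [hcont.continuousAt.eventually h] with t ht
    simp [ht]
  have han := hdiff.analyticOnNhd (ho.preimage hcont)
  have hone := han.eqOn_zero_of_preconnected_of_eventuallyEq_zero hconv.isPreconnected
    (Set.mem_preimage.mpr (hline0 ▸ hu)) hzero (Set.mem_preimage.mpr (hline1 ▸ hz))
  simpa [hline1] using hone

/-- `stemEval J₁ J₂ ∘ F` is holomorphic only for `J₁ = J₂`; the values on the remaining slices are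
recovered from `F ∘ c`, where `c` conjugates some of the variables. -/
theorem IsHolomorphicStem.stemEval_conj_eq_zero (hF : IsHolomorphicStem D F) (hJ : J ∈ imagUnits)
    {c : (ℂ × ℂ) ≃L[ℝ] (ℂ × ℂ)} (hcc : ∀ z, c (c z) = z) (hcD : ∀ z ∈ D, c z ∈ D)
    (hcF : ∀ z ∈ D, F z = 0 → F (c z) = 0)
    {C : Set (ℂ × ℂ)} (hC : Convex ℝ C) (ho : IsOpen C) (hCD : C ⊆ D) {u z : ℂ × ℂ} (hu : u ∈ C)
    (hz : z ∈ C) (h : ∀ᶠ w in 𝓝 u, F w = 0) : stemEval J J (F (c z)) = 0 := by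
  refine hF.stemEval_eq_zero hJ (hC.linear_preimage c.toLinearMap) (ho.preimage c.continuous)
    (fun w hw => hcc w ▸ hcD _ (hCD hw)) (u := c u) ?_ ?_ ?_
  · simpa [hcc] using hu
  · simpa [hcc] using hz
  · have hDF : ∀ᶠ w in 𝓝 (c (c u)), w ∈ D ∧ F w = 0 := by
      rw [hcc]
      exact (hF.isOpen.eventually_mem (hCD hu)).and h
    filter_upwards [c.continuous.continuousAt.eventually hDF] with w hw
    exact hcc w ▸ hcF _ hw.1 hw.2

theorem IsHolomorphicStem.eq_zero_of_eventually_eq_zero (hF : IsHolomorphicStem D F)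
    {C : Set (ℂ × ℂ)} (hC : Convex ℝ C) (ho : IsOpen C) (hCD : C ⊆ D) {u z : ℂ × ℂ} (hu : u ∈ C)
    (hz : z ∈ C) (h : ∀ᶠ w in 𝓝 u, F w = 0) : F z = 0 := by
  let c₁ : (ℂ × ℂ) ≃L[ℝ] (ℂ × ℂ) := Complex.conjCLE.prodCongr (.refl ℝ ℂ)
  let c₂ : (ℂ × ℂ) ≃L[ℝ] (ℂ × ℂ) := (ContinuousLinearEquiv.refl ℝ ℂ).prodCongr Complex.conjCLE
  have hc₁D (w) (hw : w ∈ D) : c₁ w ∈ D := (hF.conjInvariant w hw).1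
  have hc₂D (w) (hw : w ∈ D) : c₂ w ∈ D := (hF.conjInvariant w hw).2
  have hc₁F (w) (hw : w ∈ D) (hFw : F w = 0) : F (c₁ w) = 0 :=
    (hF.parity₁ w hw).trans (by simp [hFw])
  have hc₂F (w) (hw : w ∈ D) (hFw : F w = 0) : F (c₂ w) = 0 :=
    (hF.parity₂ w hw).trans (by simp [hFw])
  have hJ := unitI_mem_imagUnits
  exact hF.eq_zero_of_stemEval hJ (hCD hz) (hF.stemEval_eq_zero hJ hC ho hCD hu hz h)
    (hF.stemEval_conj_eq_zero hJ (c := c₁) (by simp [c₁]) hc₁D hc₁F hC ho hCD hu hz h)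
    (hF.stemEval_conj_eq_zero hJ (c := c₂) (by simp [c₂]) hc₂D hc₂F hC ho hCD hu hz h)
    (hF.stemEval_conj_eq_zero hJ (c := c₁.trans c₂) (by simp [c₁, c₂])
      (fun w hw => hc₂D _ (hc₁D w hw)) (fun w hw hFw => hc₂F _ (hc₁D w hw) (hc₁F w hw hFw))
      hC ho hCD hu hz h)

/-- `g` is on the circularization of `D` the slice function induced by the stem function `F`. -/
def IsInducedBy (g : H2 → ℍ[ℝ]) (F : ℂ × ℂ → StemSpace) (D : Set (ℂ × ℂ)) : Prop :=
  ∀ z ∈ D, ∀ J₁ ∈ imagUnits, ∀ J₂ ∈ imagUnits,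
    g (sliceEmb J₁ z.1, sliceEmb J₂ z.2) = stemEval J₁ J₂ (F z)

theorem SliceRegularOnCircular.exists_isInducedBy (hg : SliceRegularOnCircular g Ω) :
    ∃ D F, IsHolomorphicStem D F ∧ Ω = circularization D ∧ IsInducedBy g F D := by
  simpa only [IsInducedBy, stemEval_apply, SliceRegularOnCircular] using hg

theorem continuous_sliceCoord_prod : Continuous fun y : H2 => (sliceCoord y.1, sliceCoord y.2) :=
  continuous_sliceCoord.prodMap continuous_sliceCoord

theorem IsInducedBy.eventually_eq_zero (hg : IsInducedBy g F D) {x : H2}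
    (hF : ∀ᶠ z in 𝓝 (sliceCoord x.1, sliceCoord x.2), z ∈ D ∧ F z = 0) :
    ∀ᶠ y in 𝓝 x, g y = 0 := by
  filter_upwards [continuous_sliceCoord_prod.continuousAt.eventually hF] with y hy
  obtain ⟨J₁, h₁, e₁⟩ := exists_sliceEmb_sliceCoord y.1
  obtain ⟨J₂, h₂, e₂⟩ := exists_sliceEmb_sliceCoord y.2
  have hgy := hg _ hy.1 J₁ h₁ J₂ h₂
  rwa [← e₁, ← e₂, hy.2, map_zero] at hgy

theorem IsInducedBy.stem_eventually_eq_zero (hg : IsInducedBy g F D) (ho : IsOpen D)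
    {J₁ J₂ : ℍ[ℝ]} (h₁ : J₁ ∈ imagUnits) (h₂ : J₂ ∈ imagUnits) {u : ℂ × ℂ} (hu : u ∈ D)
    (h : ∀ᶠ y in 𝓝 ((sliceEmb J₁ u.1, sliceEmb J₂ u.2) : H2), g y = 0) :
    ∀ᶠ z in 𝓝 u, F z = 0 := by
  have hcont : Continuous fun q : (ℍ[ℝ] × ℍ[ℝ]) × (ℂ × ℂ) =>
      ((sliceEmb q.1.1 q.2.1, sliceEmb q.1.2 q.2.2) : H2) := by
    apply Continuous.prodMk <;> apply continuous_sliceEmb.comp₂ <;> fun_prop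
  have hev := (hcont.tendsto ((J₁, J₂), u)).eventually h
  rw [nhds_prod_eq, nhds_prod_eq] at hev
  obtain ⟨near, hnear, Q, hQ, hPQ⟩ := Filter.eventually_prod_iff.mp hev
  obtain ⟨P₁, hP₁, P₂, hP₂, hPP⟩ := Filter.eventually_prod_iff.mp hnear
  obtain ⟨K₁, k₁, kP₁, kne₁⟩ := exists_mem_imagUnits_ne_of_mem_nhds h₁ hP₁
  obtain ⟨K₂, k₂, kP₂, kne₂⟩ := exists_mem_imagUnits_ne_of_mem_nhds h₂ hP₂
  filter_upwards [hQ, ho.mem_nhds hu] with z hz hzD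
  refine eq_zero_of_forall_stemEval_eq_zero kne₁ kne₂ fun L₁ hL₁ L₂ hL₂ => ?_
  obtain ⟨l₁, lP₁⟩ : L₁ ∈ imagUnits ∧ P₁ L₁ := by
    rcases hL₁ with rfl | rfl
    exacts [⟨k₁, kP₁⟩, ⟨h₁, hP₁.self_of_nhds⟩]
  obtain ⟨l₂, lP₂⟩ : L₂ ∈ imagUnits ∧ P₂ L₂ := by
    rcases hL₂ with rfl | rfl
    exacts [⟨k₂, kP₂⟩, ⟨h₂, hP₂.self_of_nhds⟩]
  rw [← hg z hzD L₁ l₁ L₂ l₂]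
  exact hPQ (hPP lP₁ lP₂) hz

theorem SliceRegularOnCircular.eventually_eq_zero (hg : SliceRegularOnCircular g Ω) {x : H2}
    (hx : x ∈ Ω) (hcl : x ∈ closure {y | ∀ᶠ t in 𝓝 y, g t = 0}) : ∀ᶠ y in 𝓝 x, g y = 0 := by
  obtain ⟨D, F, hF, rfl, hgF⟩ := hg.exists_isInducedBy
  obtain ⟨ε, hε, hball⟩ := Metric.isOpen_iff.mp hF.isOpen _
    ((mem_circularization_iff hF.conjInvariant x).mp hx)
  obtain ⟨y, hyball, hy⟩ := mem_closure_iff_nhds.mp hcl _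
    (continuous_sliceCoord_prod.continuousAt.preimage_mem_nhds (Metric.ball_mem_nhds _ hε))
  obtain ⟨J₁, h₁, e₁⟩ := exists_sliceEmb_sliceCoord y.1
  obtain ⟨J₂, h₂, e₂⟩ := exists_sliceEmb_sliceCoord y.2
  have hFy : ∀ᶠ z in 𝓝 (sliceCoord y.1, sliceCoord y.2), F z = 0 :=
    hgF.stem_eventually_eq_zero hF.isOpen h₁ h₂ (hball hyball) (by rw [← e₁, ← e₂]; exact hy)
  refine hgF.eventually_eq_zero ?_
  filter_upwards [Metric.ball_mem_nhds _ hε] with z hz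
  exact ⟨hball hz, hF.eq_zero_of_eventually_eq_zero (convex_ball _ ε) Metric.isOpen_ball hball
    hyball hz hFy⟩

theorem SliceRegularOnCircular.eventually_eq_zero_of_slice (hg : SliceRegularOnCircular g Ω)
    (hJ : J ∈ imagUnits) {a b : ℝ} (hx : slicePt J (a, b) ∈ Ω)
    (h0 : ∀ᶠ z in 𝓝 ((a, b) : ℂ × ℂ), g (slicePt J z) = 0) :
    ∀ᶠ y in 𝓝 (slicePt J (a, b)), g y = 0 := by
  obtain ⟨D, F, hF, rfl, hgF⟩ := hg.exists_isInducedBy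
  have hzD : ((a, b) : ℂ × ℂ) ∈ D := (sliceEmb_mem_circularization hF.conjInvariant hJ hJ _).mp hx
  have hcoord (t : ℝ) : sliceCoord (sliceEmb J t) = t :=
    (sliceCoord_sliceEmb_eq_or hJ t).elim id fun h => h.trans (Complex.conj_ofReal t)
  have heval : ∀ᶠ z in 𝓝 ((a, b) : ℂ × ℂ), z ∈ D ∧ stemEval J J (F z) = 0 := by
    filter_upwards [h0, hF.isOpen.mem_nhds hzD] with z hz hzD
    exact ⟨hzD, (hgF z hzD J hJ J hJ).symm.trans hz⟩
  have heval_comp {c : ℂ × ℂ → ℂ × ℂ} (hc : Continuous c) (hcz : c (a, b) = ((a, b) : ℂ × ℂ)) :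
      ∀ᶠ z in 𝓝 ((a, b) : ℂ × ℂ), c z ∈ D ∧ stemEval J J (F (c z)) = 0 :=
    hc.continuousAt.eventually (by rwa [hcz])
  refine hgF.eventually_eq_zero ?_
  simp only [slicePt, hcoord]
  filter_upwards [heval,
    heval_comp (c := fun z => (star z.1, z.2)) (by fun_prop) (by simp),
    heval_comp (c := fun z => (z.1, star z.2)) (by fun_prop) (by simp),
    heval_comp (c := fun z => (star z.1, star z.2)) (by fun_prop) (by simp)] with z h h₁ h₂ h₁₂
  exact ⟨h.1, hF.eq_zero_of_stemEval hJ h.1 h.2 h₁.2 h₂.2 h₁₂.2⟩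

variable {f f' : H2 → H2} {x : H2}

theorem SliceRegularAt.eventuallyEq_of_mem_closure (hf : SliceRegularAt f x)
    (hf' : SliceRegularAt f' x) (hcl : x ∈ closure {y | f =ᶠ[𝓝 y] f'}) : f =ᶠ[𝓝 x] f' := by
  obtain ⟨Ω, G, hx, hG₁, hG₂, hG⟩ := hf.sub hf'
  have hclG : x ∈ closure {y | ∀ᶠ t in 𝓝 y, G t = 0} := by
    refine mem_closure_iff_nhds.mpr fun V hV => ?_
    obtain ⟨y, ⟨hyV, hyG⟩, hy⟩ := mem_closure_iff_nhds.mp hcl _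
      (Filter.inter_mem hV hG.eventually_nhds)
    refine ⟨y, hyV, ?_⟩
    filter_upwards [hy, hyG] with t ht htG
    rw [← htG, Pi.sub_apply, ht, sub_self]
  have h₁ := hG₁.eventually_eq_zero hx (closure_mono (fun y (hy : ∀ᶠ t in 𝓝 y, G t = 0) =>
    hy.mono fun t ht => congrArg Prod.fst ht) hclG)
  have h₂ := hG₂.eventually_eq_zero hx (closure_mono (fun y (hy : ∀ᶠ t in 𝓝 y, G t = 0) =>
    hy.mono fun t ht => congrArg Prod.snd ht) hclG)
  filter_upwards [h₁, h₂, hG] with y hy₁ hy₂ hyG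
  exact sub_eq_zero.mp (hyG.trans (Prod.ext hy₁ hy₂))

theorem SliceRegularAt.eventuallyEq_of_slice (hJ : J ∈ imagUnits) {a b : ℝ}
    (hf : SliceRegularAt f (slicePt J (a, b))) (hf' : SliceRegularAt f' (slicePt J (a, b)))
    (h : ∀ᶠ z in 𝓝 ((a, b) : ℂ × ℂ), f (slicePt J z) = f' (slicePt J z)) :
    f =ᶠ[𝓝 (slicePt J (a, b))] f' := by
  obtain ⟨Ω, G, hx, hG₁, hG₂, hG⟩ := hf.sub hf'
  have hG0 : ∀ᶠ z in 𝓝 ((a, b) : ℂ × ℂ), G (slicePt J z) = 0 := by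
    filter_upwards [h, (continuous_slicePt J).continuousAt.eventually hG] with z hz hzG
    rw [← hzG, Pi.sub_apply, hz, sub_self]
  have h₁ := hG₁.eventually_eq_zero_of_slice hJ hx (hG0.mono fun z hz => congrArg Prod.fst hz)
  have h₂ := hG₂.eventually_eq_zero_of_slice hJ hx (hG0.mono fun z hz => congrArg Prod.snd hz)
  filter_upwards [h₁, h₂, hG] with y hy₁ hy₂ hyG
  exact sub_eq_zero.mp (hyG.trans (Prod.ext hy₁ hy₂))

theorem eventuallyEq_of_forall_sliceRegularAt (hf : ∀ x ≠ 0, SliceRegularAt f x)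
    (hf' : ∀ x ≠ 0, SliceRegularAt f' x) {x₀ : H2} (hx₀ : x₀ ≠ 0) (h₀ : f =ᶠ[𝓝 x₀] f')
    (hx : x ≠ 0) : f =ᶠ[𝓝 x] f' := by
  let Z : Set PuncturedH2 := {y | f =ᶠ[𝓝 (y : H2)] f'}
  have hopen : IsOpen Z := isOpen_iff_mem_nhds.mpr fun y hy =>
    continuous_subtype_val.continuousAt.eventually (Filter.Eventually.eventually_nhds hy)
  have hclosed : IsClosed Z := by
    refine isClosed_of_closure_subset fun y hy => ?_
    refine (hf y y.2).eventuallyEq_of_mem_closure (hf' y y.2) ?_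
    exact closure_mono (Set.image_subset_iff.mpr fun _ hz => hz)
      (image_closure_subset_closure_image continuous_subtype_val ⟨y, hy, rfl⟩)
  have hZ : Z = Set.univ := IsClopen.eq_univ ⟨hclosed, hopen⟩ ⟨⟨x₀, hx₀⟩, h₀⟩
  exact hZ.ge (Set.mem_univ (⟨x, hx⟩ : PuncturedH2))

end IdentityTheorem

/-! ### Laurent coefficients on the punctured plane -/

section Laurent

open Complex Metric

variable {V : Type*} [NormedAddCommGroup V] [NormedSpace ℂ V]

/-- The `d`-th Laurent coefficient at `0`, as an average over the unit circle. It also makes sense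
for functions that are merely continuous on that circle. -/
def laurentCoeff (k : ℂ → V) (d : ℤ) : V := Real.circleAverage (fun t => t ^ (-d) • k t) 0 1

theorem circleAverage_eq_of_differentiableAt [CompleteSpace V] {f : ℂ → V}
    (hf : ∀ z ≠ 0, DifferentiableAt ℂ f z) {r R : ℝ} (hr : 0 < r) (hR : 0 < R) :
    Real.circleAverage f 0 R = Real.circleAverage f 0 r := by
  wlog hle : r ≤ R generalizing r R
  · exact (this hR hr (le_of_not_ge hle)).symm
  have hne {z : ℂ} (hz : z ∉ ball 0 r) : z ≠ 0 := by
    rintro rfl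
    exact hz (mem_ball_self hr)
  rw [Real.circleAverage_eq_circleIntegral hR.ne', Real.circleAverage_eq_circleIntegral hr.ne',
    circleIntegral_sub_center_inv_smul_eq_of_differentiable_on_annulus_off_countable hr hle
      Set.countable_empty (fun z hz => (hf z (hne hz.2)).continuousAt.continuousWithinAt)
      fun z hz => hf z (hne fun h => hz.1.2 (ball_subset_closedBall h))]

theorem circleAverage_comp_mul_right (f : ℂ → V) (τ : ℂ) :
    Real.circleAverage (fun t => f (t * τ)) 0 1 = Real.circleAverage f 0 ‖τ‖ := by
  have hrot (θ : ℝ) : circleMap 0 1 θ * τ = circleMap 0 ‖τ‖ (θ + arg τ) := by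
    conv_lhs => rw [← norm_mul_exp_arg_mul_I τ]
    simp only [circleMap_zero, ofReal_add, add_mul, Complex.exp_add, ofReal_one]
    ring
  simp only [Real.circleAverage_eq_integral_add (arg τ) (R := ‖τ‖), ← hrot, Real.circleAverage_def]

theorem laurentCoeff_comp_mul_right [CompleteSpace V] {k : ℂ → V}
    (hk : ∀ z ≠ 0, DifferentiableAt ℂ k z) (d : ℤ) {τ : ℂ} (hτ : τ ≠ 0) :
    laurentCoeff (fun t => k (t * τ)) d = τ ^ d • laurentCoeff k d := by
  have hf (z : ℂ) (hz : z ≠ 0) : DifferentiableAt ℂ (fun z => z ^ (-d) • k z) z :=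
    (differentiableAt_zpow.mpr (.inl hz)).smul (hk z hz)
  have hscale (t : ℂ) : t ^ (-d) • k (t * τ) = τ ^ d • (t * τ) ^ (-d) • k (t * τ) := by
    rw [mul_zpow, smul_smul, mul_left_comm, ← zpow_add₀ hτ, add_neg_cancel, zpow_zero, mul_one]
  simp only [laurentCoeff, hscale]
  rw [Real.circleAverage_fun_smul, circleAverage_comp_mul_right fun z => z ^ (-d) • k z,
    circleAverage_eq_of_differentiableAt hf one_pos (norm_pos_iff.mpr hτ)]

theorem two_zpow_ne_one {d : ℤ} (hd : d ≠ 0) : (2 : ℂ) ^ d ≠ 1 := fun h => by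
  have hnorm := congrArg norm h
  rw [norm_zpow, Complex.norm_ofNat, norm_one] at hnorm
  exact hd ((zpow_eq_one_iff_right₀ zero_le_two (by norm_num)).mp hnorm)

theorem laurentCoeff_const [CompleteSpace V] (b : V) {d : ℤ} (hd : d ≠ 0) :
    laurentCoeff (fun _ => b) d = 0 := by
  have htwo : (2 : ℂ) ^ d • laurentCoeff (fun _ => b) d = laurentCoeff (fun _ => b) d :=
    (laurentCoeff_comp_mul_right (fun _ _ => differentiableAt_const b) d two_ne_zero).symm
  refine (smul_eq_zero.mp ?_).resolve_left (sub_ne_zero.mpr (two_zpow_ne_one hd))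
  rw [sub_smul, one_smul, htwo, sub_self]

theorem circleIntegrable_zpow_smul {k : ℂ → V} (hk : ContinuousOn k (sphere 0 1)) (n : ℤ) :
    CircleIntegrable (fun t => t ^ n • k t) 0 1 :=
  ((continuousOn_zpow₀ n).mono (fun _ ht => ne_of_mem_sphere ht one_ne_zero)
    |>.smul hk).circleIntegrable zero_le_one

theorem laurentCoeff_clm [CompleteSpace V] {W : Type*} [NormedAddCommGroup W] [NormedSpace ℂ W]
    [CompleteSpace W] {k : ℂ → V} (hk : ContinuousOn k (sphere 0 1)) (L : V →L[ℂ] W) (d : ℤ) :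
    laurentCoeff (fun t => L (k t)) d = L (laurentCoeff k d) := by
  have := (L.restrictScalars ℝ).circleAverage_comp_comm (circleIntegrable_zpow_smul hk (-d))
  simpa [laurentCoeff, Function.comp_def] using this

theorem laurentCoeff_add_const [CompleteSpace V] {k : ℂ → V} (hk : ContinuousOn k (sphere 0 1))
    (b : V) {d : ℤ} (hd : d ≠ 0) : laurentCoeff (fun t => k t + b) d = laurentCoeff k d := by
  have hb := laurentCoeff_const b hd
  simp only [laurentCoeff, smul_add] at hb ⊢
  rw [Real.circleAverage_fun_add (circleIntegrable_zpow_smul hk _)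
    (circleIntegrable_zpow_smul continuousOn_const _), hb, add_zero]

theorem continuous_circleMap_zpow_smul {X : Type*} [TopologicalSpace X] {F : X → ℂ → V}
    (hF : Continuous fun q : X × ℝ => F q.1 (circleMap 0 1 q.2)) (n : ℤ) :
    Continuous fun q : X × ℝ => (circleMap 0 1 q.2) ^ n • F q.1 (circleMap 0 1 q.2) :=
  (((continuous_circleMap 0 1).comp continuous_snd).zpow₀ n fun _ =>
    .inl (circleMap_ne_center one_ne_zero)).smul hF

theorem continuous_laurentCoeff {X : Type*} [TopologicalSpace X] [FirstCountableTopology X]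
    [LocallyCompactSpace X] {F : X → ℂ → V}
    (hF : Continuous fun q : X × ℝ => F q.1 (circleMap 0 1 q.2)) (d : ℤ) :
    Continuous fun x => laurentCoeff (F x) d :=
  (intervalIntegral.continuous_parametric_intervalIntegral_of_continuous'
    (continuous_circleMap_zpow_smul hF (-d)) _ _).const_smul _

theorem differentiable_intervalIntegral_of_continuous [CompleteSpace V] {G : ℂ → ℝ → V}
    (hG : Continuous G.uncurry) (hd : ∀ θ, Differentiable ℂ fun s => G s θ) (a b : ℝ) :
    Differentiable ℂ fun s => ∫ θ in a..b, G s θ := by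
  intro s₀
  obtain ⟨C, hC⟩ := ((isCompact_closedBall s₀ 2).prod (isCompact_uIcc (a := a) (b := b))
    ).exists_bound_of_continuousOn hG.continuousOn
  have hderiv (θ : ℝ) (hθ : θ ∈ Set.uIoc a b) (s : ℂ) (hs : s ∈ ball s₀ 1) :
      ‖deriv (fun s => G s θ) s‖ ≤ C := by
    simpa using norm_deriv_le_of_forall_mem_sphere_norm_le one_pos
      ((hd θ).diffContOnCl (s := ball s 1)) fun z (hz : dist z s = 1) => by
        refine hC (z, θ) ⟨mem_closedBall.mpr ?_, Set.uIoc_subset_uIcc hθ⟩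
        linarith [dist_triangle z s s₀, mem_ball.mp hs]
  have hmeas : MeasureTheory.AEStronglyMeasurable (fun θ => deriv (fun s => G s θ) s₀)
      (MeasureTheory.volume.restrict (Set.uIoc a b)) :=
    ((stronglyMeasurable_deriv_with_param (𝕜 := ℂ) (f := fun θ s => G s θ)
      (hG.comp continuous_swap)).comp_measurable
        (measurable_id.prodMk measurable_const)).aestronglyMeasurable
  exact (intervalIntegral.hasDerivAt_integral_of_dominated_loc_of_deriv_le
    (ball_mem_nhds s₀ one_pos)
    (.of_forall fun s => (hG.comp (Continuous.prodMk_right s)).aestronglyMeasurable)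
    ((hG.comp (Continuous.prodMk_right s₀)).intervalIntegrable _ _) hmeas (.of_forall hderiv)
    intervalIntegrable_const (.of_forall fun θ _ s _ => (hd θ s).hasDerivAt)).2.differentiableAt

theorem differentiable_laurentCoeff [CompleteSpace V] {F : ℂ → ℂ → V}
    (hF : Continuous fun q : ℂ × ℝ => F q.1 (circleMap 0 1 q.2))
    (hd : ∀ θ : ℝ, Differentiable ℂ fun s => F s (circleMap 0 1 θ)) (d : ℤ) :
    Differentiable ℂ fun s => laurentCoeff (F s) d :=
  (differentiable_intervalIntegral_of_continuous
    (G := fun s θ => (circleMap 0 1 θ) ^ (-d) • F s (circleMap 0 1 θ))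
    (continuous_circleMap_zpow_smul hF (-d)) (fun θ => (hd θ).const_smul _) _ _).const_smul _

theorem coe_toCircle_coe (θ : ℝ) :
    (AddCircle.toCircle (θ : AddCircle (2 * Real.pi)) : ℂ) = circleMap 0 1 θ := by
  simp [AddCircle.toCircle_apply_mk, circleMap]

theorem fourierCoeff_comp_toCircle [Fact (0 < 2 * Real.pi)] (k : ℂ → V) (d : ℤ) :
    fourierCoeff (fun x : AddCircle (2 * Real.pi) => k (AddCircle.toCircle x)) d =
      laurentCoeff k d := by
  rw [fourierCoeff_eq_intervalIntegral _ d 0, zero_add, one_div, laurentCoeff, Real.circleAverage]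
  simp only [fourier_apply, AddCircle.toCircle_zsmul, Circle.coe_zpow, coe_toCircle_coe]

theorem apply_one_eq_sum_laurentCoeff_complex {k : ℂ → ℂ} (hk : ContinuousOn k (sphere 0 1))
    (S : Finset ℤ) (hS : ∀ d ∉ S, laurentCoeff k d = 0) : k 1 = ∑ d ∈ S, laurentCoeff k d := by
  have : Fact (0 < 2 * Real.pi) := ⟨Real.two_pi_pos⟩
  let f : C(AddCircle (2 * Real.pi), ℂ) := ⟨fun x => k (AddCircle.toCircle x),
    hk.comp_continuous (by fun_prop) fun _ => mem_sphere_zero_iff_norm.mpr (Circle.norm_coe _)⟩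
  have hcoeff (d : ℤ) : fourierCoeff f d = laurentCoeff k d := fourierCoeff_comp_toCircle k d
  have hseries := has_pointwise_sum_fourier_series_of_summable (f := f)
    (summable_of_ne_finset_zero fun d hd => (hcoeff d).trans (hS d hd)) 0
  have hfinite : HasSum (fun d => laurentCoeff k d) (∑ d ∈ S, laurentCoeff k d) :=
    hasSum_sum_of_ne_finset_zero hS
  simp only [hcoeff, fourier_eval_zero, smul_eq_mul, mul_one] at hseries
  simpa [f] using hseries.unique hfinite

theorem apply_one_eq_sum_laurentCoeff [CompleteSpace V] {k : ℂ → V}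
    (hk : ContinuousOn k (sphere 0 1)) (S : Finset ℤ) (hS : ∀ d ∉ S, laurentCoeff k d = 0) :
    k 1 = ∑ d ∈ S, laurentCoeff k d := by
  refine (SeparatingDual.eq_iff_forall_dual_eq (R := ℂ)).mpr fun g => ?_
  simp only [map_sum, ← laurentCoeff_clm hk g]
  exact apply_one_eq_sum_laurentCoeff_complex (g.continuous.comp_continuousOn hk) S fun d hd =>
    (laurentCoeff_clm hk g d).trans (by rw [hS d hd, map_zero])

end Laurent

/-! ### Polynomial entire functions equivariant under a translation -/

section Entire

variable {V : Type*} [NormedAddCommGroup V] [NormedSpace ℂ V]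

theorem iteratedDeriv_eq_zero_of_growth [CompleteSpace V] {q : ℂ → V} (hq : Differentiable ℂ q)
    {C : ℝ} {m : ℕ} (hC : ∀ s : ℂ, 1 ≤ ‖s‖ → ‖q s‖ ≤ C * ‖s‖ ^ m) :
    iteratedDeriv (m + 1) q = 0 := by
  have hC0 : 0 ≤ C := by simpa using (norm_nonneg _).trans (hC 1 (by simp))
  funext c
  set K : ℝ := (m + 1).factorial * C * 2 ^ m with hK
  have hcauchy (R : ℝ) (hR : ‖c‖ + 1 ≤ R) : ‖iteratedDeriv (m + 1) q c‖ ≤ K / R := by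
    have hR0 : 0 < R := by linarith [norm_nonneg c]
    have hsphere (z : ℂ) (hz : z ∈ Metric.sphere c R) : ‖q z‖ ≤ C * (2 * R) ^ m := by
      rw [mem_sphere_iff_norm] at hz
      have hlarge : 1 ≤ ‖z‖ := by linarith [norm_sub_le z c]
      have hsmall : ‖z‖ ≤ 2 * R := by linarith [norm_sub_norm_le z c]
      exact (hC z hlarge).trans (by gcongr)
    refine (Complex.norm_iteratedDeriv_le_of_forall_mem_sphere_norm_le (m + 1) hR0
      hq.diffContOnCl hsphere).trans_eq ?_
    rw [hK]
    field_simp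
    ring
  have hlim : Filter.Tendsto (fun R : ℝ => K / R) Filter.atTop (𝓝 0) :=
    Filter.tendsto_id.const_div_atTop K
  exact norm_le_zero_iff.mp
    (ge_of_tendsto hlim ((Filter.eventually_ge_atTop (‖c‖ + 1)).mono hcauchy))

theorem differentiable_iteratedDeriv_complex [CompleteSpace V] {q : ℂ → V}
    (hq : Differentiable ℂ q) (n : ℕ) : Differentiable ℂ (iteratedDeriv n q) :=
  (hq.contDiff (n := ⊤)).differentiable_iteratedDeriv n (WithTop.coe_lt_top _)

theorem iteratedDeriv_equivariant [CompleteSpace V] {q : ℂ → V} (hq : Differentiable ℂ q) {μ : ℂ}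
    {B : V →L[ℂ] V} (h : ∀ s, q (s + μ) = B (q s)) (n : ℕ) (s : ℂ) :
    iteratedDeriv n q (s + μ) = B (iteratedDeriv n q s) := by
  induction n generalizing s with
  | zero => simpa using h s
  | succ n ih =>
    have hderiv := congrArg (deriv · s) (funext ih)
    rw [deriv_comp_add_const, ← iteratedDeriv_succ] at hderiv
    rw [hderiv, iteratedDeriv_succ]
    exact (B.hasFDerivAt.comp_hasDerivAt s
      (differentiable_iteratedDeriv_complex hq n s).hasDerivAt).deriv

theorem exists_iteratedDeriv_eq_const [CompleteSpace V] {q : ℂ → V} (hq : Differentiable ℂ q)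
    (hq0 : q ≠ 0) {m : ℕ} (hm : iteratedDeriv m q = 0) :
    ∃ (n : ℕ) (e : V), e ≠ 0 ∧ ∀ s, iteratedDeriv n q s = e := by
  induction m with
  | zero => exact absurd (by simpa using hm) hq0
  | succ m ih =>
    by_cases h : iteratedDeriv m q = 0
    · exact ih h
    · have hconst (s : ℂ) : iteratedDeriv m q s = iteratedDeriv m q 0 :=
        is_const_of_deriv_eq_zero (differentiable_iteratedDeriv_complex hq m)
          (fun t => by rw [← iteratedDeriv_succ, hm, Pi.zero_apply]) s 0
      exact ⟨m, iteratedDeriv m q 0, fun h0 => h (funext fun s => (hconst s).trans h0), hconst⟩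

theorem eq_of_deriv_eq_const {g : ℂ → V} (hg : Differentiable ℂ g) {e : V}
    (h : ∀ s, deriv g s = e) (s : ℂ) : g s = g 0 + s • e := by
  have hderiv (t : ℂ) : HasDerivAt (fun s => g s - s • e) 0 t := by
    have := (hg t).hasDerivAt.sub ((hasDerivAt_id t).smul_const e)
    rwa [h, one_smul, sub_self] at this
  have hconst := is_const_of_deriv_eq_zero (fun t => (hderiv t).differentiableAt)
    (fun t => (hderiv t).deriv) s 0
  simp only [zero_smul, sub_zero] at hconst
  rw [← hconst, sub_add_cancel]

theorem eq_of_deriv_eq_affine {g : ℂ → V} (hg : Differentiable ℂ g) {a e : V}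
    (h : ∀ s, deriv g s = a + s • e) (s : ℂ) : g s = g 0 + s • a + (s ^ 2 / 2) • e := by
  have hsq (t : ℂ) : HasDerivAt (fun s : ℂ => s ^ 2 / 2) t t := by
    simpa using ((hasDerivAt_id t).pow 2).div_const 2
  have hderiv (t : ℂ) : HasDerivAt (fun s => g s - (s ^ 2 / 2) • e) a t := by
    have := (hg t).hasDerivAt.sub ((hsq t).smul_const e)
    rwa [h, add_sub_cancel_right] at this
  have haffine := eq_of_deriv_eq_const (fun t => (hderiv t).differentiableAt)
    (fun t => (hderiv t).deriv) s
  simp only [ne_eq, OfNat.ofNat_ne_zero, not_false_eq_true, zero_pow, zero_div, zero_smul,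
    sub_zero] at haffine
  rw [← haffine, sub_add_cancel]

/-- As soon as `B` has a nontrivial Jordan block for the eigenvalue `1`, it is unipotent of order
two. Left linear endomorphisms of `ℍ²` have this property, because `ℍ²` has no room for a second
Jordan block over `ℍ`. -/
def UnipotentOfJordanBlock (B : V →L[ℂ] V) : Prop :=
  ∀ v w, w ≠ 0 → B w = w → B v = v + w → (B - 1) ^ 2 = 0

theorem sq_sub_one_apply (B : V →L[ℂ] V) (x : V) :
    ((B - 1) ^ 2 : V →L[ℂ] V) x = B (B x) - (2 : ℂ) • B x + x := by
  simp only [sq, mul_apply_eq_comp, sub_apply, one_apply_eq_self, map_sub]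
  module

theorem eq_affine_of_equivariant [CompleteSpace V] {q : ℂ → V} (hq : Differentiable ℂ q)
    {m : ℕ} (hm : iteratedDeriv m q = 0) {μ : ℂ} (hμ : μ ≠ 0) {B : V →L[ℂ] V}
    (hB : UnipotentOfJordanBlock B) (h : ∀ s, q (s + μ) = B (q s)) :
    ∃ a c : V, (∀ s, q s = a + s • c) ∧ (c ≠ 0 → (B - 1) ^ 2 = 0) := by
  by_cases hq0 : q = 0
  · exact ⟨0, 0, fun s => by simp [hq0], fun h => absurd rfl h⟩
  obtain ⟨n, e, he, hn⟩ := exists_iteratedDeriv_eq_const hq hq0 hm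
  obtain _ | n := n
  · exact ⟨e, 0, fun s => by simpa using hn s, fun h => absurd rfl h⟩
  have hlin := eq_of_deriv_eq_const (differentiable_iteratedDeriv_complex hq n) (e := e)
    fun s => by rw [← iteratedDeriv_succ, hn]
  have hBe : B e = e := by simpa only [hn] using (iteratedDeriv_equivariant hq h (n + 1) 0).symm
  have hjordan : B (iteratedDeriv n q 0) = iteratedDeriv n q 0 + μ • e := by
    rw [← iteratedDeriv_equivariant hq h n 0, hlin, zero_add]
  have hunip := hB _ (μ • e) (smul_ne_zero hμ he) (by rw [map_smul, hBe]) hjordan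
  obtain _ | n := n
  · exact ⟨q 0, e, by simpa using hlin, fun _ => hunip⟩
  -- In degree at least two, the second difference of a derivative of `q` contradicts unipotency.
  have hquad := eq_of_deriv_eq_affine (differentiable_iteratedDeriv_complex hq n)
    (a := iteratedDeriv (n + 1) q 0) (e := e) fun s => by rw [← iteratedDeriv_succ, hlin]
  have hdiff : ((B - 1) ^ 2 : V →L[ℂ] V) (iteratedDeriv n q 0) = μ ^ 2 • e := by
    rw [sq_sub_one_apply, ← iteratedDeriv_equivariant hq h, ← iteratedDeriv_equivariant hq h,
      hquad (0 + μ + μ), hquad (0 + μ)]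
    module
  rw [hunip, zero_apply] at hdiff
  exact absurd hdiff.symm (smul_ne_zero (pow_ne_zero 2 hμ) he)

theorem eq_zero_of_equivariant_of_sq_sub_one_eq_zero [CompleteSpace V] {q : ℂ → V}
    (hq : Differentiable ℂ q) {m : ℕ} (hm : iteratedDeriv m q = 0) {μ κ : ℂ} (hκ : κ ≠ 1)
    {B : V →L[ℂ] V} (hB : (B - 1) ^ 2 = 0) (h : ∀ s, q (s + μ) = (κ • B) (q s)) : q = 0 := by
  by_contra hq0
  obtain ⟨n, e, he, hn⟩ := exists_iteratedDeriv_eq_const hq hq0 hm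
  have heigen : κ • B e = e := by
    simpa only [hn, smul_apply] using (iteratedDeriv_equivariant hq h n 0).symm
  have hsq : κ ^ 2 • ((B - 1) ^ 2 : V →L[ℂ] V) e = (κ - 1) ^ 2 • e := by
    calc κ ^ 2 • ((B - 1) ^ 2 : V →L[ℂ] V) e
      _ = κ • B (κ • B e) - (2 * κ) • (κ • B e) + κ ^ 2 • e := by
        rw [sq_sub_one_apply, map_smul]
        module
      _ = (κ - 1) ^ 2 • e := by
        rw [heigen, heigen]
        module
  rw [hB, zero_apply, smul_zero] at hsq
  exact smul_ne_zero (pow_ne_zero 2 (sub_ne_zero.mpr hκ)) he hsq.symm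

theorem apply_zero_eq_zero_of_eq_zpow_smul_add {φ : ℂ → V} (hφ : Continuous φ) {m n : ℤ}
    (hm : m ≠ 0) (hn : n ≠ 0) {a c : V} (h : ∀ v ≠ 0, φ v = v ^ m • a + v ^ n • c) : φ 0 = 0 := by
  have hrec : (fun v => φ (2 * (2 * v)) + ((2 : ℂ) ^ m * 2 ^ n) • φ v) =
      fun v => ((2 : ℂ) ^ m + 2 ^ n) • φ (2 * v) := by
    refine Continuous.ext_on (dense_compl_singleton (0 : ℂ)) (by fun_prop) (by fun_prop)
      fun v (hv : v ≠ 0) => ?_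
    have h2v : 2 * v ≠ 0 := mul_ne_zero two_ne_zero hv
    simp only [h _ (mul_ne_zero two_ne_zero h2v), h _ h2v, h v hv, mul_zpow]
    module
  have hzero := congrFun hrec 0
  simp only [mul_zero] at hzero
  have hfactor : (((2 : ℂ) ^ m - 1) * (2 ^ n - 1)) • φ 0 = 0 := by
    rw [← sub_eq_zero.mpr hzero]
    module
  exact (smul_eq_zero.mp hfactor).resolve_left
    (mul_ne_zero (sub_ne_zero.mpr (two_zpow_ne_one hm)) (sub_ne_zero.mpr (two_zpow_ne_one hn)))

theorem weight_eq_of_continuous {φ : ℂ → V} (hφ : Continuous φ) (h0 : φ 0 ≠ 0) {p : ℕ}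
    {d : ℤ} (hd : d ≠ 0) {a c : V}
    (h : ∀ v ≠ 0, φ v = v ^ d • a + v ^ (d - p) • c) : d = p ∧ c ≠ 0 := by
  have hdp : d = p := by
    by_contra hne
    exact h0 (apply_zero_eq_zero_of_eq_zpow_smul_add hφ hd (sub_ne_zero.mpr hne) h)
  subst hdp
  refine ⟨rfl, ?_⟩
  rintro rfl
  exact h0 (apply_zero_eq_zero_of_eq_zpow_smul_add (c := 0) hφ hd hd (by simpa using h))

end Entire

/-! ### Weighted homogeneous components on `ℂ² ∖ {0}` -/

section Weighted

open Metric

/-- The action of weights `(p, 1)` of `ℂˣ` on `ℂ²`. -/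
def weightedScale (p : ℕ) (t : ℂ) (x : ℂ × ℂ) : ℂ × ℂ := (t ^ p * x.1, t * x.2)

/-- The restriction to `ℂ²` of the Hopf contraction `(z, w) ↦ (z r ^ p + w ^ p ℓ, w r)`. -/
def jordanMap (p : ℕ) (ρ ℓ : ℂ) (x : ℂ × ℂ) : ℂ × ℂ := (ρ ^ p * x.1 + x.2 ^ p * ℓ, ρ * x.2)

variable {p : ℕ}

theorem weightedScale_one (x : ℂ × ℂ) : weightedScale p 1 x = x := by
  simp [weightedScale]

theorem weightedScale_weightedScale (s t : ℂ) (x : ℂ × ℂ) :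
    weightedScale p s (weightedScale p t x) = weightedScale p (s * t) x := by
  simp only [weightedScale, mul_pow, mul_assoc]

theorem weightedScale_ne_zero {t : ℂ} (ht : t ≠ 0) {x : ℂ × ℂ} (hx : x ≠ 0) :
    weightedScale p t x ≠ 0 := by
  simp only [weightedScale, ne_eq, Prod.mk_eq_zero, mul_eq_zero, pow_eq_zero_iff', ht, false_and,
    false_or]
  exact fun h => hx (Prod.ext h.1 h.2)

theorem weightedScale_jordanMap (t ρ ℓ : ℂ) (x : ℂ × ℂ) :
    weightedScale p t (jordanMap p ρ ℓ x) = jordanMap p ρ ℓ (weightedScale p t x) := by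
  simp only [weightedScale, jordanMap, Prod.mk.injEq]
  constructor <;> ring

theorem mk_eq_weightedScale (u : ℂ) {v : ℂ} (hv : v ≠ 0) :
    (u, v) = weightedScale p v (u / v ^ p, 1) := by
  rw [weightedScale, mul_div_cancel₀ _ (pow_ne_zero p hv), mul_one]

theorem jordanMap_mk_one (s ℓ : ℂ) {ρ : ℂ} (hρ : ρ ≠ 0) :
    jordanMap p ρ ℓ (s, 1) = weightedScale p ρ (s + ℓ / ρ ^ p, 1) := by
  rw [jordanMap, weightedScale, mul_add, mul_div_cancel₀ _ (pow_ne_zero p hρ), one_pow, one_mul]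

theorem exists_ne_zero_pow_eq (hp : p ≠ 0) {s : ℂ} (hs : s ≠ 0) : ∃ t ≠ 0, t ^ p = s := by
  obtain ⟨t, rfl⟩ := IsAlgClosed.exists_pow_nat_eq s (Nat.pos_of_ne_zero hp)
  exact ⟨t, ne_zero_pow hp hs, rfl⟩

variable {V : Type*} [NormedAddCommGroup V] [NormedSpace ℂ V] {h : ℂ × ℂ → V}

/-- The component of weight `d` of `h` for the action `weightedScale p` of `ℂˣ`. -/
def weightComp (p : ℕ) (h : ℂ × ℂ → V) (d : ℤ) (x : ℂ × ℂ) : V :=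
  laurentCoeff (fun t => h (weightedScale p t x)) d

theorem differentiableAt_comp_weightedScale (hh : ∀ x ≠ 0, DifferentiableAt ℂ h x) {x : ℂ × ℂ}
    (hx : x ≠ 0) {t : ℂ} (ht : t ≠ 0) :
    DifferentiableAt ℂ (fun t => h (weightedScale p t x)) t :=
  (hh _ (weightedScale_ne_zero ht hx)).comp t (by unfold weightedScale; fun_prop)

theorem continuousOn_comp_weightedScale (hh : ∀ x ≠ 0, DifferentiableAt ℂ h x) {x : ℂ × ℂ}
    (hx : x ≠ 0) : ContinuousOn (fun t => h (weightedScale p t x)) (sphere 0 1) := fun _ ht =>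
  (differentiableAt_comp_weightedScale hh hx
    (ne_of_mem_sphere ht one_ne_zero)).continuousAt.continuousWithinAt

theorem continuous_comp_weightedScale_circleMap (hh : ∀ x ≠ 0, DifferentiableAt ℂ h x)
    {X : Type*} [TopologicalSpace X] {x : X → ℂ × ℂ} (hx : Continuous x) (hx0 : ∀ y, x y ≠ 0) :
    Continuous fun q : X × ℝ => h (weightedScale p (circleMap 0 1 q.2) (x q.1)) := by
  have hscale : Continuous fun q : X × ℝ => weightedScale p (circleMap 0 1 q.2) (x q.1) := by
    have := continuous_circleMap 0 1
    unfold weightedScale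
    fun_prop
  exact continuous_iff_continuousAt.mpr fun q => ContinuousAt.comp (hh _ (weightedScale_ne_zero
    (circleMap_ne_center one_ne_zero) (hx0 q.1))).continuousAt hscale.continuousAt

theorem continuous_weightComp (hh : ∀ x ≠ 0, DifferentiableAt ℂ h x) (d : ℤ) :
    Continuous fun v => weightComp p h d (1, v) :=
  continuous_laurentCoeff
    (continuous_comp_weightedScale_circleMap hh (x := fun v => (1, v)) (by fun_prop) (by simp)) d

variable [CompleteSpace V]

theorem differentiable_weightComp (hh : ∀ x ≠ 0, DifferentiableAt ℂ h x) (d : ℤ) :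
    Differentiable ℂ fun s => weightComp p h d (s, 1) := by
  refine differentiable_laurentCoeff (F := fun s t => h (weightedScale p t (s, 1)))
    (continuous_comp_weightedScale_circleMap hh (x := fun s => (s, 1)) (by fun_prop) (by simp))
    (fun θ s => ?_) d
  have hne : weightedScale p (circleMap 0 1 θ) (s, 1) ≠ 0 :=
    weightedScale_ne_zero (circleMap_ne_center one_ne_zero) (by simp)
  exact (hh _ hne).comp s (by unfold weightedScale; fun_prop)

theorem weightComp_weightedScale (hh : ∀ x ≠ 0, DifferentiableAt ℂ h x) (d : ℤ) {τ : ℂ}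
    (hτ : τ ≠ 0) {x : ℂ × ℂ} (hx : x ≠ 0) :
    weightComp p h d (weightedScale p τ x) = τ ^ d • weightComp p h d x := by
  simp only [weightComp, weightedScale_weightedScale]
  exact laurentCoeff_comp_mul_right
    (fun z hz => differentiableAt_comp_weightedScale hh hx hz) d hτ

theorem weightComp_mk (hh : ∀ x ≠ 0, DifferentiableAt ℂ h x) (d : ℤ) (u : ℂ) {v : ℂ}
    (hv : v ≠ 0) : weightComp p h d (u, v) = v ^ d • weightComp p h d (u / v ^ p, 1) := by
  rw [← weightComp_weightedScale hh d hv (by simp), ← mk_eq_weightedScale u hv]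

theorem eq_sum_weightComp (hh : ∀ x ≠ 0, DifferentiableAt ℂ h x) {x : ℂ × ℂ} (hx : x ≠ 0)
    (S : Finset ℤ) (hS : ∀ d ∉ S, weightComp p h d x = 0) :
    h x = ∑ d ∈ S, weightComp p h d x := by
  simpa only [weightedScale_one, weightComp] using
    apply_one_eq_sum_laurentCoeff (continuousOn_comp_weightedScale hh hx) S hS

theorem exists_norm_weightComp_le (hp : p ≠ 0) (hh : ∀ x ≠ 0, DifferentiableAt ℂ h x) (d : ℤ) :
    ∃ C, ∀ s : ℂ, 1 ≤ ‖s‖ → ‖weightComp p h d (s, 1)‖ ≤ C * ‖s‖ ^ d.natAbs := by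
  obtain ⟨C, hC⟩ := (isCompact_closedBall (0 : ℂ) 1).exists_bound_of_continuousOn
    (continuous_weightComp (p := p) hh d).continuousOn
  refine ⟨C, fun s hs => ?_⟩
  obtain ⟨t, ht, rfl⟩ := exists_ne_zero_pow_eq hp (norm_pos_iff.mp (one_pos.trans_le hs))
  have ht1 : 1 ≤ ‖t‖ := by
    rwa [norm_pow, one_le_pow_iff_of_nonneg (norm_nonneg t) hp] at hs
  have hscale : ((t ^ p, 1) : ℂ × ℂ) = weightedScale p t (1, t⁻¹) := by
    simp [weightedScale, ht]
  have hpow : ‖t ^ d‖ ≤ ‖t ^ p‖ ^ d.natAbs := by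
    calc ‖t ^ d‖ = ‖t‖ ^ d := norm_zpow t d
      _ ≤ ‖t‖ ^ (d.natAbs : ℤ) := zpow_le_zpow_right₀ ht1 Int.le_natAbs
      _ = ‖t‖ ^ d.natAbs := zpow_natCast _ _
      _ ≤ ‖t ^ p‖ ^ d.natAbs := by
        rw [norm_pow]
        gcongr
        exact le_self_pow₀ ht1 hp
  have hbound := hC t⁻¹ (by
    rw [mem_closedBall_zero_iff, norm_inv]
    exact inv_le_one_of_one_le₀ ht1)
  rw [hscale, weightComp_weightedScale hh d ht (by simp), norm_smul, mul_comm]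
  exact mul_le_mul hbound hpow (norm_nonneg _) ((norm_nonneg _).trans hbound)

theorem iteratedDeriv_weightComp_eq_zero (hp : p ≠ 0) (hh : ∀ x ≠ 0, DifferentiableAt ℂ h x)
    (d : ℤ) : iteratedDeriv (d.natAbs + 1) (fun s => weightComp p h d (s, 1)) = 0 := by
  obtain ⟨C, hC⟩ := exists_norm_weightComp_le hp hh d
  exact iteratedDeriv_eq_zero_of_growth (differentiable_weightComp hh d) hC

theorem weightComp_zero_mk (hp : p ≠ 0) (hh : ∀ x ≠ 0, DifferentiableAt ℂ h x) (u : ℂ) {v : ℂ}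
    (hv : v ≠ 0) : weightComp p h 0 (u, v) = weightComp p h 0 (0, 1) := by
  rw [weightComp_mk hh 0 u hv, zpow_zero, one_smul]
  refine is_const_of_deriv_eq_zero (differentiable_weightComp hh 0) (fun t => ?_) _ 0
  simpa using congrFun (iteratedDeriv_weightComp_eq_zero hp hh 0) t

theorem exists_weightComp_ne_zero (hp : p ≠ 0) (hh : ∀ x ≠ 0, DifferentiableAt ℂ h x) {u : ℂ}
    (hu : u ≠ 0) (hne : h (u, 0) ≠ h (1, 0)) : ∃ d ≠ 0, weightComp p h d (1, 0) ≠ 0 := by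
  contrapose! hne
  suffices hconst : ∀ u ≠ 0, h (u, 0) = weightComp p h 0 (1, 0) from
    (hconst u hu).trans (hconst 1 one_ne_zero).symm
  intro u hu
  obtain ⟨t, ht, rfl⟩ := exists_ne_zero_pow_eq hp hu
  have hcomp (d : ℤ) : weightComp p h d (t ^ p, 0) = t ^ d • weightComp p h d (1, 0) := by
    rw [← weightComp_weightedScale hh d ht (by simp), weightedScale, mul_one, mul_zero]
  rw [eq_sum_weightComp hh (by simpa using hu) {0} fun d hd => by
    rw [hcomp, hne d (by simpa using hd), smul_zero], Finset.sum_singleton, hcomp, zpow_zero,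
    one_smul]

variable {ρ ℓ : ℂ} {L : V →L[ℂ] V} {b : V}

theorem weightComp_equivariant (hh : ∀ x ≠ 0, DifferentiableAt ℂ h x) (hρ : ρ ≠ 0)
    (heq : ∀ x ≠ 0, h (jordanMap p ρ ℓ x) = L (h x) + b) {d : ℤ} (hd : d ≠ 0) (s : ℂ) :
    weightComp p h d (s + ℓ / ρ ^ p, 1) = (ρ ^ (-d) • L) (weightComp p h d (s, 1)) := by
  have hs : ((s, 1) : ℂ × ℂ) ≠ 0 := by simp
  have hcont := continuousOn_comp_weightedScale (p := p) hh hs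
  have hcircle : Set.EqOn (fun t => h (weightedScale p t (jordanMap p ρ ℓ (s, 1))))
      (fun t => L (h (weightedScale p t (s, 1))) + b) (sphere 0 1) := fun t ht => by
    simp only [weightedScale_jordanMap]
    exact heq _ (weightedScale_ne_zero (ne_of_mem_sphere ht one_ne_zero) hs)
  have hjordan : weightComp p h d (jordanMap p ρ ℓ (s, 1)) = L (weightComp p h d (s, 1)) := by
    rw [weightComp, weightComp, ← laurentCoeff_clm hcont]
    refine Eq.trans ?_ (laurentCoeff_add_const (L.continuous.comp_continuousOn hcont) b hd)
    refine Real.circleAverage_congr_sphere fun t ht => ?_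
    rw [abs_one] at ht
    exact congrArg (t ^ (-d) • ·) (hcircle ht)
  rw [smul_apply, ← hjordan, jordanMap_mk_one s ℓ hρ, weightComp_weightedScale hh d hρ (by simp),
    smul_smul, ← zpow_add₀ hρ, neg_add_cancel, zpow_zero, one_smul]

theorem weightComp_eq_affine_of_equivariant (hp : p ≠ 0) (hh : ∀ x ≠ 0, DifferentiableAt ℂ h x)
    (hρ : ρ ≠ 0) (hℓ : ℓ ≠ 0) (heq : ∀ x ≠ 0, h (jordanMap p ρ ℓ x) = L (h x) + b) {d : ℤ}
    (hL : UnipotentOfJordanBlock (ρ ^ (-d) • L)) (hd : d ≠ 0)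
    (hne : weightComp p h d (1, 0) ≠ 0) :
    d = p ∧ (ρ ^ (-d) • L - 1) ^ 2 = 0 ∧
      ∃ a c : V, ∀ s, weightComp p h d (s, 1) = a + s • c := by
  obtain ⟨a, c, hac, hunip⟩ := eq_affine_of_equivariant (differentiable_weightComp hh d)
    (iteratedDeriv_weightComp_eq_zero hp hh d) (div_ne_zero hℓ (pow_ne_zero p hρ)) hL
    (weightComp_equivariant hh hρ heq hd)
  obtain ⟨hdp, hc⟩ := weight_eq_of_continuous (p := p) (continuous_weightComp hh d) hne hd
    (a := a) (c := c) fun v hv => by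
      rw [weightComp_mk hh d 1 hv, hac, smul_add, smul_smul, zpow_sub₀ hv, zpow_natCast,
        mul_one_div]
  exact ⟨hdp, hunip hc, a, c, hac⟩

theorem weightComp_eq_zero_of_ne (hp : p ≠ 0) (hh : ∀ x ≠ 0, DifferentiableAt ℂ h x)
    (hρ : ρ ≠ 0) (hρ1 : ‖ρ‖ ≠ 1) (heq : ∀ x ≠ 0, h (jordanMap p ρ ℓ x) = L (h x) + b) {d d' : ℤ}
    (hunip : (ρ ^ (-d) • L - 1) ^ 2 = 0) (hd' : d' ≠ 0) (hne : d' ≠ d) (s : ℂ) :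
    weightComp p h d' (s, 1) = 0 := by
  have hκ : ρ ^ (d - d') ≠ 1 := fun h1 => hne <| by
    have hnorm := congrArg norm h1
    rw [norm_zpow, norm_one, zpow_eq_one_iff_right₀ (norm_nonneg ρ) hρ1] at hnorm
    omega
  refine congrFun (eq_zero_of_equivariant_of_sq_sub_one_eq_zero (differentiable_weightComp hh d')
    (iteratedDeriv_weightComp_eq_zero hp hh d') (μ := ℓ / ρ ^ p) hκ hunip fun s => ?_) s
  rw [weightComp_equivariant hh hρ heq hd', smul_smul, ← zpow_add₀ hρ]
  congr 3
  ring

/-- Continuity on the line `v = 0` forces the component of some weight `d ≠ 0` to have degree one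
and `d = p`. Then `ρ ^ (-p) • L` is unipotent, so that no other nonzero weight can occur. -/
theorem eq_affine_pow_of_equivariant (hp : p ≠ 0) (hh : ∀ x ≠ 0, DifferentiableAt ℂ h x)
    (hρ : ρ ≠ 0) (hρ1 : ‖ρ‖ ≠ 1) (hℓ : ℓ ≠ 0)
    (heq : ∀ x ≠ 0, h (jordanMap p ρ ℓ x) = L (h x) + b)
    (hL : ∀ d : ℤ, UnipotentOfJordanBlock (ρ ^ d • L)) {u₀ : ℂ} (hu₀ : u₀ ≠ 0)
    (hne : h (u₀, 0) ≠ h (1, 0)) :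
    ∃ c₀ c a : V, ∀ u v : ℂ, v ≠ 0 → h (u, v) = u • c + v ^ p • a + c₀ := by
  obtain ⟨d, hd, hd0⟩ := exists_weightComp_ne_zero hp hh hu₀ hne
  obtain ⟨hdp, hunip, a, c, hac⟩ :=
    weightComp_eq_affine_of_equivariant hp hh hρ hℓ heq (hL (-d)) hd hd0
  refine ⟨weightComp p h 0 (0, 1), c, a, fun u v hv => ?_⟩
  have hvanish (d' : ℤ) (hd' : d' ∉ ({d, 0} : Finset ℤ)) : weightComp p h d' (u, v) = 0 := by
    rw [Finset.mem_insert, Finset.mem_singleton, not_or] at hd'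
    rw [weightComp_mk hh d' u hv, weightComp_eq_zero_of_ne hp hh hρ hρ1 heq hunip hd'.2 hd'.1,
      smul_zero]
  have htop : weightComp p h d (u, v) = u • c + v ^ p • a := by
    rw [weightComp_mk hh d u hv, hac, hdp, zpow_natCast, smul_add, smul_smul,
      mul_div_cancel₀ _ (pow_ne_zero p hv), add_comm]
  rw [eq_sum_weightComp hh (by simp [hv]) {d, 0} hvanish, Finset.sum_pair hd, htop,
    weightComp_zero_mk hp hh u hv]

end Weighted

/-! ### Nonexistence of affine structures in case B -/

theorem sq_sub_one_eq_zero_of_jordanBlock {K V : Type*} [DivisionRing K] [AddCommGroup V]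
    [Module K V] (hV : Module.finrank K V = 2) (B : Module.End K V) {v w : V} (hw : w ≠ 0)
    (hBw : B w = w) (hBv : B v = v + w) : (B - 1) ^ 2 = 0 := by
  have hindep : LinearIndependent K ![w, v] := by
    refine LinearIndependent.pair_iff.mpr fun s t hst => ?_
    have hBst := congrArg B hst
    rw [map_add, map_smul, map_smul, hBw, hBv, smul_add, ← add_assoc, hst, zero_add,
      map_zero] at hBst
    have ht : t = 0 := (smul_eq_zero.mp hBst).resolve_right hw
    rw [ht, zero_smul, add_zero] at hst
    exact ⟨(smul_eq_zero.mp hst).resolve_right hw, ht⟩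
  have hspan := hindep.span_eq_top_of_card_eq_finrank (by rw [hV, Fintype.card_fin])
  refine LinearMap.ext_on_range hspan fun i => ?_
  fin_cases i <;> simp [sq, hBw, hBv]

section SliceConjugation

variable {J : ℍ[ℝ]}

/-- The complex coordinates on `ℍ²` in which left multiplication by `sliceEmb J z` is
multiplication by `z`. -/
def sliceEquivH2 (hJ : J ∈ imagUnits) : H2 ≃L[ℝ] (ℂ × ℂ) × (ℂ × ℂ) :=
  (sliceEquiv hJ).prodCongr (sliceEquiv hJ)

theorem sliceEquivH2_smul (hJ : J ∈ imagUnits) (z : ℂ) (x : H2) :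
    sliceEquivH2 hJ (sliceEmb J z • x) = z • sliceEquivH2 hJ x :=
  Prod.ext (sliceEquiv_sliceEmb_mul hJ z x.1) (sliceEquiv_sliceEmb_mul hJ z x.2)

theorem sliceEquivH2_symm_smul (hJ : J ∈ imagUnits) (z : ℂ) (y : (ℂ × ℂ) × (ℂ × ℂ)) :
    (sliceEquivH2 hJ).symm (z • y) = sliceEmb J z • (sliceEquivH2 hJ).symm y := by
  rw [ContinuousLinearEquiv.symm_apply_eq, sliceEquivH2_smul,
    ContinuousLinearEquiv.apply_symm_apply]

/-- A left linear endomorphism of `ℍ²` as a complex linear map in the coordinates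
`sliceEquivH2`. -/
def sliceConj (hJ : J ∈ imagUnits) (B : Module.End ℍ[ℝ] H2) :
    (ℂ × ℂ) × (ℂ × ℂ) →L[ℂ] (ℂ × ℂ) × (ℂ × ℂ) :=
  LinearMap.toContinuousLinearMap
    { toFun := fun y => sliceEquivH2 hJ (B ((sliceEquivH2 hJ).symm y))
      map_add' := fun y z => by simp only [map_add]
      map_smul' := fun z y => by
        rw [sliceEquivH2_symm_smul, map_smul, sliceEquivH2_smul, RingHom.id_apply] }

theorem sliceConj_sliceEquivH2 (hJ : J ∈ imagUnits) (B : Module.End ℍ[ℝ] H2) (x : H2) :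
    sliceConj hJ B (sliceEquivH2 hJ x) = sliceEquivH2 hJ (B x) :=
  congrArg (fun y => sliceEquivH2 hJ (B y)) ((sliceEquivH2 hJ).symm_apply_apply x)

theorem smul_sliceConj (hJ : J ∈ imagUnits) (r : ℝ) (B : Module.End ℍ[ℝ] H2) :
    (r : ℂ) • sliceConj hJ B = sliceConj hJ (r • B) := by
  refine ContinuousLinearMap.ext fun y => ?_
  obtain ⟨x, rfl⟩ := (sliceEquivH2 hJ).surjective y
  rw [smul_apply, sliceConj_sliceEquivH2, sliceConj_sliceEquivH2, Complex.coe_smul,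
    LinearMap.smul_apply, map_smul]

theorem unipotentOfJordanBlock_sliceConj (hJ : J ∈ imagUnits) (B : Module.End ℍ[ℝ] H2) :
    UnipotentOfJordanBlock (sliceConj hJ B) := by
  intro v w hw hBw hBv
  obtain ⟨v, rfl⟩ := (sliceEquivH2 hJ).surjective v
  obtain ⟨w, rfl⟩ := (sliceEquivH2 hJ).surjective w
  rw [sliceConj_sliceEquivH2] at hBw hBv
  rw [← map_add] at hBv
  have hB : (B - 1) ^ 2 = 0 := sq_sub_one_eq_zero_of_jordanBlock
    (by rw [Module.finrank_prod, Module.finrank_self]) B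
    (by rintro rfl; exact hw (map_zero _)) ((sliceEquivH2 hJ).injective hBw)
    ((sliceEquivH2 hJ).injective hBv)
  refine ContinuousLinearMap.ext fun y => ?_
  obtain ⟨x, rfl⟩ := (sliceEquivH2 hJ).surjective y
  have hBx := congrArg (sliceEquivH2 hJ) (LinearMap.congr_fun hB x)
  simpa [sq, sliceConj_sliceEquivH2] using hBx

/-- The left linear map `x ↦ x A`. -/
def rowMulEnd (A : Matrix (Fin 2) (Fin 2) ℍ[ℝ]) : Module.End ℍ[ℝ] H2 where
  toFun := rowMulCLM A
  map_add' := map_add _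
  map_smul' := rowMulCLM_smul A

theorem slicePt_jordanMap (hJ : J ∈ imagUnits) (p : ℕ) (r : ℝ) (ℓ : ℂ) (x : ℂ × ℂ) :
    slicePt J (jordanMap p r ℓ x) =
      hopfMap p ((r : ℍ[ℝ]) ^ p) r (sliceEmb J ℓ) (slicePt J x) := by
  simp only [slicePt, jordanMap, hopfMap, sliceEmb_add, sliceEmb_mul hJ, sliceEmb_pow hJ,
    sliceEmb_ofReal]
  rw [← Quaternion.coe_pow, Quaternion.coe_commutes, Quaternion.coe_commutes]

theorem exists_slicePt_mem_ne {U : Set H2} (hJ : J ∈ imagUnits)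
    (hU : U ∈ 𝓝 (slicePt J (1, 0))) :
    ∃ u : ℂ, u ≠ 0 ∧ slicePt J (u, 0) ∈ U ∧ slicePt J (u, 0) ≠ slicePt J (1, 0) := by
  have hcont : Continuous fun u : ℂ => slicePt J (u, 0) :=
    (continuous_slicePt J).comp (by fun_prop)
  have hmem : ∀ᶠ u in 𝓝[≠] (1 : ℂ), u ≠ 0 ∧ slicePt J (u, 0) ∈ U :=
    ((eventually_ne_nhds one_ne_zero).and (hcont.continuousAt.eventually hU)).filter_mono
      nhdsWithin_le_nhds
  obtain ⟨u, ⟨hu0, huU⟩, hu1⟩ := (hmem.and self_mem_nhdsWithin).exists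
  exact ⟨u, hu0, huU, fun h => hu1 (congrArg Prod.fst (slicePt_injective hJ h))⟩

theorem exists_eq_affine_pow_on_slice {p : ℕ} (hp : p ≠ 0) {r : ℝ} (hr : r ≠ 0) (hr1 : |r| ≠ 1)
    (hJ : J ∈ imagUnits) {ℓ : ℂ} (hℓ : ℓ ≠ 0) {dev : H2 → H2}
    (hreg : ∀ x ≠ 0, SliceRegularAt dev x) (hinj : ∀ x ≠ 0, ∃ U ∈ 𝓝 x, Set.InjOn dev U)
    {A : Matrix (Fin 2) (Fin 2) ℍ[ℝ]} {b : H2}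
    (heq : ∀ x ≠ 0, dev (hopfMap p ((r : ℍ[ℝ]) ^ p) r (sliceEmb J ℓ) x) = affineH2 A b (dev x)) :
    ∃ c₀ c a : H2, ∀ u v : ℂ, v ≠ 0 →
      dev (slicePt J (u, v)) = sliceEmb J u • c + sliceEmb J v ^ p • a + c₀ := by
  let S := sliceEquivH2 hJ
  have hholo (z : ℂ × ℂ) (hz : z ≠ 0) : DifferentiableAt ℂ (fun z => S (dev (slicePt J z))) z :=
    (hreg _ (slicePt_ne_zero hJ hz)).differentiableAt_slice hJ
  have hequiv (x : ℂ × ℂ) (hx : x ≠ 0) : S (dev (slicePt J (jordanMap p r ℓ x))) =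
      sliceConj hJ (rowMulEnd A) (S (dev (slicePt J x))) + S b := by
    rw [slicePt_jordanMap hJ, heq _ (slicePt_ne_zero hJ hx), affineH2_eq, map_add,
      sliceConj_sliceEquivH2]
    rfl
  have hunip (d : ℤ) : UnipotentOfJordanBlock ((r : ℂ) ^ d • sliceConj hJ (rowMulEnd A)) := by
    rw [← Complex.ofReal_zpow, smul_sliceConj]
    exact unipotentOfJordanBlock_sliceConj hJ _
  obtain ⟨U, hU, hUinj⟩ := hinj (slicePt J (1, 0)) (slicePt_ne_zero hJ (by simp))
  obtain ⟨u₀, hu₀, hu₀U, hne⟩ := exists_slicePt_mem_ne hJ hU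
  obtain ⟨c₀, c, a, hform⟩ := eq_affine_pow_of_equivariant hp hholo
    (Complex.ofReal_ne_zero.mpr hr) (by rwa [Complex.norm_real]) hℓ hequiv hunip hu₀
    fun h => hne (hUinj hu₀U (mem_of_mem_nhds hU) (S.injective h))
  refine ⟨S.symm c₀, S.symm c, S.symm a, fun u v hv => S.injective ?_⟩
  rw [hform u v hv, map_add, map_add, ← sliceEmb_pow hJ, sliceEquivH2_smul, sliceEquivH2_smul]
  simp only [S, ContinuousLinearEquiv.apply_symm_apply]

end SliceConjugation

/-- The power map is constant on the sphere of a nonreal `p`-th root of `-1`. -/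
theorem exists_pow_eq_of_mem_nhds {p : ℕ} (hp : 1 < p) :
    ∃ q : ℍ[ℝ], q ≠ 0 ∧ ∀ U ∈ 𝓝 q, ∃ q' ∈ U, q' ≠ q ∧ q' ^ p = q ^ p := by
  have hp0 : (p : ℂ) ≠ 0 := Nat.cast_ne_zero.mpr (by omega)
  obtain ⟨ζ, hζp, hζim⟩ : ∃ ζ : ℂ, ζ ^ p = -1 ∧ ζ.im ≠ 0 := by
    refine ⟨Complex.exp ((Real.pi / p : ℝ) * Complex.I), ?_, ?_⟩
    · rw [← Complex.exp_nat_mul, ← Complex.exp_pi_mul_I]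
      congr 1
      push_cast
      field_simp
    · rw [Complex.exp_ofReal_mul_I_im]
      have hp1 : (1 : ℝ) < p := Nat.one_lt_cast.mpr hp
      exact (Real.sin_pos_of_pos_of_lt_pi (by positivity) (div_lt_self Real.pi_pos hp1)).ne'
  have hpow (K : ℍ[ℝ]) (hK : K ∈ imagUnits) : sliceEmb K ζ ^ p = -1 := by
    rw [← sliceEmb_pow hK, hζp]
    simp [sliceEmb]
  refine ⟨sliceEmb unitI ζ, fun h => ?_, fun U hU => ?_⟩
  · have hzero := sliceEmb_injective unitI_mem_imagUnits (h.trans (sliceEmb_zero unitI).symm)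
    exact hζim (by rw [hzero, Complex.zero_im])
  · have hcont : Continuous fun K => sliceEmb K ζ := by
      unfold sliceEmb
      fun_prop
    obtain ⟨K, hK, hKU, hne⟩ := exists_mem_imagUnits_ne_of_mem_nhds unitI_mem_imagUnits
      (hcont.continuousAt.preimage_mem_nhds hU)
    refine ⟨_, hKU, fun h => hne ?_, by rw [hpow K hK, hpow _ unitI_mem_imagUnits]⟩
    exact smul_right_injective _ hζim (add_left_cancel h)

theorem not_injOn_affine_pow {p : ℕ} (hp : 1 < p) (c a c₀ : H2) :
    ∃ x : H2, x ≠ 0 ∧ ∀ U ∈ 𝓝 x, ¬ Set.InjOn (fun x : H2 => x.1 • c + x.2 ^ p • a + c₀) U := by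
  obtain ⟨q, hq, hqU⟩ := exists_pow_eq_of_mem_nhds hp
  refine ⟨(0, q), by simpa using hq, fun U hU hinj => ?_⟩
  obtain ⟨q', hq'U, hne, hpow⟩ := hqU _
    ((Continuous.prodMk_right (0 : ℍ[ℝ])).continuousAt.preimage_mem_nhds hU)
  exact hne (congrArg Prod.snd (hinj hq'U (mem_of_mem_nhds hU) (by simp only [hpow])))

section CaseB

variable {p : ℕ} {α β l : ℍ[ℝ]} {hp : p ≠ 0} {hα : 0 < ‖α‖} {hβ : 0 < ‖β‖}

theorem AdmitsSliceRegularAffineCharts.exists_hopf_developing (htri : HasTriangularIterates p β l)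
    (hαβ : ‖α‖ ≤ ‖β‖) (hβ1 : ‖β‖ < 1)
    (h : AdmitsSliceRegularAffineCharts (hopfAtlas p α β l hp hα hβ)) :
    ∃ dev : H2 → H2, (∀ x ≠ 0, SliceRegularAt dev x) ∧
      (∀ x ≠ 0, ∃ U ∈ 𝓝 x, Set.InjOn dev U) ∧
      ∃ (A : Matrix (Fin 2) (Fin 2) ℍ[ℝ]) (b : H2), ∀ x ≠ 0,
        dev (hopfMap p α β l x) = affineH2 A b (dev x) := by
  have := (isSliceRegularGroup_hopfGroup (hp := hp) (hα := hα) (hβ := hβ)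
    htri).continuousConstSMul
  obtain ⟨dev, hreg, hinj, hequiv⟩ := AdmitsSliceRegularAffineCharts.exists_equivariant_developing
    (hasCircularSections_hopfGroup htri hαβ hβ1)
    (isHopfSurface_hopfAtlas htri hαβ hβ1).covering.isLocalHomeomorph h
  obtain ⟨A, b, heq⟩ := hequiv _ (Subgroup.mem_zpowers _)
  exact ⟨dev, hreg, hinj, A, b, fun x hx => heq ⟨x, hx⟩⟩

theorem HopfCaseB.not_admitsSliceRegularAffineCharts (hB : HopfCaseB p α β l) (hαβ : ‖α‖ ≤ ‖β‖)
    (hβ1 : ‖β‖ < 1) : ¬ AdmitsSliceRegularAffineCharts (hopfAtlas p α β l hp hα hβ) := by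
  intro h
  obtain ⟨dev, hreg, hinj, A, b, heq⟩ :=
    h.exists_hopf_developing hB.hasTriangularIterates hαβ hβ1
  obtain ⟨hl, hp1, ⟨r, rfl⟩, rfl⟩ := hB
  obtain ⟨J, hJ, hlJ⟩ := exists_sliceEmb_sliceCoord l
  have hℓ : sliceCoord l ≠ 0 := fun h0 => hl (by rw [hlJ, h0, sliceEmb_zero])
  rw [hlJ] at heq
  obtain ⟨c₀, c, a, hslice⟩ := exists_eq_affine_pow_on_slice hp (by simpa using hβ)
    (by simpa using hβ1.ne) hJ hℓ hreg hinj heq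
  have hx₀ : slicePt J ((0 : ℝ), (1 : ℝ)) ≠ 0 := slicePt_ne_zero hJ (by simp)
  have hnear : ∀ᶠ z : ℂ × ℂ in 𝓝 (((0 : ℝ) : ℂ), ((1 : ℝ) : ℂ)), z.2 ≠ 0 :=
    continuous_snd.continuousAt.eventually_ne (by simp)
  have hdev₀ := (hreg _ hx₀).eventuallyEq_of_slice hJ (sliceRegularAt_affine_pow p c a c₀ _)
    (hnear.mono fun z hz => hslice z.1 z.2 hz)
  obtain ⟨x, hx, hx_inj⟩ := not_injOn_affine_pow hp1 c a c₀
  have hdev := eventuallyEq_of_forall_sliceRegularAt hreg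
    (fun y _ => sliceRegularAt_affine_pow p c a c₀ y) hx₀ hdev₀ hx
  obtain ⟨U, hU, hUinj⟩ := hinj x hx
  exact hx_inj _ (Filter.inter_mem hU hdev)
    ((hUinj.mono Set.inter_subset_left).congr fun _ hy => hy.2)

end CaseB

end

theorem theorem2p1 (p : ℕ) (hp : p ≠ 0) (α β l : ℍ[ℝ])
    (hα : 0 < ‖α‖) (hαβ : ‖α‖ ≤ ‖β‖) (hβ : ‖β‖ < 1) (hres : (α - β ^ p) * l = 0)
    (hcase : HopfCaseA p α β l ∨ HopfCaseB p α β l) :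
    (∀ γ ∈ hopfGroup p α β l hp hα (hα.trans_le hαβ),
      SliceRegularOnPunctured (fun y => (γ y : H2)) Set.univ) ∧
    IsHopfSurface (hopfAtlas p α β l hp hα (hα.trans_le hαβ))
      (hopfProj p α β l hp hα (hα.trans_le hαβ)) ∧
    (AdmitsAffineStructure (hopfAtlas p α β l hp hα (hα.trans_le hαβ)) ↔ HopfCaseA p α β l) ∧
    (AdmitsSliceRegularAffineCharts (hopfAtlas p α β l hp hα (hα.trans_le hαβ)) ↔
      HopfCaseA p α β l) := by
  have htri : HasTriangularIterates p β l :=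
    hcase.elim HopfCaseA.hasTriangularIterates HopfCaseB.hasTriangularIterates
  have caseA_of_affineCharts
      (h : AdmitsSliceRegularAffineCharts (hopfAtlas p α β l hp hα (hα.trans_le hαβ))) :
      HopfCaseA p α β l :=
    hcase.resolve_right fun hB => hB.not_admitsSliceRegularAffineCharts hαβ hβ h
  have affine_of_caseA (hA : HopfCaseA p α β l) :
      AdmitsAffineStructure (hopfAtlas p α β l hp hα (hα.trans_le hαβ)) :=
    admitsAffineStructure_hopfAtlas hA hαβ hβ
  exact ⟨fun γ hγ => (isSliceRegularGroup_hopfGroup htri).sliceRegularOnPunctured hγ _,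
    isHopfSurface_hopfAtlas htri hαβ hβ,
    ⟨fun h => caseA_of_affineCharts h.admitsSliceRegularAffineCharts, affine_of_caseA⟩,
    ⟨caseA_of_affineCharts, fun hA => (affine_of_caseA hA).admitsSliceRegularAffineCharts⟩⟩
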